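/- Fix a finite alphabet $\Sigma$ and an infinite set $\mathcal D$ of data values. A data word is a non-empty finite word over $\Sigma\times\mathcal D$, a data $\omega$-word is an $\omega$-word over $\Sigma\times\mathcal D$. A class of $w$ is the (non-empty) set of all positions carrying one given data value; the class successor of $i$ is the least later position in the class of $i$. The type $tp(i)\in\mathcal M=\{\mathsf P,\neg\mathsf P\}\times\{\mathsf S,\neg\mathsf S\}$ records whether the predecessor and class predecessor of $i$ exist and coincide, and whether the successor and class successor of $i$ exist and coincide. **Logic.** Formulas of the $\mu$-calculus are built from fixpoint variables, the atoms $p\in\Sigma$, $\mathsf S,\mathsf P,\mathsf{first}^c,\mathsf{first}^g,\mathsf{last}^c,\mathsf{last}^g$ and their negations, $\vee$, $\wedge$, the modalities $X^g,Y^g$ (successor, predecessor) and $X^c,Y^c$ (class successor, class predecessor), and $\mu x$, $\nu x$, with the usual semantics. The language of a sentence is the set of words whose first position satisfies it. For a set $\Psi$ of formulas let $\mathsf{Comp}^0(\Psi)=\emptyset$ and let $\mathsf{Comp}^{i+1}(\Psi)$ be the set of all $\psi(\varphi_1,\dots,\varphi_n)$ with $\psi(x_1,\dots,x_n)\in\Psi$,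 where $x_1,\dots,x_n$ are the free variables of $\psi$, and $\varphi_1,\dots,\varphi_n\in\mathsf{Comp}^i(\Psi)$; the $\mathsf{Comp}$-height of $\varphi$ in $\mathsf{Comp}(\Psi)=\bigcup_i\mathsf{Comp}^i(\Psi)$ is the least $i$ with $\varphi\in\mathsf{Comp}^i(\Psi)$. Let $\Psi$ be the set of formulas whose modalities all lie in $\{X^g,Y^g\}$ or all lie in $\{X^c,Y^c\}$ (all atoms allowed), and put $\mathrm{BMA}=\mathsf{Comp}(\Psi)$; "height" of a formula refers to this $\Psi$. Let $\Psi_0\subseteq\Psi$ consist of the formulas with modalities in $\{X^g,Y^g\}$ in which $\mathsf{first}^c,\mathsf{last}^c$ do not occur, and those with modalities in $\{X^c,Y^c\}$ in which $\mathsf{first}^g,\mathsf{last}^g$ do not occur; the height in $\mathsf{Comp}(\Psi_0)$ is called the strict height. **Cascades.** A functional letter-to-letter transducer is a nondeterministic finite-state letter-to-letter transducer (with Büchi acceptance, for $\omega$-words) that has at most one output word on each input word. A global transducer from $A$ to $B$ is such a transducer reading the word $(a_1,tp(1))(a_2,tp(2))\cdots$ over $A\times\mathcal M$ and relabelling the positions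 of $w$ by its output. A class transducer does so separately on every class, reading the restriction of that word to the class; over data $\omega$-words it is a pair, a transducer over finite words for the finite classes and a Büchi transducer for the infinite classes. The run succeeds if it succeeds on every class. A cascade of height $n\ge 0$ is a sequence of $n$ global or class transducers with matching finite alphabets, $\Sigma$ being the input alphabet; its output is obtained by applying them in sequence, and its language is the set of words on which all of them have a successful run. A cascade with output alphabet $\{0,1\}$ computes a sentence $\varphi$ if it has an output on every word and labels by $1$ exactly the positions at which $\varphi$ holds. **Theorem.** The following hold for data words and cascades over data words, and likewise for data $\omega$-words and cascades over data $\omega$-words. 1. (Equivalence.) A set of words is the language of a BMA formula if and only if it is the language of a cascade. 2. (From formulas to cascades.) If $\varphi\in\mathrm{BMA}$ has height $k$, then some cascade of height $k+1$ has the same language as $\varphi$, and some cascade of height $k+1$ computes $\varphi$. If $\varphi$ has strict height $k$, then some cascade of height exactly $k$ computes $\varphi$. 3. (From cascades to formulas.) For every cascade $\mathcal C$ of height $k$ there is a formula whose height and strict height are both $k+1$ and whose language is that of $\mathcal C$. For every letter $b$ of the output alphabet of $\mathcal C$ there is a formula $\varphi_b$ whose height and strict height are both exactly $\max(k,1)$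 such that, on every word on which $\mathcal C$ has a successful run, $\varphi_b$ holds at exactly the positions at which the output of $\mathcal C$ carries the letter $b$. -/

import Mathlib

namespace DataWords

universe u v

/-! ### Data words

A word with data is a map `w : P → A × D` on a linearly ordered set `P` of positions: `P = Fin n` for
a finite data word of length `n`, and `P = ℕ` for a data `ω`-word. -/

/-- Non-empty finite data words over the alphabet `A` with data values in `D`. -/
abbrev DataWord (A : Type) (D : Type u) : Type u := Σ n : ℕ, (Fin (n + 1) → A × D)

/-- Data `ω`-words over the alphabet `A` with data values in `D`. -/
abbrev DataOmegaWord (A : Type) (D : Type u) : Type u := ℕ → A × D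

section Positions

variable {P : Type v} [LinearOrder P] {A : Type} {D : Type u}

/-- `j` is the (global) successor of `i`. -/
def GSucc (i j : P) : Prop := i ⋖ j

/-- `j` is the class successor of `i`: the least later position with the same data value. -/
def CSucc (w : P → A × D) (i j : P) : Prop :=
  i < j ∧ (w j).2 = (w i).2 ∧ ∀ k, i < k → k < j → (w k).2 ≠ (w i).2

/-- The successor and the class successor of `i` exist and coincide. -/
def SuccMark (w : P → A × D) (i : P) : Prop := ∃ j, GSucc i j ∧ CSucc w i j

/-- The predecessor and the class predecessor of `i` exist and coincide. -/
def PredMark (w : P → A × D) (i : P) : Prop := ∃ j, GSucc j i ∧ CSucc w j i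

/-- The marking alphabet: the first bit is the predecessor mark, the second the successor mark. -/
abbrev Mark : Type := Bool × Bool

open Classical in
/-- The marked label `(a_i, tp(i))` of position `i`. -/
noncomputable def markedLabel (w : P → A × D) (i : P) : A × Mark :=
  ((w i).1, (decide (PredMark w i), decide (SuccMark w i)))

/-- The set of positions carrying the data value `d`, with the induced order. It is a class of `w`
when it is non-empty. -/
abbrev ClassOf (w : P → A × D) (d : D) : Type v := {i : P // (w i).2 = d}

end Positions

/-! ### The `μ`-calculus -/

/-- The modalities `X^g`, `X^c`, `Y^g`, `Y^c`. -/
inductive Modality where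
  | Xg | Xc | Yg | Yc

/-- Atoms: propositions (letters) and the zeroary modalities. -/
inductive Atom (A : Type) where
  | letter (a : A)
  | S | P | firstC | firstG | lastC | lastG

/-- Formulas, with fixpoint variables named by natural numbers. -/
inductive Formula (A : Type) where
  | var (x : ℕ)
  | atom (a : Atom A)
  | natom (a : Atom A)
  | modal (M : Modality) (φ : Formula A)
  | or (φ ψ : Formula A)
  | and (φ ψ : Formula A)
  | mu (x : ℕ) (φ : Formula A)
  | nu (x : ℕ) (φ : Formula A)

section Semantics

variable {P : Type v} [LinearOrder P] {A : Type} {D : Type u}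

/-- The accessibility relation of a modality. -/
def Modality.Rel (w : P → A × D) : Modality → P → P → Prop
  | .Xg => fun i j => GSucc i j
  | .Xc => fun i j => CSucc w i j
  | .Yg => fun i j => GSucc j i
  | .Yc => fun i j => CSucc w j i

/-- The set of positions at which an atom is true. -/
def Atom.sem (w : P → A × D) : Atom A → Set P
  | .letter a => {i | (w i).1 = a}
  | .S => {i | SuccMark w i}
  | .P => {i | PredMark w i}
  | .firstC => {i | ¬ ∃ j, CSucc w j i}
  | .firstG => {i | ∀ j, i ≤ j}
  | .lastC => {i | ¬ ∃ j, CSucc w i j}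
  | .lastG => {i | ∀ j, j ≤ i}

/-- The set of positions at which a formula is true, under a valuation `v` of the variables. -/
def Formula.sem (w : P → A × D) : Formula A → (ℕ → Set P) → Set P
  | .var x, v => v x
  | .atom a, _ => a.sem w
  | .natom a, _ => (a.sem w)ᶜ
  | .modal M φ, v => {i | ∃ j, M.Rel w i j ∧ j ∈ φ.sem w v}
  | .or φ ψ, v => φ.sem w v ∪ ψ.sem w v
  | .and φ ψ, v => φ.sem w v ∩ ψ.sem w v
  | .mu x φ, v => ⋂₀ {S | φ.sem w (Function.update v x S) ⊆ S}
  | .nu x φ, v => ⋃₀ {S | S ⊆ φ.sem w (Function.update v x S)}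

/-- `w, i ⊨ φ`, for a sentence `φ` (whose truth does not depend on the valuation). -/
def Formula.Holds (w : P → A × D) (i : P) (φ : Formula A) : Prop := i ∈ φ.sem w fun _ => ∅

end Semantics

namespace Formula

variable {A : Type}

/-- The data language of a sentence: the data words that satisfy it at the first position. -/
def language (D : Type u) (φ : Formula A) : Set (DataWord A D) := {w | φ.Holds w.2 0}

/-- The data `ω`-language of a sentence. -/
def omegaLanguage (D : Type u) (φ : Formula A) : Set (DataOmegaWord A D) := {w | φ.Holds w 0}

/-- The free variables of a formula. -/
def freeVars : Formula A → Set ℕ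
  | .var x => {x}
  | .atom _ => ∅
  | .natom _ => ∅
  | .modal _ φ => φ.freeVars
  | .or φ ψ => φ.freeVars ∪ ψ.freeVars
  | .and φ ψ => φ.freeVars ∪ ψ.freeVars
  | .mu x φ => φ.freeVars \ {x}
  | .nu x φ => φ.freeVars \ {x}

/-- The modalities that occur in a formula. -/
def modalities : Formula A → Set Modality
  | .var _ => ∅
  | .atom _ => ∅
  | .natom _ => ∅
  | .modal M φ => insert M φ.modalities
  | .or φ ψ => φ.modalities ∪ ψ.modalities
  | .and φ ψ => φ.modalities ∪ ψ.modalities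
  | .mu _ φ => φ.modalities
  | .nu _ φ => φ.modalities

/-- The atoms that occur in a formula, negated or not. -/
def atoms : Formula A → Set (Atom A)
  | .var _ => ∅
  | .atom a => {a}
  | .natom a => {a}
  | .modal _ φ => φ.atoms
  | .or φ ψ => φ.atoms ∪ ψ.atoms
  | .and φ ψ => φ.atoms ∪ ψ.atoms
  | .mu _ φ => φ.atoms
  | .nu _ φ => φ.atoms

/-- Simultaneous substitution of `σ x` for the free occurrences of each variable `x`. It is used only
when the formulas substituted are sentences, so that no variable can be captured. -/
def subst : Formula A → (ℕ → Formula A) → Formula A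
  | .var x, σ => σ x
  | .atom a, _ => .atom a
  | .natom a, _ => .natom a
  | .modal M φ, σ => .modal M (φ.subst σ)
  | .or φ ψ, σ => .or (φ.subst σ) (ψ.subst σ)
  | .and φ ψ, σ => .and (φ.subst σ) (ψ.subst σ)
  | .mu x φ, σ => .mu x (φ.subst (Function.update σ x (.var x)))
  | .nu x φ, σ => .nu x (φ.subst (Function.update σ x (.var x)))

end Formula

/-- The `i`-th level of the composition hierarchy over a set `Ψ` of formulas:
`Comp 0 = ∅`, and `Comp (i + 1)` consists of the formulas `ψ(φ₁, …, φₙ)` with `ψ ∈ Ψ` whose free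
variables are `x₁, …, xₙ`, and `φ₁, …, φₙ ∈ Comp i`. -/
def Comp {A : Type} (Ψ : Set (Formula A)) : ℕ → Set (Formula A)
  | 0 => ∅
  | i + 1 => {χ | ∃ ψ ∈ Ψ, ∃ σ : ℕ → Formula A,
      (∀ x ∈ ψ.freeVars, σ x ∈ Comp Ψ i) ∧ χ = ψ.subst σ}

/-- The free variables of `ψ.subst σ` come from the formulas substituted for free variables of `ψ`. -/
theorem Formula.freeVars_subst {A : Type} (ψ : Formula A) (σ : ℕ → Formula A) (s : Set ℕ)
    (h : ∀ x ∈ ψ.freeVars, (σ x).freeVars ⊆ s) : (ψ.subst σ).freeVars ⊆ s := by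
  induction ψ generalizing σ s with
  | var x => exact h x rfl
  | atom a => exact Set.empty_subset _
  | natom a => exact Set.empty_subset _
  | modal M φ ih => exact ih σ s h
  | or φ ψ ih1 ih2 =>
    exact Set.union_subset (ih1 σ s fun x hx => h x (Or.inl hx))
      (ih2 σ s fun x hx => h x (Or.inr hx))
  | and φ ψ ih1 ih2 =>
    exact Set.union_subset (ih1 σ s fun x hx => h x (Or.inl hx))
      (ih2 σ s fun x hx => h x (Or.inr hx))
  | mu x φ ih | nu x φ ih =>
    have := ih (Function.update σ x (.var x)) (insert x s) (by
      intro y hy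
      by_cases e : y = x
      · subst e; simp [Formula.freeVars]
      · rw [Function.update_of_ne e]
        exact (h y ⟨hy, e⟩).trans (Set.subset_insert _ _))
    intro y hy
    exact (this hy.1).resolve_left hy.2

/-- All formulas of the composition hierarchy are sentences. -/
theorem freeVars_of_mem_Comp {A : Type} {Ψ : Set (Formula A)} :
    ∀ {i : ℕ} {χ : Formula A}, χ ∈ Comp Ψ i → χ.freeVars = ∅
  | 0, _, h => h.elim
  | i + 1, χ, ⟨ψ, _, σ, hσ, e⟩ => by
    subst e
    exact Set.subset_empty_iff.mp
      (ψ.freeVars_subst σ ∅ fun x hx => (freeVars_of_mem_Comp (hσ x hx)).subset)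

/-- `φ` belongs to `Comp(Ψ)`, and its `Comp`-height in `Comp(Ψ)` is `k`. -/
def HasCompHeight {A : Type} (Ψ : Set (Formula A)) (φ : Formula A) (k : ℕ) : Prop :=
  IsLeast {i | φ ∈ Comp Ψ i} k

/-- The formulas all of whose unary modalities are in `M`; all atoms are allowed. -/
def Formulas (A : Type) (M : Set Modality) : Set (Formula A) := {φ | φ.modalities ⊆ M}

/-- The purely global and the purely class formulas. -/
def modeBasis (A : Type) : Set (Formula A) :=
  Formulas A {.Xg, .Yg} ∪ Formulas A {.Xc, .Yc}

/-- The bounded mode alternation fragment. -/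
def BMA (A : Type) : Set (Formula A) := ⋃ i, Comp (modeBasis A) i

/-- The purely global formulas without `first^c`, `last^c`, and the purely class formulas without
`first^g`, `last^g`. -/
def strictModeBasis (A : Type) : Set (Formula A) :=
  {φ ∈ Formulas A {.Xg, .Yg} | Atom.firstC ∉ φ.atoms ∧ Atom.lastC ∉ φ.atoms} ∪
    {φ ∈ Formulas A {.Xc, .Yc} | Atom.firstG ∉ φ.atoms ∧ Atom.lastG ∉ φ.atoms}

/-! ### Transducers -/

/-- A nondeterministic finite-state letter-to-letter transducer. -/
structure Transducer (A B : Type) : Type 1 where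
  State : Type
  finite_state : Finite State
  init : Set State
  step : State → A → B → State → Prop
  accept : Set State

namespace Transducer

variable {A B : Type}

/-- `v` is an output on the finite word `u`: there is a run from an initial state to an accepting
state that reads `u` and writes `v`. -/
def Outputs (T : Transducer A B) {n : ℕ} (u : Fin n → A) (v : Fin n → B) : Prop :=
  ∃ r : Fin (n + 1) → T.State, r 0 ∈ T.init ∧
    (∀ i : Fin n, T.step (r i.castSucc) (u i) (v i) (r i.succ)) ∧ r (Fin.last n) ∈ T.accept

/-- `v` is an output on the `ω`-word `u` under the Büchi acceptance condition. -/
def OmegaOutputs (T : Transducer A B) (u : ℕ → A) (v : ℕ → B) : Prop :=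
  ∃ r : ℕ → T.State, r 0 ∈ T.init ∧ (∀ i, T.step (r i) (u i) (v i) (r (i + 1))) ∧
    ∃ᶠ i in Filter.atTop, r i ∈ T.accept

end Transducer

/-- A functional letter-to-letter transducer over finite words. -/
structure FunctionalTransducer (A B : Type) : Type 1 extends Transducer A B where
  functional : ∀ (n : ℕ) (u : Fin n → A) (v v' : Fin n → B),
    toTransducer.Outputs u v → toTransducer.Outputs u v' → v = v'

/-- A functional letter-to-letter Büchi transducer over `ω`-words. -/
structure FunctionalBuchiTransducer (A B : Type) : Type 1 extends Transducer A B where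
  functional : ∀ (u : ℕ → A) (v v' : ℕ → B),
    toTransducer.OmegaOutputs u v → toTransducer.OmegaOutputs u v' → v = v'

/-- Global and class transducers over data words. -/
inductive DataTransducer (A B : Type) : Type 1 where
  | glob (G : FunctionalTransducer (A × Mark) B)
  | cls (L : FunctionalTransducer (A × Mark) B)

/-- Global and class transducers over data `ω`-words. -/
inductive DataOmegaTransducer (A B : Type) : Type 1 where
  | glob (G : FunctionalBuchiTransducer (A × Mark) B)
  | cls (L : FunctionalTransducer (A × Mark) B) (Lω : FunctionalBuchiTransducer (A × Mark) B)

section Stages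

variable {A B : Type} {D : Type u}

/-- `L` maps the marked class projection of `w` for each finite class to the corresponding class
projection of `w'`. The unique order isomorphism `e` lists the positions of the class in order. -/
def OutputsOnFiniteClasses {P : Type v} [LinearOrder P] (L : FunctionalTransducer (A × Mark) B)
    (w : P → A × D) (w' : P → B × D) : Prop :=
  ∀ d ∈ Set.range (fun i => (w i).2), ∀ (m : ℕ) (e : Fin m ≃o ClassOf w d),
    L.Outputs (fun k => markedLabel w (e k).1) (fun k => (w' (e k).1).1)

/-- The analogue for infinite classes. -/
def OutputsOnInfiniteClasses {P : Type v} [LinearOrder P]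
    (L : FunctionalBuchiTransducer (A × Mark) B) (w : P → A × D) (w' : P → B × D) : Prop :=
  ∀ d ∈ Set.range (fun i => (w i).2), ∀ e : ℕ ≃o ClassOf w d,
    L.OmegaOutputs (fun k => markedLabel w (e k).1) (fun k => (w' (e k).1).1)

/-- The transducer has a successful run on the data word `w` that outputs the data word `w'`. -/
def DataTransducer.Outputs {n : ℕ} (T : DataTransducer A B)
    (w : Fin n → A × D) (w' : Fin n → B × D) : Prop :=
  (∀ i, (w' i).2 = (w i).2) ∧
    match T with
    | .glob G => G.Outputs (markedLabel w) (fun i => (w' i).1)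
    | .cls L => OutputsOnFiniteClasses L w w'

/-- The transducer has a successful run on the data `ω`-word `w` that outputs `w'`. -/
def DataOmegaTransducer.Outputs (T : DataOmegaTransducer A B)
    (w : DataOmegaWord A D) (w' : DataOmegaWord B D) : Prop :=
  (∀ i, (w' i).2 = (w i).2) ∧
    match T with
    | .glob G => G.OmegaOutputs (markedLabel w) (fun i => (w' i).1)
    | .cls L Lω => OutputsOnFiniteClasses L w w' ∧ OutputsOnInfiniteClasses Lω w w'

end Stages

/-! ### Cascades -/

/-- A cascade `⟨A = Σ₀, 𝒜₁, Σ₁, …, 𝒜ₙ, Σₙ = B⟩` of transducers of kind `T`, with finite alphabets. -/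
inductive Cascade (T : Type → Type → Type 1) : Type → Type → Type 1 where
  | nil (A : Type) : Cascade T A A
  | cons {A B C : Type} (finite_alphabet : Finite B) (t : T A B) (c : Cascade T B C) :
      Cascade T A C

namespace Cascade

/-- The number of transducers of a cascade. -/
def height {T : Type → Type → Type 1} : {A B : Type} → Cascade T A B → ℕ
  | _, _, .nil _ => 0
  | _, _, .cons _ _ c => c.height + 1

/-- The cascade has a successful run on the data word `w` whose final output is `w'`. -/
def Outputs {D : Type u} {n : ℕ} : {A B : Type} → Cascade DataTransducer A B →
    (Fin n → A × D) → (Fin n → B × D) → Prop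
  | _, _, .nil _, w, w' => w' = w
  | _, _, .cons _ t c, w, w' => ∃ w₁, t.Outputs w w₁ ∧ c.Outputs w₁ w'

/-- The cascade has a successful run on the data `ω`-word `w` whose final output is `w'`. -/
def OmegaOutputs {D : Type u} : {A B : Type} → Cascade DataOmegaTransducer A B →
    DataOmegaWord A D → DataOmegaWord B D → Prop
  | _, _, .nil _, w, w' => w' = w
  | _, _, .cons _ t c, w, w' => ∃ w₁, t.Outputs w w₁ ∧ c.OmegaOutputs w₁ w'

/-- The data words on which the cascade has a successful run. -/
def language {A B : Type} (D : Type u) (C : Cascade DataTransducer A B) : Set (DataWord A D) :=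
  {w | ∃ w', C.Outputs w.2 w'}

/-- The data `ω`-words on which the cascade has a successful run. -/
def omegaLanguage {A B : Type} (D : Type u) (C : Cascade DataOmegaTransducer A B) :
    Set (DataOmegaWord A D) :=
  {w | ∃ w', C.OmegaOutputs w w'}

/-- On every data word, the cascade has exactly one output: the input word, relabelled by the bit
that says whether `φ` holds at the position. -/
def Computes {A : Type} (D : Type u) (C : Cascade DataTransducer A Bool) (φ : Formula A) : Prop :=
  ∀ (w : DataWord A D) (w' : Fin (w.1 + 1) → Bool × D),
    C.Outputs w.2 w' ↔ ∀ i, (w' i).2 = (w.2 i).2 ∧ ((w' i).1 = true ↔ φ.Holds w.2 i)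

/-- The analogue for data `ω`-words. -/
def OmegaComputes {A : Type} (D : Type u) (C : Cascade DataOmegaTransducer A Bool)
    (φ : Formula A) : Prop :=
  ∀ (w : DataOmegaWord A D) (w' : DataOmegaWord Bool D),
    C.OmegaOutputs w w' ↔ ∀ i, (w' i).2 = (w i).2 ∧ ((w' i).1 = true ↔ φ.Holds w i)

end Cascade

end DataWords

namespace DataWords

universe u v

/-! ### Sequences -/

/-! Cut a word into lines: the whole word for the global mode, its classes for the class mode. A
modality of a given mode moves to a neighbour on a line of that mode. So a formula of one mode is
evaluated on each line separately, like a formula about a finite or infinite word whose letters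
record the atoms and the values of the free variables. There a fixpoint is an intersection or a
union over sets of positions, so the set defined by the formula is a function of the word with an
ω-regular graph (`Formula.regularFn_linSem`): set quantifiers are handled by projection and
complementation of Büchi automata (`BuchiAutomaton.language_complement`), and finite lines are
continued by blanks. An automaton for the graph of a function, read as a device that writes the
second track, is a functional transducer.

Hence one level of composition costs one transducer. The labellings obtained by `k` stages of
alternating modes form `Level`; they are closed under finite products, and level `k` in one mode is
contained in level `k + 1` in both modes, so that sentences of different modes can be substituted
into one formula. An end marker of the opposite mode needs a preceding stage of that mode: this is
the one additional transducer, which the strict height avoids. For the language, the last transducer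
also rejects unless the first position satisfies the sentence.

Conversely, a transducer writes `o` at a position if and only if some run arrives there from an
initial state, writes `o`, and continues successfully. Kleene's elimination of states turns paths of
runs into nested least fixpoints, backward for the past and forward for the future; the Büchi
condition adds a greatest fixpoint. Functionality makes these local statements coherent: if some run
writes some letter at every position of a line, then all these runs write the same word
(`functional_outputs`). So each stage costs one level, and its success means that a certain sentence
holds everywhere, which one further global formula can express.

Exact heights come from counting mode changes along nested modalities. A member of the `k`-th level
has at most `k` of them, while a disjunct that holds nowhere and has `k` alternating modalities
forces height `k` without changing the meaning (`exists_hasCompHeight`). -/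

theorem exists_chain {α : Type*} (X : Set α) (R : α → α → Prop) (h : ∀ x ∈ X, ∃ y ∈ X, R x y)
    {x : α} (hx : x ∈ X) : ∃ κ : ℕ → α, κ 0 = x ∧ ∀ n, κ n ∈ X ∧ R (κ n) (κ (n + 1)) := by
  choose f hf using h
  let g : X → X := fun y => ⟨f y.1 y.2, (hf y.1 y.2).1⟩
  refine ⟨fun n => (g^[n] ⟨x, hx⟩).1, rfl, fun n => ⟨(g^[n] ⟨x, hx⟩).2, ?_⟩⟩
  simp only [Function.iterate_succ_apply']
  exact (hf _ (g^[n] ⟨x, hx⟩).2).2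

theorem exists_mem_interval {κ : ℕ → ℕ} (hκ : StrictMono κ) {k : ℕ} (hk : κ 0 ≤ k) :
    ∃ n, κ n ≤ k ∧ k < κ (n + 1) := by
  induction k, hk using Nat.le_induction with
  | base => exact ⟨0, le_rfl, hκ (Nat.lt_succ_self 0)⟩
  | succ k _ ih =>
    obtain ⟨n, h1, h2⟩ := ih
    rcases Nat.lt_or_ge (k + 1) (κ (n + 1)) with h3 | h3
    · exact ⟨n, by omega, h3⟩
    · exact ⟨n + 1, h3, lt_of_le_of_lt h2 (hκ (Nat.lt_succ_self (n + 1)))⟩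

/-- Functions on consecutive intervals that agree at the common end points can be glued. -/
theorem exists_glue {α : Type*} {κ : ℕ → ℕ} (hκ : StrictMono κ) (ρ : ℕ → ℕ → α)
    (h : ∀ n, ρ n (κ (n + 1)) = ρ (n + 1) (κ (n + 1))) :
    ∃ r : ℕ → α, ∀ n k, κ n ≤ k → k ≤ κ (n + 1) → r k = ρ n k := by
  have hidx : ∀ k, ∃ n, κ 0 ≤ k → κ n ≤ k ∧ k < κ (n + 1) := by
    intro k
    by_cases hk : κ 0 ≤ k
    · obtain ⟨n, hn⟩ := exists_mem_interval hκ hk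
      exact ⟨n, fun _ => hn⟩
    · exact ⟨0, fun h => absurd h hk⟩
  choose idx hidx using hidx
  have huniq : ∀ n k, κ n ≤ k → k < κ (n + 1) → idx k = n := by
    intro n k a b
    obtain ⟨h1, h2⟩ := hidx k ((hκ.monotone (Nat.zero_le n)).trans a)
    have := hκ.lt_iff_lt.mp (lt_of_le_of_lt a h2)
    have := hκ.lt_iff_lt.mp (lt_of_le_of_lt h1 b)
    omega
  refine ⟨fun k => ρ (idx k) k, fun n k a b => ?_⟩
  rcases b.lt_or_eq with b | b
  · simp only [huniq n k a b]
  · subst b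
    simp only [huniq (n + 1) _ le_rfl (hκ (Nat.lt_succ_self (n + 1))), h n]

/-- A weak form of Ramsey's theorem: consecutive pairs of some infinite sequence have one colour. -/
theorem exists_homogeneous_sequence {α : Type*} [Finite α] (c : ℕ → ℕ → α) :
    ∃ (e : α) (κ : ℕ → ℕ), StrictMono κ ∧ 0 < κ 0 ∧ ∀ n, c (κ n) (κ (n + 1)) = e := by
  -- For a nonprincipal ultrafilter every colouring is constant on a large set: `g i` is the colour
  -- of `(i, j)` for almost all `j`, and `e` is the value of `g` almost everywhere. From an `i` with
  -- `g i = e` one can then always move on to a larger `j` with `g j = e` and `c i j = e`.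
  let U := Filter.hyperfilter ℕ
  have key : ∀ f : ℕ → α, ∃ e, {j | f j = e} ∈ U := by
    intro f
    obtain ⟨e, he⟩ := (U.map f).eq_pure_of_finite
    refine ⟨e, ?_⟩
    have : ({e} : Set α) ∈ U.map f := by rw [he]; exact Ultrafilter.mem_pure.mpr rfl
    exact this
  choose g hg using fun i => key (c i)
  obtain ⟨e, he⟩ := key g
  have hIoi : ∀ i, Set.Ioi i ∈ U := fun i =>
    Nat.hyperfilter_le_atTop (Filter.Ioi_mem_atTop i)
  have hne : ∀ {s : Set ℕ}, s ∈ U → s.Nonempty := fun hs => Ultrafilter.nonempty_of_mem hs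
  obtain ⟨x, hx, hx0⟩ := hne (Filter.inter_mem he (hIoi 0))
  obtain ⟨κ, h0, h⟩ := exists_chain {j | g j = e} (fun i j => i < j ∧ c i j = e) (by
    intro i hi
    obtain ⟨j, ⟨h1, h2⟩, h3⟩ := hne (Filter.inter_mem (Filter.inter_mem he (hIoi i)) (hg i))
    exact ⟨j, h1, h2, h3.trans hi⟩) hx
  exact ⟨e, κ, strictMono_nat_of_lt_succ fun n => (h n).2.1, h0 ▸ hx0, fun n => (h n).2.2⟩

/-! ### Büchi automata -/

/-- A nondeterministic Büchi automaton. -/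
structure BuchiAutomaton (Γ : Type) : Type 1 where
  State : Type
  finite_state : Finite State
  init : Set State
  step : State → Γ → State → Prop
  accept : Set State

/-- The `ω`-language of a Büchi automaton. -/
def BuchiAutomaton.language {Γ : Type} (M : BuchiAutomaton Γ) : Set (ℕ → Γ) :=
  {u | ∃ r : ℕ → M.State, r 0 ∈ M.init ∧ (∀ i, M.step (r i) (u i) (r (i + 1))) ∧
    ∃ᶠ i in Filter.atTop, r i ∈ M.accept}

/-- An `ω`-language is regular if it is the language of a Büchi automaton. -/
def OmegaRegular {Γ : Type} (L : Set (ℕ → Γ)) : Prop := ∃ M : BuchiAutomaton Γ, M.language = L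

namespace BuchiAutomaton

variable {Γ : Type} (M : BuchiAutomaton Γ)

/-- For a finite word, the pairs of states connected by a run, and those connected by a run
through an accepting state. -/
abbrev Profile : Type := (M.State → M.State → Prop) × (M.State → M.State → Prop)

/-- The profile of a word followed by a letter. -/
def extend (s : M.Profile) (a : Γ) : M.Profile :=
  (fun p q => ∃ r, s.1 p r ∧ M.step r a q,
    fun p q => ∃ r, M.step r a q ∧ (s.2 p r ∨ s.1 p r ∧ r ∈ M.accept))

/-- The profile of the empty word. -/
def emptyProfile : M.Profile := (fun p q => p = q, fun _ _ => False)

/-- The profile of the factor of length `n` of `u` that starts at `i`. -/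
def profile (u : ℕ → Γ) (i : ℕ) : ℕ → M.Profile
  | 0 => M.emptyProfile
  | n + 1 => M.extend (profile u i n) (u (i + n))

/-- `r` is a run on the factor of length `n` of `u` that starts at `i`. -/
def RunOn (u : ℕ → Γ) (i n : ℕ) (p q : M.State) (r : ℕ → M.State) : Prop :=
  r i = p ∧ r (i + n) = q ∧ ∀ k, i ≤ k → k < i + n → M.step (r k) (u k) (r (k + 1))

variable {M}

theorem RunOn.snoc {u : ℕ → Γ} {i n : ℕ} {p q q' : M.State} {r : ℕ → M.State}
    (h : M.RunOn u i n p q r) (hs : M.step q (u (i + n)) q') :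
    M.RunOn u i (n + 1) p q' (Function.update r (i + n + 1) q') := by
  obtain ⟨h1, h2, h3⟩ := h
  refine ⟨?_, by simp [← add_assoc], ?_⟩
  · rw [Function.update_of_ne (by omega), h1]
  · intro k hk hk'
    rw [Function.update_of_ne (by omega)]
    rcases Nat.lt_or_ge k (i + n) with h4 | h4
    · rw [Function.update_of_ne (by omega)]; exact h3 k hk h4
    · obtain rfl : k = i + n := by omega
      rw [Function.update_self, h2]; exact hs

theorem profile_fst (u : ℕ → Γ) (i n : ℕ) (p q : M.State) :
    (M.profile u i n).1 p q ↔ ∃ r, M.RunOn u i n p q r := by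
  induction n generalizing q with
  | zero =>
    constructor
    · rintro (rfl : p = q)
      exact ⟨fun _ => p, rfl, rfl, fun k h h' => absurd h' (by omega)⟩
    · rintro ⟨r, h1, h2, -⟩
      exact h1.symm.trans h2
  | succ n ih =>
    constructor
    · rintro ⟨s, hs, hst⟩
      obtain ⟨r, hr⟩ := (ih s).mp hs
      exact ⟨_, hr.snoc hst⟩
    · rintro ⟨r, h1, h2, h3⟩
      exact ⟨r (i + n), (ih _).mpr ⟨r, h1, rfl, fun k a b => h3 k a (by omega)⟩,
        h2 ▸ h3 (i + n) (by omega) (by omega)⟩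

theorem profile_snd (u : ℕ → Γ) (i n : ℕ) (p q : M.State) :
    (M.profile u i n).2 p q ↔
      ∃ r, M.RunOn u i n p q r ∧ ∃ k, i ≤ k ∧ k < i + n ∧ r k ∈ M.accept := by
  induction n generalizing q with
  | zero =>
    constructor
    · exact False.elim
    · rintro ⟨r, -, k, h1, h2, -⟩
      omega
  | succ n ih =>
    constructor
    · rintro ⟨s, hst, hs | ⟨hs, ha⟩⟩
      · obtain ⟨r, hr, k, h1, h2, h3⟩ := (ih s).mp hs
        refine ⟨_, hr.snoc hst, k, h1, by omega, ?_⟩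
        rwa [Function.update_of_ne (by omega)]
      · obtain ⟨r, hr⟩ := (profile_fst u i n p s).mp hs
        refine ⟨_, hr.snoc hst, i + n, by omega, by omega, ?_⟩
        rw [Function.update_of_ne (by omega), hr.2.1]
        exact ha
    · rintro ⟨r, ⟨h1, h2, h3⟩, k, h4, h5, h6⟩
      have hr : M.RunOn u i n p (r (i + n)) r := ⟨h1, rfl, fun k a b => h3 k a (by omega)⟩
      refine ⟨r (i + n), h2 ▸ h3 (i + n) (by omega) (by omega), ?_⟩
      rcases Nat.lt_or_ge k (i + n) with h7 | h7
      · exact Or.inl ((ih _).mpr ⟨r, hr, k, h4, h7, h6⟩)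
      · obtain rfl : k = i + n := by omega
        exact Or.inr ⟨(profile_fst u i n p _).mpr ⟨r, hr⟩, h6⟩

/-! ### Factorizations of an ω-word by profiles -/

variable (M)

/-- The sequence of cut points splits `u` into a factor with profile `s` and factors with
profile `e`. -/
def Splits (s e : M.Profile) (u : ℕ → Γ) : Prop :=
  ∃ κ : ℕ → ℕ, StrictMono κ ∧ 0 < κ 0 ∧ M.profile u 0 (κ 0) = s ∧
    ∀ n, M.profile u (κ n) (κ (n + 1) - κ n) = e

/-- Words that split into factors with profiles `s, e, e, …` are accepted. -/
def Accepting (s e : M.Profile) : Prop :=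
  ∃ p : ℕ → M.State, ∃ p₀ ∈ M.init, s.1 p₀ (p 0) ∧ (∀ n, e.1 (p n) (p (n + 1))) ∧
    ∀ N, ∃ n ≥ N, e.2 (p n) (p (n + 1))

variable {M}

/-- Acceptance of a split word depends on the two profiles alone. In this direction, a successful
run is sampled at the cut points; a visit to an accepting state lies in some factor and is recorded
by the second relation of its profile. -/
theorem Splits.accepting {s e : M.Profile} {u : ℕ → Γ} (h : M.Splits s e u)
    (hu : u ∈ M.language) : M.Accepting s e := by
  obtain ⟨κ, hκ, h0, hs, he⟩ := h
  obtain ⟨r, hr0, hr, hacc⟩ := hu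
  have hlt : ∀ n, κ n < κ (n + 1) := fun n => hκ (Nat.lt_succ_self n)
  have hrun : ∀ n, M.RunOn u (κ n) (κ (n + 1) - κ n) (r (κ n)) (r (κ (n + 1))) r := fun n =>
    ⟨rfl, by rw [Nat.add_sub_cancel' (hlt n).le], fun k _ _ => hr k⟩
  refine ⟨fun n => r (κ n), r 0, hr0, ?_, fun n => ?_, fun N => ?_⟩
  · rw [← hs, profile_fst]
    exact ⟨r, rfl, by simp, fun k _ _ => hr k⟩
  · rw [← he n, profile_fst]
    exact ⟨r, hrun n⟩
  · obtain ⟨k, hk, hka⟩ := Filter.frequently_atTop.mp hacc (κ N)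
    obtain ⟨n, h2, h3⟩ := exists_mem_interval hκ ((hκ.monotone (Nat.zero_le N)).trans hk)
    have h1 : N < n + 1 := hκ.lt_iff_lt.mp (lt_of_le_of_lt hk h3)
    refine ⟨n, Nat.lt_succ_iff.mp h1, ?_⟩
    rw [← he n, profile_snd]
    exact ⟨r, hrun n, k, h2, by have := hlt n; omega, hka⟩

/-- Runs are chosen factor by factor, through an accepting state whenever the profile offers one,
and are then glued at the cut points. -/
theorem Splits.mem_language {s e : M.Profile} {u : ℕ → Γ} (h : M.Splits s e u)
    (ha : M.Accepting s e) : u ∈ M.language := by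
  obtain ⟨κ, hκ, h0, hs, he⟩ := h
  obtain ⟨p, p₀, hp₀, hs1, he1, he2⟩ := ha
  have hlt : ∀ n, κ n < κ (n + 1) := fun n => hκ (Nat.lt_succ_self n)
  obtain ⟨r₀, hr₀⟩ := (profile_fst u 0 (κ 0) p₀ (p 0)).mp (hs ▸ hs1)
  have hex : ∀ n, ∃ r, M.RunOn u (κ n) (κ (n + 1) - κ n) (p n) (p (n + 1)) r ∧
      (e.2 (p n) (p (n + 1)) → ∃ k, κ n ≤ k ∧ k < κ (n + 1) ∧ r k ∈ M.accept) := by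
    intro n
    by_cases h2 : e.2 (p n) (p (n + 1))
    · obtain ⟨r, hr, k, hk⟩ := (profile_snd u _ _ _ _).mp (he n ▸ h2)
      exact ⟨r, hr, fun _ => ⟨k, hk.1, by have := hlt n; omega, hk.2.2⟩⟩
    · obtain ⟨r, hr⟩ := (profile_fst u _ _ _ _).mp (he n ▸ he1 n)
      exact ⟨r, hr, fun h => absurd h h2⟩
  choose ρ hρ hρa using hex
  -- The initial factor is added as factor number `0`. The condition `0 < κ 0` keeps the cut points
  -- strictly increasing.
  let κ' : ℕ → ℕ := fun n => Nat.casesOn n 0 κ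
  let ρ' : ℕ → ℕ → M.State := fun n => Nat.casesOn n r₀ ρ
  have hκ' : StrictMono κ' := strictMono_nat_of_lt_succ fun n => by
    cases n with
    | zero => exact h0
    | succ n => exact hlt n
  have hend : ∀ n, ρ n (κ (n + 1)) = p (n + 1) := fun n => by
    have := (hρ n).2.1
    rwa [Nat.add_sub_cancel' (hlt n).le] at this
  obtain ⟨r, hr⟩ := exists_glue hκ' ρ' (fun n => by
    cases n with
    | zero =>
      have := hr₀.2.1
      rw [zero_add] at this
      exact this.trans (hρ 0).1.symm
    | succ n => exact (hend n).trans (hρ (n + 1)).1.symm)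
  refine ⟨r, ?_, fun k => ?_, Filter.frequently_atTop.mpr fun N => ?_⟩
  · rw [hr 0 0 le_rfl (Nat.zero_le _)]
    change r₀ 0 ∈ _
    rw [hr₀.1]; exact hp₀
  · obtain ⟨n, h1, h2⟩ := exists_mem_interval hκ' (Nat.zero_le k)
    rw [hr n k h1 h2.le, hr n (k + 1) (by omega) h2]
    cases n with
    | zero => exact hr₀.2.2 k (Nat.zero_le _) (by rw [zero_add]; exact h2)
    | succ n =>
      refine (hρ n).2.2 k h1 ?_
      rw [Nat.add_sub_cancel' (hlt n).le]; exact h2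
  · obtain ⟨n, hn, h2⟩ := he2 N
    obtain ⟨k, hk1, hk2, hka⟩ := hρa n h2
    refine ⟨k, (hn.trans (hκ.id_le n)).trans hk1, ?_⟩
    rw [hr (n + 1) k hk1 hk2.le]
    exact hka

/-! ### Complementation of Büchi automata -/

variable (M)

/-- An automaton for the words that split into factors with profiles `s, e, e, …`, where `(s, e)`
is not accepting. A state consists of the profile of the current factor, the profile that it must
have in the end, the profile `e`, and a bit that marks the cut points. -/
def complement : BuchiAutomaton Γ where
  State := M.Profile × M.Profile × M.Profile × Bool
  finite_state := by have := M.finite_state; infer_instance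
  init := {x | x.1 = M.emptyProfile ∧ ¬ M.Accepting x.2.1 x.2.2.1 ∧ x.2.2.2 = false}
  step x a y := y.2.2.1 = x.2.2.1 ∧
    ((y.2.2.2 = false ∧ y.1 = M.extend x.1 a ∧ y.2.1 = x.2.1) ∨
      (y.2.2.2 = true ∧ y.1 = M.emptyProfile ∧ M.extend x.1 a = x.2.1 ∧ y.2.1 = x.2.2.1))
  accept := {x | x.2.2.2 = true}

variable {M}

theorem Splits.mem_complement {s e : M.Profile} {u : ℕ → Γ} (h : M.Splits s e u)
    (ha : ¬ M.Accepting s e) : u ∈ M.complement.language := by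
  classical
  obtain ⟨κ, hκ, h0, hs, he⟩ := h
  have hlt : ∀ n, κ n < κ (n + 1) := fun n => hκ (Nat.lt_succ_self n)
  let st : ℕ → M.complement.State := fun k => Nat.rec (M.emptyProfile, s, e, false)
    (fun k x => if k + 1 ∈ Set.range κ then (M.emptyProfile, e, e, true)
      else (M.extend x.1 (u k), x.2.1, e, false)) k
  have hst : ∀ k, st (k + 1) = if k + 1 ∈ Set.range κ then (M.emptyProfile, e, e, true)
      else (M.extend (st k).1 (u k), (st k).2.1, e, false) := fun k => rfl
  -- The first entry of the state is the profile read since the last cut; its target is `s` before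
  -- the first cut and `e` afterwards.
  have hinv : ∀ k, (k < κ 0 ∧ (st k).2.1 = s ∧ (st k).1 = M.profile u 0 k) ∨
      ∃ n, κ n ≤ k ∧ k < κ (n + 1) ∧ (st k).2.1 = e ∧ (st k).1 = M.profile u (κ n) (k - κ n) := by
    intro k
    induction k with
    | zero => exact Or.inl ⟨h0, rfl, rfl⟩
    | succ k ih =>
      rw [hst]
      split_ifs with hk
      · obtain ⟨n, hn⟩ := hk
        exact Or.inr ⟨n, hn.le, hn ▸ hlt n, rfl, by rw [hn, Nat.sub_self]; rfl⟩
      · rcases ih with ⟨h1, h2, h3⟩ | ⟨n, h1, h2, h3, h4⟩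
        · have : k + 1 ≠ κ 0 := fun h => hk ⟨0, h.symm⟩
          refine Or.inl ⟨by omega, h2, ?_⟩
          rw [h3, profile, zero_add]
        · have : k + 1 ≠ κ (n + 1) := fun h => hk ⟨n + 1, h.symm⟩
          refine Or.inr ⟨n, by omega, by omega, h3, ?_⟩
          rw [h4, Nat.sub_add_comm h1, profile, Nat.add_sub_cancel' h1]
  have he' : ∀ k, (st k).2.2.1 = e := by
    intro k
    cases k with
    | zero => rfl
    | succ k => rw [hst]; split_ifs <;> rfl
  refine ⟨st, ⟨rfl, ha, rfl⟩, fun k => ⟨(he' (k + 1)).trans (he' k).symm, ?_⟩,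
    Filter.frequently_atTop.mpr fun N => ⟨κ N, hκ.id_le N, ?_⟩⟩
  · by_cases hk : k + 1 ∈ Set.range κ
    · right
      rw [hst, if_pos hk, he']
      refine ⟨rfl, rfl, ?_, rfl⟩
      obtain ⟨n, hn⟩ := hk
      rcases hinv k with ⟨h1, h2, h3⟩ | ⟨m, h1, h2, h3, h4⟩
      · have : n = 0 := by
          by_contra h
          have := hκ (Nat.pos_of_ne_zero h)
          omega
        subst this
        rw [h2, h3, ← hs, hn, profile, zero_add]
      · have a1 : m < n := hκ.lt_iff_lt.mp (by omega)
        have a2 : n < m + 1 + 1 := hκ.lt_iff_lt.mp (by have := hlt (m + 1); omega)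
        obtain rfl : n = m + 1 := by omega
        rw [h3, h4, ← he m, hn, Nat.sub_add_comm h1, profile, Nat.add_sub_cancel' h1]
    · left
      rw [hst, if_neg hk]
      exact ⟨rfl, rfl, rfl⟩
  · change (st (κ N)).2.2.2 = true
    obtain ⟨k, hk⟩ : ∃ k, κ N = k + 1 :=
      Nat.exists_eq_succ_of_ne_zero (by have := hκ.monotone (Nat.zero_le N); omega)
    rw [hk, hst, if_pos ⟨N, hk⟩]

theorem exists_splits_of_mem_complement {u : ℕ → Γ} (h : u ∈ M.complement.language) :
    ∃ s e, ¬ M.Accepting s e ∧ M.Splits s e u := by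
  classical
  obtain ⟨st, ⟨h1, h2, h3⟩, hstep, hacc⟩ := h
  have he : ∀ k, (st k).2.2.1 = (st 0).2.2.1 := by
    intro k
    induction k with
    | zero => rfl
    | succ k ih => rw [(hstep k).1, ih]
  -- From a state with the empty profile, the profile accumulates until the next marked position,
  -- where a transition is possible only if it has reached its target.
  have hnext : ∀ l, (st l).1 = M.emptyProfile → ∃ k, l < k ∧ (st k).2.2.2 = true ∧
      M.profile u l (k - l) = (st l).2.1 := by
    intro l hl
    have hex : ∃ k, l < k ∧ (st k).2.2.2 = true := by
      obtain ⟨k, hk, hka⟩ := Filter.frequently_atTop.mp hacc (l + 1)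
      exact ⟨k, hk, hka⟩
    have hmin : ∀ k, l < k → k < Nat.find hex → (st k).2.2.2 = false := fun k a b => by
      simpa [a] using Nat.find_min hex b
    have hinv : ∀ n, l + n < Nat.find hex →
        (st (l + n)).2.1 = (st l).2.1 ∧ (st (l + n)).1 = M.profile u l n := by
      intro n
      induction n with
      | zero => exact fun _ => ⟨rfl, hl⟩
      | succ n ih =>
        intro hn
        obtain ⟨i1, i2⟩ := ih (by omega)
        have hf := hmin (l + n + 1) (by omega) (by omega)
        rcases (hstep (l + n)).2 with ⟨-, c2, c3⟩ | ⟨c1, -⟩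
        · exact ⟨c3.trans i1, by rw [← add_assoc, c2, i2]; rfl⟩
        · rw [hf] at c1; cases c1
    obtain ⟨hk1, hk2⟩ := Nat.find_spec hex
    refine ⟨Nat.find hex, hk1, hk2, ?_⟩
    obtain ⟨n, hn⟩ : ∃ n, Nat.find hex = l + n + 1 := ⟨Nat.find hex - l - 1, by omega⟩
    obtain ⟨i1, i2⟩ := hinv n (by omega)
    rcases (hstep (l + n)).2 with ⟨c1, -⟩ | ⟨-, -, c3, -⟩
    · rw [← hn, hk2] at c1; cases c1
    · rw [i1, i2] at c3
      rw [hn, show l + n + 1 - l = n + 1 by omega, ← c3]; rfl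
  have hcut : ∀ k, (st k).2.2.2 = true → (st k).1 = M.emptyProfile ∧ (st k).2.1 = (st 0).2.2.1 := by
    intro k hk
    cases k with
    | zero => rw [h3] at hk; cases hk
    | succ k =>
      rcases (hstep k).2 with ⟨c1, -⟩ | ⟨-, c2, -, c4⟩
      · rw [hk] at c1; cases c1
      · exact ⟨c2, c4.trans (he k)⟩
  obtain ⟨k₀, hk₀, hk₀', hs⟩ := hnext 0 h1
  obtain ⟨κ, hκ0, hκ⟩ := exists_chain {k | (st k).2.2.2 = true}
    (fun i j => i < j ∧ M.profile u i (j - i) = (st 0).2.2.1) (by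
      intro k hk
      obtain ⟨j, a, b, c⟩ := hnext k (hcut k hk).1
      exact ⟨j, b, a, c.trans (hcut k hk).2⟩) hk₀'
  exact ⟨_, _, h2, κ, strictMono_nat_of_lt_succ fun n => (hκ n).2.1, hκ0 ▸ hk₀, by
    rw [hκ0]; simpa using hs, fun n => (hκ n).2.2⟩

/-- Ramsey's theorem, with factors coloured by their profiles. Only consecutive factors matter for
acceptance, so `e` need not be idempotent. -/
theorem exists_splits (u : ℕ → Γ) : ∃ s e, M.Splits s e u := by
  have := M.finite_state
  obtain ⟨e, κ, h1, h2, h3⟩ := exists_homogeneous_sequence fun i j => M.profile u i (j - i)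
  exact ⟨_, e, κ, h1, h2, rfl, h3⟩

theorem language_complement : M.complement.language = M.languageᶜ := by
  ext u
  constructor
  · intro h hu
    obtain ⟨s, e, ha, hs⟩ := exists_splits_of_mem_complement h
    exact ha (hs.accepting hu)
  · intro hu
    obtain ⟨s, e, hs⟩ := M.exists_splits u
    exact hs.mem_complement fun ha => hu (hs.mem_language ha)

end BuchiAutomaton

/-! ### Closure properties of regular `ω`-languages -/

namespace OmegaRegular

variable {Γ Δ : Type}

theorem congr {L L' : Set (ℕ → Γ)} (h : OmegaRegular L) (e : ∀ u, u ∈ L' ↔ u ∈ L) :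
    OmegaRegular L' := by
  rwa [Set.ext e]

theorem compl {L : Set (ℕ → Γ)} : OmegaRegular L → OmegaRegular Lᶜ := by
  rintro ⟨M, rfl⟩
  exact ⟨M.complement, M.language_complement⟩

theorem union {L L' : Set (ℕ → Γ)} (h : OmegaRegular L) (h' : OmegaRegular L') :
    OmegaRegular (L ∪ L') := by
  obtain ⟨M, rfl⟩ := h
  obtain ⟨M', rfl⟩ := h'
  have := M.finite_state
  have := M'.finite_state
  let N : BuchiAutomaton Γ :=
    { State := M.State ⊕ M'.State
      finite_state := inferInstance
      init := {x | Sum.elim (· ∈ M.init) (· ∈ M'.init) x}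
      step := fun x a y => Sum.elim (fun p => ∃ q, y = .inl q ∧ M.step p a q)
        (fun p => ∃ q, y = .inr q ∧ M'.step p a q) x
      accept := {x | Sum.elim (· ∈ M.accept) (· ∈ M'.accept) x} }
  refine ⟨N, Set.ext fun u => ⟨?_, ?_⟩⟩
  · rintro ⟨r, h1, h2, h3⟩
    rcases h0 : r 0 with p | p
    · have : ∀ i, ∃ q, r i = .inl q := by
        intro i
        induction i with
        | zero => exact ⟨p, h0⟩
        | succ i ih =>
          obtain ⟨q, hq⟩ := ih
          have := h2 i
          rw [hq] at this
          obtain ⟨q', h, -⟩ := this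
          exact ⟨q', h⟩
      choose r' hr' using this
      refine Or.inl ⟨r', ?_, fun i => ?_, ?_⟩
      · rw [hr'] at h1; exact h1
      · have := h2 i
        rw [hr', hr'] at this
        obtain ⟨q', h, h'⟩ := this
        rwa [Sum.inl.inj h]
      · refine h3.mono fun i hi => ?_
        rw [hr'] at hi; exact hi
    · have : ∀ i, ∃ q, r i = .inr q := by
        intro i
        induction i with
        | zero => exact ⟨p, h0⟩
        | succ i ih =>
          obtain ⟨q, hq⟩ := ih
          have := h2 i
          rw [hq] at this
          obtain ⟨q', h, -⟩ := this
          exact ⟨q', h⟩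
      choose r' hr' using this
      refine Or.inr ⟨r', ?_, fun i => ?_, ?_⟩
      · rw [hr'] at h1; exact h1
      · have := h2 i
        rw [hr', hr'] at this
        obtain ⟨q', h, h'⟩ := this
        rwa [Sum.inr.inj h]
      · refine h3.mono fun i hi => ?_
        rw [hr'] at hi; exact hi
  · rintro (⟨r, h1, h2, h3⟩ | ⟨r, h1, h2, h3⟩)
    · exact ⟨fun i => .inl (r i), h1, fun i => ⟨_, rfl, h2 i⟩, h3⟩
    · exact ⟨fun i => .inr (r i), h1, fun i => ⟨_, rfl, h2 i⟩, h3⟩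

theorem inter {L L' : Set (ℕ → Γ)} (h : OmegaRegular L) (h' : OmegaRegular L') :
    OmegaRegular (L ∩ L') := by
  have := (h.compl.union h'.compl).compl
  rwa [Set.compl_union, compl_compl, compl_compl] at this

theorem comap {L : Set (ℕ → Δ)} (h : OmegaRegular L) (f : Γ → Δ) :
    OmegaRegular {u : ℕ → Γ | (fun i => f (u i)) ∈ L} := by
  obtain ⟨M, rfl⟩ := h
  exact ⟨⟨M.State, M.finite_state, M.init, fun p a q => M.step p (f a) q, M.accept⟩, rfl⟩

theorem exists_snd {L : Set (ℕ → Γ × Δ)} (h : OmegaRegular L) :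
    OmegaRegular {u : ℕ → Γ | ∃ t : ℕ → Δ, (fun i => (u i, t i)) ∈ L} := by
  obtain ⟨M, rfl⟩ := h
  refine ⟨⟨M.State, M.finite_state, M.init, fun p a q => ∃ b, M.step p (a, b) q, M.accept⟩,
    Set.ext fun u => ⟨?_, ?_⟩⟩
  · rintro ⟨r, h1, h2, h3⟩
    choose t ht using h2
    exact ⟨t, r, h1, ht, h3⟩
  · rintro ⟨t, r, h1, h2, h3⟩
    exact ⟨r, h1, fun i => ⟨_, h2 i⟩, h3⟩

theorem forall_snd {L : Set (ℕ → Γ × Δ)} (h : OmegaRegular L) :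
    OmegaRegular {u : ℕ → Γ | ∀ t : ℕ → Δ, (fun i => (u i, t i)) ∈ L} := by
  convert h.compl.exists_snd.compl using 1
  ext u
  simp

theorem imp {L L' : Set (ℕ → Γ)} (h : OmegaRegular L) (h' : OmegaRegular L') :
    OmegaRegular {u | u ∈ L → u ∈ L'} := by
  convert h.compl.union h' using 1
  ext u
  simp [imp_iff_not_or]

/-- Local conditions on two consecutive letters, and on the first letter. -/
theorem local_condition (p q : Γ → Prop) (c : Prop → Prop) :
    OmegaRegular {u : ℕ → Γ | c (q (u 0)) ∧ ∀ i, p (u i) ↔ q (u (i + 1))} := by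
  refine ⟨⟨Prop, inferInstance, {s | c s}, fun s a s' => (s ↔ q a) ∧ (p a ↔ s'), Set.univ⟩,
    Set.ext fun u => ⟨?_, ?_⟩⟩
  · rintro ⟨r, h1, h2, -⟩
    have h0 : ∀ i, r i = q (u i) := fun i => propext (h2 i).1
    exact ⟨h0 0 ▸ h1, fun i => (h2 i).2.trans (h0 (i + 1)).to_iff⟩
  · rintro ⟨h1, h2⟩
    exact ⟨fun i => q (u i), h1, fun i => ⟨Iff.rfl, h2 i⟩,
      Filter.Eventually.frequently (Filter.Eventually.of_forall fun _ => trivial)⟩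

theorem forall_letter (p : Γ → Prop) : OmegaRegular {u : ℕ → Γ | ∀ i, p (u i)} := by
  refine ⟨⟨Unit, inferInstance, Set.univ, fun _ a _ => p a, Set.univ⟩, Set.ext fun u => ⟨?_, ?_⟩⟩
  · rintro ⟨r, h1, h2, -⟩
    exact h2
  · exact fun h => ⟨fun _ => (), trivial, h,
      Filter.Eventually.frequently (Filter.Eventually.of_forall fun _ => trivial)⟩

theorem iInter {ι : Type} [Finite ι] {L : ι → Set (ℕ → Γ)} (h : ∀ j, OmegaRegular (L j)) :
    OmegaRegular (⋂ j, L j) := by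
  have := Fintype.ofFinite ι
  have key : ∀ s : Finset ι, OmegaRegular (⋂ j ∈ s, L j) := by
    classical
    intro s
    induction s using Finset.induction_on with
    | empty => simpa using forall_letter fun _ : Γ => True
    | insert a s _ ih => rw [Finset.set_biInter_insert]; exact (h a).inter ih
  simpa using key Finset.univ

end OmegaRegular

/-! ### Regular functions on `ω`-words -/

/-- A function on `ω`-words is regular if its graph is. -/
def RegularFn {Γ Δ : Type} (f : (ℕ → Γ) → ℕ → Δ) : Prop :=
  OmegaRegular {z : ℕ → Γ × Δ | (fun i => (z i).2) = f fun i => (z i).1}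

namespace RegularFn

variable {Γ Δ Θ : Type}

theorem congr {f g : (ℕ → Γ) → ℕ → Δ} (hf : RegularFn f) (h : ∀ u, g u = f u) : RegularFn g := by
  rwa [funext h]

theorem letterwise (g : Γ → Δ) : RegularFn fun (u : ℕ → Γ) i => g (u i) := by
  refine OmegaRegular.congr (OmegaRegular.forall_letter fun x : Γ × Δ => x.2 = g x.1) fun z => ?_
  exact funext_iff

/-- The value of `f` is guessed on a second track, checked against the graph of `f`, and projected
away. -/
theorem preimage {f : (ℕ → Γ) → ℕ → Δ} (hf : RegularFn f) {L : Set (ℕ → Δ)}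
    (hL : OmegaRegular L) : OmegaRegular {u | f u ∈ L} := by
  refine OmegaRegular.congr ((hf.inter (hL.comap Prod.snd)).exists_snd) fun u => ?_
  constructor
  · exact fun h => ⟨f u, rfl, h⟩
  · rintro ⟨t, h', h⟩
    have h' : t = f u := h'
    subst h'
    exact h

theorem comp {g : (ℕ → Δ) → ℕ → Θ} {f : (ℕ → Γ) → ℕ → Δ} (hg : RegularFn g) (hf : RegularFn f) :
    RegularFn fun u => g (f u) := by
  have h1 : OmegaRegular {z : ℕ → (Γ × Θ) × Δ | (fun i => (z i).2) = f fun i => (z i).1.1} :=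
    hf.comap fun x : (Γ × Θ) × Δ => (x.1.1, x.2)
  have h2 : OmegaRegular {z : ℕ → (Γ × Θ) × Δ |
      (fun i => (z i).1.2) = g fun i => (z i).2} := hg.comap fun x : (Γ × Θ) × Δ => (x.2, x.1.2)
  refine OmegaRegular.congr ((h1.inter h2).exists_snd) fun z => ?_
  constructor
  · exact fun h => ⟨f fun i => (z i).1, rfl, h⟩
  · rintro ⟨t, h, h'⟩
    exact Eq.trans h' (congrArg g h)

theorem pi {ι : Type} [Finite ι] {Δ : ι → Type} {f : ∀ j, (ℕ → Γ) → ℕ → Δ j}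
    (h : ∀ j, RegularFn (f j)) : RegularFn fun (u : ℕ → Γ) i j => f j u i := by
  have h1 : ∀ j, OmegaRegular {z : ℕ → Γ × (∀ j, Δ j) |
      (fun i => (z i).2 j) = f j fun i => (z i).1} := fun j => (h j).comap fun x : Γ × (∀ j, Δ j) => (x.1, x.2 j)
  refine OmegaRegular.congr (OmegaRegular.iInter h1) fun z => ?_
  simp only [Set.mem_ofPred_eq, Set.mem_iInter, funext_iff]
  exact forall_comm

theorem pair {f : (ℕ → Γ) → ℕ → Δ} {g : (ℕ → Γ) → ℕ → Θ} (hf : RegularFn f) (hg : RegularFn g) :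
    RegularFn fun u i => (f u i, g u i) := by
  have h1 : OmegaRegular {z : ℕ → Γ × (Δ × Θ) | (fun i => (z i).2.1) = f fun i => (z i).1} :=
    hf.comap fun x : Γ × (Δ × Θ) => (x.1, x.2.1)
  have h2 : OmegaRegular {z : ℕ → Γ × (Δ × Θ) | (fun i => (z i).2.2) = g fun i => (z i).1} :=
    hg.comap fun x : Γ × (Δ × Θ) => (x.1, x.2.2)
  refine OmegaRegular.congr (h1.inter h2) fun z => ?_
  simp only [Set.mem_ofPred_eq, Set.mem_inter_iff, funext_iff, Prod.ext_iff]
  exact forall_and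

theorem map {f : (ℕ → Γ) → ℕ → Δ} (hf : RegularFn f) (g : Δ → Θ) :
    RegularFn fun u i => g (f u i) := (letterwise g).comp hf

/-- Shift to the left; the letters may say that the next position is not to be looked at. -/
theorem next (p : Γ → Prop) : RegularFn fun (u : ℕ → Γ) => {i | p (u (i + 1))} := by
  have := OmegaRegular.local_condition (fun x : Γ × Prop => x.2) (fun x => p x.1) fun _ => True
  refine OmegaRegular.congr this fun z => ?_
  simp only [Set.mem_ofPred_eq, true_and]
  constructor
  · exact fun h i => (congrFun h i).to_iff
  · exact fun h => funext fun i => propext (h i)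

/-- Shift to the right. -/
theorem prev (p : Γ → Prop) : RegularFn fun (u : ℕ → Γ) => {i | ∃ j, i = j + 1 ∧ p (u j)} := by
  have := OmegaRegular.local_condition (fun x : Γ × Prop => p x.1) (fun x => x.2) fun x => ¬ x
  refine OmegaRegular.congr this fun z => ?_
  simp only [Set.mem_ofPred_eq]
  constructor
  · intro h
    refine ⟨fun h0 => ?_, fun i => ?_⟩
    · obtain ⟨j, hj, -⟩ := (congrFun h 0).to_iff.mp h0
      omega
    · refine Iff.trans ?_ (congrFun h (i + 1)).to_iff.symm
      constructor
      · exact fun hi => ⟨i, rfl, hi⟩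
      · rintro ⟨j, hj, hp⟩
        obtain rfl : i = j := by omega
        exact hp
  · rintro ⟨h0, h⟩
    refine funext fun i => propext ?_
    cases i with
    | zero =>
      constructor
      · exact fun h' => absurd h' h0
      · rintro ⟨j, hj, -⟩
        omega
    | succ i =>
      refine (h i).symm.trans ⟨fun hi => ⟨i, rfl, hi⟩, ?_⟩
      rintro ⟨j, hj, hp⟩
      obtain rfl : i = j := by omega
      exact hp

/-- The set `S`, as a word, put next to the word `u`. -/
abbrev attach (u : ℕ → Γ) (S : Set ℕ) : ℕ → Γ × Prop := fun i => (u i, i ∈ S)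

/-- The intersection is characterised as the greatest lower bound of the family. Being a lower
bound, and containing every lower bound, are conditions with universal set quantifiers over regular
conditions. -/
theorem sInter {p : Set (ℕ → Γ × Prop)} (hp : OmegaRegular p) :
    RegularFn fun (u : ℕ → Γ) => ⋂₀ {S | attach u S ∈ p} := by
  have hsub : OmegaRegular {z : ℕ → (Γ × Prop) × Prop | ∀ i, (z i).1.2 → (z i).2} :=
    OmegaRegular.forall_letter fun x : (Γ × Prop) × Prop => x.1.2 → x.2
  have hlb := ((hp.comap fun x : (Γ × Prop) × Prop => (x.1.1, x.2)).imp hsub).forall_snd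
  have hle : OmegaRegular {z : ℕ → (Γ × Prop) × Prop | ∀ i, (z i).2 → (z i).1.2} :=
    OmegaRegular.forall_letter fun x : (Γ × Prop) × Prop => x.2 → x.1.2
  have hgr := ((hlb.comap fun x : (Γ × Prop) × Prop => (x.1.1, x.2)).imp hle).forall_snd
  refine OmegaRegular.congr (hlb.inter hgr) fun z => ?_
  constructor
  · intro h
    have h' : ∀ i, (z i).2 ↔ i ∈ ⋂₀ {S | attach (fun i => (z i).1) S ∈ p} :=
      fun i => (congrFun h i).to_iff
    refine ⟨fun t ht i hi => (h' i).mp hi t ht, fun s hs i hi => (h' i).mpr fun t ht => ?_⟩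
    exact hs t ht i hi
  · rintro ⟨h1, h2⟩
    refine funext fun i => propext ⟨fun hi t ht => h1 t ht i hi, ?_⟩
    exact h2 (⋂₀ {S | attach (fun i => (z i).1) S ∈ p}) (fun t ht i hi => hi t ht) i

theorem sUnion {p : Set (ℕ → Γ × Prop)} (hp : OmegaRegular p) :
    RegularFn fun (u : ℕ → Γ) => ⋃₀ {S | attach u S ∈ p} := by
  have hsub : OmegaRegular {z : ℕ → (Γ × Prop) × Prop | ∀ i, (z i).2 → (z i).1.2} :=
    OmegaRegular.forall_letter fun x : (Γ × Prop) × Prop => x.2 → x.1.2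
  have hub := ((hp.comap fun x : (Γ × Prop) × Prop => (x.1.1, x.2)).imp hsub).forall_snd
  have hle : OmegaRegular {z : ℕ → (Γ × Prop) × Prop | ∀ i, (z i).1.2 → (z i).2} :=
    OmegaRegular.forall_letter fun x : (Γ × Prop) × Prop => x.1.2 → x.2
  have hgr := ((hub.comap fun x : (Γ × Prop) × Prop => (x.1.1, x.2)).imp hle).forall_snd
  refine OmegaRegular.congr (hub.inter hgr) fun z => ?_
  constructor
  · intro h
    have h' : ∀ i, (z i).2 ↔ i ∈ ⋃₀ {S | attach (fun i => (z i).1) S ∈ p} :=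
      fun i => (congrFun h i).to_iff
    refine ⟨fun t ht i hi => (h' i).mpr ⟨t, ht, hi⟩, fun s hs i hi => ?_⟩
    obtain ⟨t, ht, hi⟩ := (h' i).mp hi
    exact hs t ht i hi
  · rintro ⟨h1, h2⟩
    refine funext fun i => propext ⟨?_, ?_⟩
    · exact h2 (⋃₀ {S | attach (fun i => (z i).1) S ∈ p}) (fun t ht i hi => ⟨t, ht, hi⟩) i
    · rintro ⟨t, ht, hi⟩
      exact h1 t ht i hi

end RegularFn

/-! ### Semantics of formulas along a component -/

/-- The direction in which a modality moves. -/
def Modality.Dir : Modality → ℕ → ℕ → Prop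
  | .Xg | .Xc => fun i j => j = i + 1
  | .Yg | .Yc => fun i j => i = j + 1

/-- The semantics of a formula on a non-empty initial segment `dom` of `ℕ`, where all modalities
move to the neighbouring position and the atoms are interpreted by `α`. -/
def Formula.linSem {A : Type} (dom : Set ℕ) (α : Atom A → Set ℕ) :
    Formula A → (ℕ → Set ℕ) → Set ℕ
  | .var x, v => v x
  | .atom a, _ => α a
  | .natom a, _ => (α a)ᶜ
  | .modal M φ, v => {i | ∃ j ∈ dom, M.Dir i j ∧ j ∈ φ.linSem dom α v}
  | .or φ ψ, v => φ.linSem dom α v ∪ ψ.linSem dom α v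
  | .and φ ψ, v => φ.linSem dom α v ∩ ψ.linSem dom α v
  | .mu x φ, v => ⋂₀ {S | φ.linSem dom α (Function.update v x S) ⊆ S}
  | .nu x φ, v => ⋃₀ {S | S ⊆ φ.linSem dom α (Function.update v x S)}

theorem RegularFn.update_attach {Γ : Type} (ν : Γ → ℕ → Prop) (u : ℕ → Γ) (x : ℕ) (S : Set ℕ) :
    (fun y => {i | Function.update (ν (RegularFn.attach u S i).1) x (RegularFn.attach u S i).2 y}) =
      Function.update (fun y => {i | ν (u i) y}) x S := by
  funext y
  by_cases h : y = x
  · subst h; simp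
  · simp [h]

/-- The semantics of a formula along a component is a regular function. -/
theorem Formula.regularFn_linSem {A : Type} (ψ : Formula A) {Γ : Type} (δ : Γ → Prop)
    (α : Γ → Atom A → Prop) (ν : Γ → ℕ → Prop) :
    RegularFn fun u : ℕ → Γ => ψ.linSem {i | δ (u i)} (fun a => {i | α (u i) a})
      fun x => {i | ν (u i) x} := by
  induction ψ generalizing Γ with
  | var x => exact RegularFn.letterwise fun a => ν a x
  | atom a => exact RegularFn.letterwise fun b => α b a
  | natom a => exact RegularFn.letterwise fun b => ¬ α b a
  | modal M φ ih =>
    have h := (RegularFn.letterwise fun a : Γ => a).pair (ih δ α ν)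
    have hX := (RegularFn.next fun x : Γ × Prop => δ x.1 ∧ x.2).comp h
    have hY := (RegularFn.prev fun x : Γ × Prop => δ x.1 ∧ x.2).comp h
    have eX : ∀ (d S : Set ℕ), {i | ∃ j ∈ d, j = i + 1 ∧ j ∈ S} = {i | i + 1 ∈ d ∧ i + 1 ∈ S} := by
      intro d S
      ext i
      constructor
      · rintro ⟨j, h, rfl, h'⟩; exact ⟨h, h'⟩
      · rintro ⟨h, h'⟩; exact ⟨_, h, rfl, h'⟩
    have eY : ∀ (d S : Set ℕ), {i | ∃ j ∈ d, i = j + 1 ∧ j ∈ S} =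
        {i | ∃ j, i = j + 1 ∧ j ∈ d ∧ j ∈ S} := by
      intro d S
      ext i
      constructor
      · rintro ⟨j, h, h1, h'⟩; exact ⟨j, h1, h, h'⟩
      · rintro ⟨j, h1, h, h'⟩; exact ⟨j, h, h1, h'⟩
    cases M
    · simp only [Formula.linSem, Modality.Dir, eX]; exact hX
    · simp only [Formula.linSem, Modality.Dir, eX]; exact hX
    · simp only [Formula.linSem, Modality.Dir, eY]; exact hY
    · simp only [Formula.linSem, Modality.Dir, eY]; exact hY
  | or φ ψ ih1 ih2 =>
    exact ((ih1 δ α ν).pair (ih2 δ α ν)).map fun x => x.1 ∨ x.2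
  | and φ ψ ih1 ih2 =>
    exact ((ih1 δ α ν).pair (ih2 δ α ν)).map fun x => x.1 ∧ x.2
  | mu x φ ih =>
    -- The value of the bound variable becomes one more track of the word, so that the induction
    -- hypothesis covers the map `S ↦ φ(S)`, and being a pre-fixed point is a regular condition on
    -- that track.
    have h := ih (Γ := Γ × Prop) (fun a => δ a.1) (fun a => α a.1)
      fun a => Function.update (ν a.1) x a.2
    have h2 := (h.pair (RegularFn.letterwise fun a : Γ × Prop => a.2)).preimage
      (OmegaRegular.forall_letter fun a : Prop × Prop => a.1 → a.2)
    refine (RegularFn.sInter h2).congr fun u => congrArg Set.sInter (Set.ext fun S => ?_)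
    change _ ↔ (_ : Set ℕ) ⊆ _
    rw [Set.mem_ofPred_eq, ← RegularFn.update_attach]
  | nu x φ ih =>
    have h := ih (Γ := Γ × Prop) (fun a => δ a.1) (fun a => α a.1)
      fun a => Function.update (ν a.1) x a.2
    have h2 := (h.pair (RegularFn.letterwise fun a : Γ × Prop => a.2)).preimage
      (OmegaRegular.forall_letter fun a : Prop × Prop => a.2 → a.1)
    refine (RegularFn.sUnion h2).congr fun u => congrArg Set.sUnion (Set.ext fun S => ?_)
    change _ ↔ (_ : Set ℕ) ⊆ _
    rw [Set.mem_ofPred_eq, ← RegularFn.update_attach]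

/-! ### Semantics on a word versus semantics along a component -/

section Transfer

variable {P : Type v} [LinearOrder P] {A : Type} {D : Type u}

omit [LinearOrder P] in
theorem update_agree {dom : Set ℕ} {pos : ℕ → P} {s : Set ℕ} {x : ℕ} {v : ℕ → Set P}
    {v' : ℕ → Set ℕ} (hv : ∀ y ∈ s \ {x}, ∀ k ∈ dom, k ∈ v' y ↔ pos k ∈ v y) {T : Set ℕ} {S : Set P}
    (h : ∀ k ∈ dom, k ∈ T ↔ pos k ∈ S) :
    ∀ y ∈ s, ∀ k ∈ dom, k ∈ Function.update v' x T y ↔ pos k ∈ Function.update v x S y := by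
  intro y hy k hk
  by_cases e : y = x
  · subst e; simpa using h k hk
  · simpa [e] using hv y ⟨hy, e⟩ k hk

/-- The modalities of `ψ` do not leave the component, so its truth there is determined by the
restriction of the valuation. At a fixpoint, pre- and post-fixed points have to be transported in
both directions. Positions outside the component are all added for `μ` and all removed for `ν`,
which makes the required inclusion trivial there. -/
theorem Formula.mem_linSem_iff {w : P → A × D} {dom : Set ℕ} {pos : ℕ → P}
    (hinj : Set.InjOn pos dom) {α : Atom A → Set ℕ} (ψ : Formula A)
    (hM : ∀ M ∈ ψ.modalities, ∀ k ∈ dom, ∀ j,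
      M.Rel w (pos k) j ↔ ∃ k' ∈ dom, M.Dir k k' ∧ j = pos k')
    (hα : ∀ a ∈ ψ.atoms, ∀ k ∈ dom, k ∈ α a ↔ pos k ∈ a.sem w) (v : ℕ → Set P) (v' : ℕ → Set ℕ)
    (hv : ∀ x ∈ ψ.freeVars, ∀ k ∈ dom, k ∈ v' x ↔ pos k ∈ v x) :
    ∀ k ∈ dom, k ∈ ψ.linSem dom α v' ↔ pos k ∈ ψ.sem w v := by
  induction ψ generalizing v v' with
  | var x => exact hv x rfl
  | atom a => exact hα a rfl
  | natom a => exact fun k hk => not_congr (hα a rfl k hk)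
  | modal M φ ih =>
    intro k hk
    have ih := ih (fun M h => hM M (Set.mem_insert_of_mem _ h)) hα v v' hv
    constructor
    · rintro ⟨j, hj, h1, h2⟩
      exact ⟨pos j, (hM M (Set.mem_insert _ _) k hk _).mpr ⟨j, hj, h1, rfl⟩, (ih j hj).mp h2⟩
    · rintro ⟨j, h1, h2⟩
      obtain ⟨j, hj, h3, rfl⟩ := (hM M (Set.mem_insert _ _) k hk _).mp h1
      exact ⟨j, hj, h3, (ih j hj).mpr h2⟩
  | or φ ψ ih1 ih2 =>
    intro k hk
    exact or_congr
      (ih1 (fun M h => hM M (.inl h)) (fun a h => hα a (.inl h)) v v' (fun x h => hv x (.inl h)) k hk)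
      (ih2 (fun M h => hM M (.inr h)) (fun a h => hα a (.inr h)) v v' (fun x h => hv x (.inr h)) k hk)
  | and φ ψ ih1 ih2 =>
    intro k hk
    exact and_congr
      (ih1 (fun M h => hM M (.inl h)) (fun a h => hα a (.inl h)) v v' (fun x h => hv x (.inl h)) k hk)
      (ih2 (fun M h => hM M (.inr h)) (fun a h => hα a (.inr h)) v v' (fun x h => hv x (.inr h)) k hk)
  | mu x φ ih =>
    intro k hk
    constructor
    · intro h S hS
      refine h {k | k ∈ dom → pos k ∈ S} (fun j hj hjd => hS ?_) hk
      exact (ih hM hα _ _ (update_agree hv fun k hk => ⟨fun h : k ∈ dom → _ => h hk, fun h _ => h⟩) j hjd).mp hj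
    · intro h T hT
      -- This set contains every position outside the component, so only positions `pos j` have to
      -- be checked.
      refine h {i | ∀ k ∈ dom, pos k = i → k ∈ T} ?_ k hk rfl
      rintro i hi j hj rfl
      refine hT ((ih hM hα _ _ (update_agree hv fun k hk => ?_) j hj).mpr hi)
      exact ⟨fun h k' hk' e => hinj hk' hk e ▸ h, fun h => h k hk rfl⟩
  | nu x φ ih =>
    intro k hk
    constructor
    · rintro ⟨T, hT, h⟩
      -- Dually, this set contains no position outside the component.
      refine ⟨{i | ∃ k ∈ dom, pos k = i ∧ k ∈ T}, ?_, k, hk, rfl, h⟩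
      rintro i ⟨j, hj, rfl, hjT⟩
      refine (ih hM hα _ _ (update_agree hv fun k hk => ?_) j hj).mp (hT hjT)
      exact ⟨fun h => ⟨k, hk, rfl, h⟩, fun ⟨k', hk', e, h⟩ => hinj hk' hk e ▸ h⟩
    · rintro ⟨S, hS, h⟩
      refine ⟨{k | k ∈ dom ∧ pos k ∈ S}, ?_, hk, h⟩
      rintro j ⟨hj, hjS⟩
      exact (ih hM hα _ _ (update_agree hv fun k hk => ⟨fun h : _ ∧ _ => h.2, fun h => ⟨hk, h⟩⟩) j hj).mpr
        (hS hjS)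

/-- The semantics of a formula depends only on the values of its free variables. -/
theorem Formula.sem_congr (w : P → A × D) (ψ : Formula A) {v v' : ℕ → Set P}
    (h : ∀ x ∈ ψ.freeVars, v x = v' x) : ψ.sem w v = ψ.sem w v' := by
  induction ψ generalizing v v' with
  | var x => exact h x rfl
  | atom a => rfl
  | natom a => rfl
  | modal M φ ih => simp only [Formula.sem, ih h]
  | or φ ψ ih1 ih2 | and φ ψ ih1 ih2 =>
    simp only [Formula.sem, ih1 fun x hx => h x (.inl hx), ih2 fun x hx => h x (.inr hx)]
  | mu x φ ih | nu x φ ih =>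
    have : ∀ S, φ.sem w (Function.update v x S) = φ.sem w (Function.update v' x S) := by
      intro S
      refine ih fun y hy => ?_
      by_cases e : y = x
      · subst e; simp
      · simpa [e] using h y ⟨hy, e⟩
    simp only [Formula.sem, this]

/-- The substitution lemma, for sentences. -/
theorem Formula.sem_subst (w : P → A × D) (ψ : Formula A) (σ : ℕ → Formula A)
    (h : ∀ x ∈ ψ.freeVars, (σ x).freeVars = ∅) (v : ℕ → Set P) :
    (ψ.subst σ).sem w v = ψ.sem w fun x => (σ x).sem w v := by
  suffices H : ∀ (ψ : Formula A) (σ : ℕ → Formula A) (v v' : ℕ → Set P),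
      (∀ x ∈ ψ.freeVars, (σ x).sem w v = v' x ∧ ((σ x).freeVars = ∅ ∨ σ x = .var x)) →
      (ψ.subst σ).sem w v = ψ.sem w v' from H ψ σ v _ fun x hx => ⟨rfl, .inl (h x hx)⟩
  clear h v σ ψ
  intro ψ
  induction ψ with
  | var x => exact fun σ v v' h => (h x rfl).1
  | atom a => exact fun σ v v' h => rfl
  | natom a => exact fun σ v v' h => rfl
  | modal M φ ih =>
    intro σ v v' h
    simp only [Formula.subst, Formula.sem, ih σ v v' h]
  | or φ ψ ih1 ih2 | and φ ψ ih1 ih2 =>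
    intro σ v v' h
    simp only [Formula.subst, Formula.sem, ih1 σ v v' fun x hx => h x (.inl hx),
      ih2 σ v v' fun x hx => h x (.inr hx)]
  | mu x φ ih | nu x φ ih =>
    intro σ v v' h
    have : ∀ S, (φ.subst (Function.update σ x (.var x))).sem w (Function.update v x S) =
        φ.sem w (Function.update v' x S) := by
      intro S
      refine ih _ _ _ fun y hy => ?_
      by_cases e : y = x
      · subst e; simp [Formula.sem]
      · obtain ⟨h1, h2⟩ := h y ⟨hy, e⟩
        simp only [Function.update_of_ne e]
        refine ⟨?_, h2⟩
        rw [← h1]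
        refine Formula.sem_congr w _ fun z hz => ?_
        rcases h2 with h2 | h2
        · rw [h2] at hz; exact hz.elim
        · rw [h2] at hz
          obtain rfl : z = y := hz
          simp [e]
    simp only [Formula.subst, Formula.sem, this]

end Transfer

/-! ### Components -/

/-- The two modes: global and class. -/
inductive Mode where
  | glob | cls

namespace Mode

/-- The other mode. -/
def other : Mode → Mode
  | .glob => .cls
  | .cls => .glob

@[simp] theorem other_other (m : Mode) : m.other.other = m := by cases m <;> rfl

/-- The forward modality of a mode. -/
def next : Mode → Modality
  | .glob => .Xg
  | .cls => .Xc

/-- The backward modality of a mode. -/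
def prev : Mode → Modality
  | .glob => .Yg
  | .cls => .Yc

/-- The modalities of a mode. -/
def modalities (m : Mode) : Set Modality := {m.next, m.prev}

/-- The atom that marks the first position of a component. -/
def first (A : Type) : Mode → Atom A
  | .glob => .firstG
  | .cls => .firstC

/-- The atom that marks the last position of a component. -/
def last (A : Type) : Mode → Atom A
  | .glob => .lastG
  | .cls => .lastC

/-- The components of a word: all positions in the global mode, the classes in the class mode. -/
def IsComponent {P : Type v} {A : Type} {D : Type u} (w : P → A × D) : Mode → Set P → Prop
  | .glob, s => s = Set.univ
  | .cls, s => ∃ d, s = {i | (w i).2 = d}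

end Mode

/-! ### Components listed in increasing order -/

section Enumerates

variable {P : Type v} [LinearOrder P] {A B : Type} {D : Type u}

/-- `pos` lists a component of `w` in order, its domain being the initial segment `dom` of `ℕ`. -/
structure Enumerates (m : Mode) (w : P → A × D) (dom : Set ℕ) (pos : ℕ → P) : Prop where
  lower : ∀ ⦃k l⦄, k ≤ l → l ∈ dom → k ∈ dom
  mono : ∀ ⦃k⦄, k ∈ dom → ∀ ⦃l⦄, l ∈ dom → (pos k < pos l ↔ k < l)
  isComponent : m.IsComponent w (pos '' dom)

namespace Enumerates

variable {m : Mode} {w : P → A × D} {dom : Set ℕ} {pos : ℕ → P}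

theorem injOn (h : Enumerates m w dom pos) : Set.InjOn pos dom := by
  intro k hk l hl e
  have h1 := h.mono hk hl
  have h2 := h.mono hl hk
  rw [e] at h1 h2
  simp only [lt_self_iff_false, false_iff] at h1 h2
  omega

/-- The domain is an initial segment of `ℕ` and `pos` is monotone on it, so the next position of the
component has the next index. -/
theorem next_iff (h : Enumerates m w dom pos) {k : ℕ} (hk : k ∈ dom) (j : P) :
    (pos k < j ∧ j ∈ pos '' dom ∧ ∀ l, pos k < l → l < j → l ∉ pos '' dom) ↔
      k + 1 ∈ dom ∧ j = pos (k + 1) := by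
  constructor
  · rintro ⟨h1, ⟨l, hl, rfl⟩, h3⟩
    have hkl := (h.mono hk hl).mp h1
    have hk1 : k + 1 ∈ dom := h.lower hkl hl
    refine ⟨hk1, ?_⟩
    rcases Nat.lt_or_ge (k + 1) l with h4 | h4
    · exact absurd ⟨_, hk1, rfl⟩ (h3 (pos (k + 1)) ((h.mono hk hk1).mpr (Nat.lt_succ_self k))
        ((h.mono hk1 hl).mpr h4))
    · obtain rfl : l = k + 1 := le_antisymm h4 hkl
      rfl
  · rintro ⟨hk1, rfl⟩
    refine ⟨(h.mono hk hk1).mpr (Nat.lt_succ_self k), ⟨_, hk1, rfl⟩, ?_⟩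
    rintro _ h1 h2 ⟨l, hl, rfl⟩
    have := (h.mono hk hl).mp h1
    have := (h.mono hl hk1).mp h2
    omega

theorem prev_iff (h : Enumerates m w dom pos) {k : ℕ} (hk : k ∈ dom) (j : P) :
    (j < pos k ∧ j ∈ pos '' dom ∧ ∀ l, j < l → l < pos k → l ∉ pos '' dom) ↔
      ∃ l ∈ dom, k = l + 1 ∧ j = pos l := by
  constructor
  · rintro ⟨h1, ⟨l, hl, rfl⟩, h3⟩
    have := ((h.next_iff hl (pos k)).mp ⟨h1, ⟨k, hk, rfl⟩, h3⟩)
    exact ⟨l, hl, h.injOn hk this.1 this.2, rfl⟩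
  · rintro ⟨l, hl, rfl, rfl⟩
    have := (h.next_iff hl (pos (l + 1))).mpr ⟨hk, rfl⟩
    exact ⟨this.1, ⟨l, hl, rfl⟩, this.2.2⟩

theorem rel_iff (h : Enumerates m w dom pos) {M : Modality} (hM : M ∈ m.modalities) {k : ℕ}
    (hk : k ∈ dom) (j : P) :
    M.Rel w (pos k) j ↔ ∃ k' ∈ dom, M.Dir k k' ∧ j = pos k' := by
  have hc := h.isComponent
  have hX := h.next_iff hk j
  have hY := h.prev_iff hk j
  have hX' : (∃ k' ∈ dom, k' = k + 1 ∧ j = pos k') ↔ k + 1 ∈ dom ∧ j = pos (k + 1) := by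
    constructor
    · rintro ⟨_, h, rfl, h'⟩; exact ⟨h, h'⟩
    · rintro ⟨h, h'⟩; exact ⟨_, h, rfl, h'⟩
  have hkm : pos k ∈ pos '' dom := ⟨k, hk, rfl⟩
  cases m with
  | glob =>
    rw [show pos '' dom = Set.univ from hc] at hX hY
    rcases hM with rfl | rfl
    · refine Iff.trans ?_ (hX.trans hX'.symm)
      simp [Mode.next, Modality.Rel, GSucc, CovBy]
    · refine Iff.trans ?_ hY
      simp [Mode.prev, Modality.Rel, GSucc, CovBy]
  | cls =>
    obtain ⟨d, hd⟩ := hc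
    rw [hd] at hX hY hkm
    have hkm : (w (pos k)).2 = d := hkm
    rcases hM with rfl | rfl
    · refine Iff.trans ?_ (hX.trans hX'.symm)
      simp [Mode.next, Modality.Rel, CSucc, hkm]
    · refine Iff.trans ?_ hY
      simp only [Mode.prev, Modality.Rel, CSucc, hkm, Set.mem_ofPred_eq]
      constructor
      · rintro ⟨h1, h2, h3⟩
        exact ⟨h1, h2.symm, fun l a b => h2 ▸ h3 l a b⟩
      · rintro ⟨h1, h2, h3⟩
        exact ⟨h1, h2.symm, fun l a b => h2 ▸ h3 l a b⟩

theorem first_iff (h : Enumerates m w dom pos) {k : ℕ} (hk : k ∈ dom) :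
    pos k ∈ (m.first A).sem w ↔ k = 0 := by
  have h0 : 0 ∈ dom := h.lower (Nat.zero_le k) hk
  cases m with
  | glob =>
    constructor
    · intro hf
      have := (h.mono h0 hk).not.mp (not_lt.mpr (hf (pos 0)))
      omega
    · rintro rfl j
      obtain ⟨l, hl, rfl⟩ : j ∈ pos '' dom := by rw [show pos '' dom = _ from h.isComponent]; trivial
      exact not_lt.mp ((h.mono hl h0).not.mpr (Nat.not_lt_zero l))
  | cls =>
    have : ∀ j, CSucc w j (pos k) ↔ _ := fun j =>
      h.rel_iff (M := .Yc) (Set.mem_insert_of_mem _ rfl) hk j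
    simp only [Mode.first, Atom.sem, Set.mem_ofPred_eq, this, Modality.Dir]
    constructor
    · intro hn
      by_contra hk0
      obtain ⟨l, rfl⟩ := Nat.exists_eq_succ_of_ne_zero hk0
      exact hn ⟨_, l, h.lower (Nat.le_succ l) hk, rfl, rfl⟩
    · rintro rfl ⟨_, l, -, hl, -⟩
      omega

theorem last_iff (h : Enumerates m w dom pos) {k : ℕ} (hk : k ∈ dom) :
    pos k ∈ (m.last A).sem w ↔ k + 1 ∉ dom := by
  cases m with
  | glob =>
    constructor
    · intro hf hk1
      exact absurd ((h.mono hk hk1).mpr (Nat.lt_succ_self k)) (not_lt.mpr (hf (pos (k + 1))))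
    · intro hk1 j
      obtain ⟨l, hl, rfl⟩ : j ∈ pos '' dom := by rw [show pos '' dom = _ from h.isComponent]; trivial
      exact not_lt.mp ((h.mono hk hl).not.mpr fun hkl => hk1 (h.lower hkl hl))
  | cls =>
    have : ∀ j, CSucc w (pos k) j ↔ _ := fun j =>
      h.rel_iff (M := .Xc) (Set.mem_insert _ _) hk j
    simp only [Mode.last, Atom.sem, Set.mem_ofPred_eq, this, Modality.Dir]
    constructor
    · exact fun hn hk1 => hn ⟨_, k + 1, hk1, rfl, rfl⟩
    · rintro hk1 ⟨_, l, hl, rfl, -⟩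
      exact hk1 hl

theorem of_fin [Nonempty P] {s : Set P} (hs : m.IsComponent w s) {n : ℕ} (e : Fin n ≃o s) :
    ∃ pos : ℕ → P, Enumerates m w {k | k < n} pos ∧ ∀ k : Fin n, pos k = e k := by
  let pos : ℕ → P := fun k => if h : k < n then e ⟨k, h⟩ else Classical.arbitrary P
  have hpos : ∀ k (h : k < n), pos k = e ⟨k, h⟩ := fun k h => dif_pos h
  refine ⟨pos, ⟨fun k l h h' => lt_of_le_of_lt h h', fun k hk l hl => ?_, ?_⟩,
    fun k => hpos k k.2⟩
  · rw [hpos k hk, hpos l hl, Subtype.coe_lt_coe, e.lt_iff_lt, Fin.mk_lt_mk]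
  · convert hs
    ext i
    constructor
    · rintro ⟨k, hk, rfl⟩
      rw [hpos k hk]; exact (e _).2
    · intro hi
      exact ⟨e.symm ⟨i, hi⟩, (e.symm ⟨i, hi⟩).2, by rw [hpos _ (e.symm ⟨i, hi⟩).2]; simp⟩

theorem of_nat {s : Set P} (hs : m.IsComponent w s) (e : ℕ ≃o s) :
    Enumerates m w Set.univ fun k => (e k : P) := by
  refine ⟨fun _ _ _ _ => trivial, fun k hk l hl => ?_, ?_⟩
  · rw [Subtype.coe_lt_coe, e.lt_iff_lt]
  · convert hs
    ext i
    constructor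
    · rintro ⟨k, hk, rfl⟩
      exact (e _).2
    · intro hi
      exact ⟨e.symm ⟨i, hi⟩, trivial, by simp⟩

end Enumerates

/-- Every formula of a mode can be evaluated along the components of that mode. -/
theorem Enumerates.mem_sem_iff {m : Mode} {w : P → A × D} {dom : Set ℕ} {pos : ℕ → P}
    (h : Enumerates m w dom pos) (ψ : Formula A) (hM : ψ.modalities ⊆ m.modalities)
    {α : Atom A → Set ℕ} (hα : ∀ a ∈ ψ.atoms, ∀ k ∈ dom, k ∈ α a ↔ pos k ∈ a.sem w)
    {v : ℕ → Set P} {v' : ℕ → Set ℕ}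
    (hv : ∀ x ∈ ψ.freeVars, ∀ k ∈ dom, k ∈ v' x ↔ pos k ∈ v x) {k : ℕ} (hk : k ∈ dom) :
    pos k ∈ ψ.sem w v ↔ k ∈ ψ.linSem dom α v' :=
  (ψ.mem_linSem_iff h.injOn (fun _ hM' _ hk j => h.rel_iff (hM hM') hk j) hα v v' hv k hk).symm

end Enumerates

/-! ### Kinds of words, and cascades over them -/

/-- A kind of words, with its transducers. It is used for finite data words and for data `ω`-words,
in order to treat the two in the same way. -/
structure WordKind (D : Type u) where
  Index : Type
  Pos : Index → Type
  order : ∀ n, LinearOrder (Pos n)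
  start : ∀ n, Pos n
  start_le : ∀ n i, start n ≤ i
  Trans : Type → Type → Type 1
  Run : ∀ {A B : Type}, Trans A B → ∀ {n}, (Pos n → A × D) → (Pos n → B × D) → Prop

attribute [instance] WordKind.order

/-- The word with the data values of `w` and the labels `ℓ`. -/
def relabel {P : Type v} {A B : Type} {D : Type u} (w : P → A × D) (ℓ : P → B) : P → B × D :=
  fun i => (ℓ i, (w i).2)

theorem eq_relabel_iff {P : Type v} {A B : Type} {D : Type u} {w : P → A × D} {ℓ : P → B}
    {w' : P → B × D} : w' = relabel w ℓ ↔ ∀ i, (w' i).2 = (w i).2 ∧ (w' i).1 = ℓ i := by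
  simp only [funext_iff, relabel, Prod.ext_iff, and_comm]

/-- The word `f (pos 0), f (pos 1), …`, which ends where `dom` ends. -/
noncomputable def encode {P : Type v} {Γ : Type} (f : P → Γ) (dom : Set ℕ) (pos : ℕ → P) :
    ℕ → Option Γ := by
  classical exact fun k => if k ∈ dom then some (f (pos k)) else none

theorem encode_of_mem {P : Type v} {Γ : Type} (f : P → Γ) {dom : Set ℕ} (pos : ℕ → P) {k : ℕ}
    (h : k ∈ dom) : encode f dom pos k = some (f (pos k)) := by
  classical exact if_pos h

theorem encode_of_notMem {P : Type v} {Γ : Type} (f : P → Γ) {dom : Set ℕ} (pos : ℕ → P) {k : ℕ}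
    (h : k ∉ dom) : encode f dom pos k = none := by
  classical exact if_neg h

theorem map_encode {P : Type v} {Γ Δ : Type} (g : Γ → Δ) (f : P → Γ) (dom : Set ℕ) (pos : ℕ → P)
    (k : ℕ) : (encode f dom pos k).map g = encode (fun i => g (f i)) dom pos k := by
  by_cases h : k ∈ dom
  · rw [encode_of_mem _ _ h, encode_of_mem _ _ h]; rfl
  · rw [encode_of_notMem _ _ h, encode_of_notMem _ _ h]; rfl

variable {D : Type u}

/-- The input–output relation of a cascade. -/
def Cascade.Runs {K : WordKind D} {n : K.Index} : {A B : Type} → Cascade K.Trans A B →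
    (K.Pos n → A × D) → (K.Pos n → B × D) → Prop
  | _, _, .nil _, w, w' => w' = w
  | _, _, .cons _ t c, w, w' => ∃ w₁, K.Run t w w₁ ∧ c.Runs w₁ w'

/-- A cascade followed by a transducer. -/
def Cascade.snoc {T : Type → Type → Type 1} {B' : Type} (h' : Finite B') :
    {A B : Type} → Cascade T A B → T B B' → Cascade T A B'
  | _, _, .nil _, t => .cons h' t (.nil _)
  | _, _, .cons h t' c, t => .cons h t' (c.snoc h' t)

theorem Cascade.height_snoc {T : Type → Type → Type 1} {A B B' : Type} (h' : Finite B')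
    (c : Cascade T A B) (t : T B B') : (c.snoc h' t).height = c.height + 1 := by
  induction c with
  | nil A => rfl
  | cons h t' c ih => simp only [Cascade.snoc, Cascade.height, ih]

theorem Cascade.runs_snoc {K : WordKind D} {n : K.Index} {A B B' : Type} (h' : Finite B')
    (c : Cascade K.Trans A B) (t : K.Trans B B') (w : K.Pos n → A × D) (w' : K.Pos n → B' × D) :
    (c.snoc h' t).Runs w w' ↔ ∃ w₁, c.Runs w w₁ ∧ K.Run t w₁ w' := by
  induction c with
  | nil A => simp [Cascade.snoc, Cascade.Runs]
  | cons h t' c ih =>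
    simp only [Cascade.snoc, Cascade.Runs, ih]
    constructor
    · rintro ⟨w₁, h1, w₂, h2, h3⟩; exact ⟨w₂, ⟨w₁, h1, h2⟩, h3⟩
    · rintro ⟨w₂, ⟨w₁, h1, h2⟩, h3⟩; exact ⟨w₁, h1, w₂, h2, h3⟩

/-- Every regular function is computed by a transducer of a given mode, which can check in addition
that all letters of the output belong to a given set. -/
def WordKind.RealizesRegularFn (K : WordKind D) : Prop :=
  ∀ (m : Mode) (A B : Type) (f : (ℕ → Option (A × Mark)) → ℕ → B), RegularFn f → ∀ Q : Set B,
    ∃ t : K.Trans A B, ∀ (n : K.Index) (w : K.Pos n → A × D) (ℓ : K.Pos n → B),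
      (∀ dom pos, Enumerates m w dom pos → ∀ k ∈ dom,
        f (encode (markedLabel w) dom pos) k = ℓ (pos k)) →
      ∀ w', K.Run t w w' ↔ w' = relabel w ℓ ∧ ∀ i, ℓ i ∈ Q

/-! ### Labellings -/

/-- A labelling of the positions of words over `A` by elements of `B`. -/
abbrev Labelling (K : WordKind D) (A B : Type) : Type (max 0 u) :=
  ∀ n : K.Index, (K.Pos n → A × D) → K.Pos n → B

section Level

variable {K : WordKind D} {A B B' B'' : Type}

/-- The labelling `ℓ` is a regular function of the labelling `ℓ'` and the marks, along every
component. -/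
def RegularIn (m : Mode) (ℓ' : Labelling K A B') (ℓ : Labelling K A B) : Prop :=
  ∃ f : (ℕ → Option (B' × Mark)) → ℕ → B, RegularFn f ∧
    ∀ n (w : K.Pos n → A × D) dom pos, Enumerates m w dom pos → ∀ k ∈ dom,
      f (encode (markedLabel (relabel w (ℓ' n w))) dom pos) k = ℓ n w (pos k)

theorem markedLabel_relabel {P : Type v} [LinearOrder P] (w : P → A × D) (ℓ : P → B) (i : P) :
    markedLabel (relabel w ℓ) i = (ℓ i, (markedLabel w i).2) := rfl

/-- Two consecutive steps of one mode work along the same components, so they compose to a single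
regular function. The marks are copied past the first step, since the second one reads them too. -/
theorem RegularIn.trans {m : Mode} {ℓ₁ : Labelling K A B} {ℓ₂ : Labelling K A B'}
    {ℓ₃ : Labelling K A B''} (h : RegularIn m ℓ₁ ℓ₂) (h' : RegularIn m ℓ₂ ℓ₃) :
    RegularIn m ℓ₁ ℓ₃ := by
  obtain ⟨f, hf, h⟩ := h
  obtain ⟨f', hf', h'⟩ := h'
  refine ⟨_, hf'.comp ((hf.pair (RegularFn.letterwise fun a => a)).map
    fun x : B' × Option (B × Mark) => x.2.map fun y => (x.1, y.2)), fun n w dom pos he k hk => ?_⟩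
  rw [← h' n w dom pos he k hk]
  congr 1
  funext l
  by_cases hl : l ∈ dom
  · rw [encode_of_mem _ _ hl, encode_of_mem _ _ hl, h n w dom pos he l hl]; rfl
  · rw [encode_of_notMem _ _ hl, encode_of_notMem _ _ hl]; rfl

theorem RegularIn.of_letter (m : Mode) (ℓ : Labelling K A B) (g : Option (B × Mark) → B')
    (ℓ' : Labelling K A B') (h : ∀ n w i, ℓ' n w i = g (some (ℓ n w i, (markedLabel w i).2))) :
    RegularIn m ℓ ℓ' :=
  ⟨_, RegularFn.letterwise g, fun n w dom pos _ k hk => by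
    rw [encode_of_mem _ _ hk, h]; rfl⟩

theorem RegularIn.pi {ι : Type} [Finite ι] {B B' : ι → Type} {m : Mode}
    {ℓ : ∀ j, Labelling K A (B j)} {ℓ' : ∀ j, Labelling K A (B' j)}
    (h : ∀ j, RegularIn m (ℓ j) (ℓ' j)) :
    RegularIn m (fun n w i j => ℓ j n w i : Labelling K A (∀ j, B j)) fun n w i j => ℓ' j n w i := by
  choose f hf h using h
  refine ⟨_, RegularFn.pi fun j => (hf j).comp (RegularFn.letterwise
    fun x : Option ((∀ j, B j) × Mark) => x.map fun y => (y.1 j, y.2)),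
    fun n w dom pos he k hk => ?_⟩
  funext j
  refine Eq.trans ?_ (h j n w dom pos he k hk)
  refine congrFun (congrArg (f j) (funext fun l => ?_)) k
  exact map_encode _ _ _ _ _

/-- The labellings obtained from the letters by `k` alternating regular steps, the last one of
mode `m`. -/
def Level (K : WordKind D) (A : Type) : ℕ → Mode → ∀ B : Type, Labelling K A B → Prop
  | 0, _, B, ℓ => ∃ g : A → B, ∀ n w i, ℓ n w i = g (w i).1
  | k + 1, m, _, ℓ => ∃ B', Finite B' ∧ ∃ ℓ' : Labelling K A B',
      Level K A k m.other B' ℓ' ∧ RegularIn m ℓ' ℓ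

namespace Level

theorem absorb {k : ℕ} {m : Mode} {ℓ : Labelling K A B} {ℓ' : Labelling K A B'}
    (h : Level K A (k + 1) m B ℓ) (h' : RegularIn m ℓ ℓ') : Level K A (k + 1) m B' ℓ' := by
  obtain ⟨B₀, hB₀, ℓ₀, h0, h1⟩ := h
  exact ⟨B₀, hB₀, ℓ₀, h0, h1.trans h'⟩

theorem step [Finite B] [Nonempty B] {k : ℕ} {m : Mode} {ℓ : Labelling K A B}
    (h : Level K A k m.other B ℓ) : Level K A (k + 1) m B ℓ :=
  ⟨B, inferInstance, ℓ, h,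
    RegularIn.of_letter m ℓ (fun x => x.elim (Classical.arbitrary B) Prod.fst) ℓ fun _ _ _ => rfl⟩

/-- An identity step on top would change the mode of the last step. It is inserted at the bottom
instead, where level `0` makes no reference to a mode. -/
theorem succ [Finite B] [Nonempty B] {k : ℕ} {m : Mode} {ℓ : Labelling K A B}
    (h : Level K A k m B ℓ) : Level K A (k + 1) m B ℓ := by
  have key : ∀ (k : ℕ) (m : Mode) (B : Type) (ℓ : Labelling K A B), Nonempty B → Finite B →
      Level K A k m B ℓ → Level K A (k + 1) m B ℓ := by
    intro k
    induction k with
    | zero => exact fun m B ℓ _ _ h => step (show Level K A 0 m.other B ℓ from h)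
    | succ k ih =>
      rintro m B ℓ _ _ ⟨B', hB', ℓ', h, h'⟩
      -- If the intermediate alphabet is empty, there is no position to be labelled, and a constant
      -- labelling can take its place.
      rcases isEmpty_or_nonempty B' with hE | hN
      · exact ⟨Unit, inferInstance, fun _ _ _ => (), by
          clear ih h h'
          exact (show ∀ k m, Level K A k m Unit fun _ _ _ => () from fun k => by
            induction k with
            | zero => exact fun m => ⟨fun _ => (), fun _ _ _ => rfl⟩
            | succ k ih => exact fun m => step (ih _)) (k + 1) m.other,
          RegularIn.of_letter m _ (fun _ => Classical.arbitrary B) ℓ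
            fun n w i => (hE.false (ℓ' n w i)).elim⟩
      · exact ⟨B', hB', ℓ', ih _ _ _ hN hB' h, h'⟩
  exact key k m B ℓ inferInstance inferInstance h

theorem of_le [Finite B] [Nonempty B] {k l : ℕ} (hkl : k ≤ l) {m : Mode} {ℓ : Labelling K A B}
    (h : Level K A k m B ℓ) : Level K A l m B ℓ := by
  induction l, hkl using Nat.le_induction with
  | base => exact h
  | succ l _ ih => exact ih.succ

theorem succ_of_mode [Finite B] [Nonempty B] {k : ℕ} {m : Mode} {ℓ : Labelling K A B}
    (h : Level K A k m B ℓ) (m' : Mode) : Level K A (k + 1) m' B ℓ := by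
  cases m <;> cases m'
  · exact h.succ
  · exact step h
  · exact step h
  · exact h.succ

/-- Stages of the same mode run in parallel on product alphabets. -/
theorem pi {ι : Type} [Finite ι] {B : ι → Type} {k : ℕ} {m : Mode} {ℓ : ∀ j, Labelling K A (B j)}
    (h : ∀ j, Level K A k m (B j) (ℓ j)) :
    Level K A k m (∀ j, B j) fun n w i j => ℓ j n w i := by
  induction k generalizing m B with
  | zero =>
    choose g hg using h
    exact ⟨fun a j => g j a, fun n w i => funext fun j => hg j n w i⟩
  | succ k ih =>
    choose B' hB' ℓ' h h' using h
    exact ⟨∀ j, B' j, inferInstance, _, ih h, RegularIn.pi h'⟩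

/-- Each regular step becomes one transducer, and the last one also checks membership in `Q`. A
labelling of level `0` applies a map to the letters, which a cascade of height `0` cannot do; the
induction therefore carries the pending map `g`, and the next transducer applies it while reading.
-/
theorem exists_cascade (hK : K.RealizesRegularFn) [Finite B] {k : ℕ} {m : Mode}
    {ℓ : Labelling K A B} (h : Level K A (k + 1) m B ℓ) (Q : Set B) :
    ∃ C : Cascade K.Trans A B, C.height = k + 1 ∧ ∀ n (w : K.Pos n → A × D) w',
      C.Runs w w' ↔ w' = relabel w (ℓ n w) ∧ ∀ i, ℓ n w i ∈ Q := by
  suffices H : ∀ (k : ℕ) (m : Mode) (B : Type) (ℓ : Labelling K A B), Finite B → Level K A k m B ℓ →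
      ∀ Q : Set B, ∃ (B' : Type) (C : Cascade K.Trans A B') (ℓ₀ : Labelling K A B') (g : B' → B),
        C.height = k ∧ (∀ n w i, ℓ n w i = g (ℓ₀ n w i)) ∧
        (∀ n (w : K.Pos n → A × D) w', C.Runs w w' ↔
          w' = relabel w (ℓ₀ n w) ∧ (0 < k → ∀ i, ℓ n w i ∈ Q)) ∧
        (0 < k → ∃ e : B' = B, ∀ b, g b = e ▸ b) by
    obtain ⟨B', C, ℓ₀, g, h1, h2, h3, h4⟩ := H _ m B ℓ inferInstance h Q
    obtain ⟨rfl, h4⟩ := h4 (Nat.succ_pos k)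
    have : ℓ₀ = ℓ := by
      funext n w i
      rw [h2, h4]
    subst this
    exact ⟨C, h1, fun n w w' => (h3 n w w').trans (by simp)⟩
  clear h Q ℓ
  intro k
  induction k with
  | zero =>
    rintro m B ℓ _ ⟨g, hg⟩ Q
    refine ⟨A, .nil A, fun n w i => (w i).1, g, rfl, hg, fun n w w' => ?_, by simp⟩
    have : relabel w (fun i => (w i).1) = w := rfl
    simp [Cascade.Runs, this]
  | succ k ih =>
    rintro m B ℓ hB ⟨B₁, hB₁, ℓ₁, h1, f, hf, hfe⟩ Q
    obtain ⟨B', C, ℓ₀, g, i1, i2, i3, -⟩ := ih _ B₁ ℓ₁ hB₁ h1 Set.univ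
    obtain ⟨t, ht⟩ := hK m B' B _ (hf.comp (RegularFn.letterwise
      fun x : Option (B' × Mark) => x.map fun y => (g y.1, y.2))) Q
    refine ⟨B, C.snoc hB t, ℓ, id, by rw [Cascade.height_snoc, i1], fun _ _ _ => rfl,
      fun n w w' => ?_, fun _ => ⟨rfl, fun _ => rfl⟩⟩
    have := ht n (relabel w (ℓ₀ n w)) (ℓ n w) (fun dom pos he k hk => by
      have he' : Enumerates m w dom pos := ⟨he.lower, he.mono, by
        have := he.isComponent
        cases m <;> exact this⟩
      rw [← hfe n w dom pos he' k hk]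
      refine congrFun (congrArg f (funext fun l => ?_)) k
      rw [map_encode]
      refine congrFun (congrFun (congrFun (congrArg encode (funext fun i => ?_)) dom) pos) l
      simp only [markedLabel_relabel, i2])
    simp only [Cascade.runs_snoc, i3, Set.mem_univ, implies_true, and_true, exists_eq_left, this,
      Nat.succ_pos, forall_const]
    rfl

end Level

/-! ### Formulas define labellings -/

theorem Formula.finite_freeVars (ψ : Formula A) : ψ.freeVars.Finite := by
  induction ψ with
  | var x => exact Set.finite_singleton x
  | atom a => exact Set.finite_empty
  | natom a => exact Set.finite_empty
  | modal M φ ih => exact ih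
  | or φ ψ ih1 ih2 | and φ ψ ih1 ih2 => exact ih1.union ih2
  | mu x φ ih | nu x φ ih => exact ih.subset Set.sdiff_subset

theorem Formula.finite_atoms (ψ : Formula A) : ψ.atoms.Finite := by
  induction ψ with
  | var x => exact Set.finite_empty
  | atom a => exact Set.finite_singleton a
  | natom a => exact Set.finite_singleton a
  | modal M φ ih => exact ih
  | or φ ψ ih1 ih2 | and φ ψ ih1 ih2 => exact ih1.union ih2
  | mu x φ ih | nu x φ ih => exact ih

/-- The finitely many atoms and free variables of `ψ` are written side by side into one finite
alphabet of bit vectors. From there `ψ` is a single regular step of mode `m`, which merges with the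
last step. -/
theorem Level.formula {k : ℕ} {m : Mode} (ψ : Formula A) (hM : ψ.modalities ⊆ m.modalities)
    (hα : ∀ a ∈ ψ.atoms, Level K A (k + 1) m Prop fun _ w i => i ∈ a.sem w)
    (F : ℕ → Labelling K A Prop) (hF : ∀ x ∈ ψ.freeVars, Level K A (k + 1) m Prop (F x)) :
    Level K A (k + 1) m Prop fun n w i => i ∈ ψ.sem w fun x => {i | F x n w i} := by
  have := ψ.finite_freeVars.to_subtype
  have := ψ.finite_atoms.to_subtype
  let L : ψ.atoms ⊕ ψ.freeVars → Labelling K A Prop :=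
    Sum.elim (fun a _ w i => i ∈ a.1.sem w) fun x => F x.1
  have hL : Level K A (k + 1) m _ fun n w i j => L j n w i := Level.pi fun j => by
    rcases j with a | x
    exacts [hα a.1 a.2, hF x.1 x.2]
  refine hL.absorb ⟨_, ψ.regularFn_linSem (fun o => o.isSome)
    (fun o a => ∃ x, o = some x ∧ ∃ h : a ∈ ψ.atoms, x.1 (.inl ⟨a, h⟩))
    (fun o y => ∃ x, o = some x ∧ ∃ h : y ∈ ψ.freeVars, x.1 (.inr ⟨y, h⟩)),
    fun n w dom pos he k hk => propext ?_⟩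
  set E := encode (markedLabel (relabel w fun i j => L j n w i)) dom pos with hE
  -- The domain is visible in the encoded word as its set of non-blank positions.
  have hdom : {i | (E i).isSome} = dom := by
    ext i
    by_cases hi : i ∈ dom
    · simp [hE, encode_of_mem _ _ hi, hi]
    · simp [hE, encode_of_notMem _ _ hi, hi]
  change k ∈ ψ.linSem {i | (E i).isSome} _ _ ↔ _
  rw [hdom]
  refine (he.mem_sem_iff ψ hM (fun a ha k hk => ?_) (fun x hx k hk => ?_) hk).symm
  · constructor
    · rintro ⟨x, h, ha', h'⟩
      rw [hE, encode_of_mem _ _ hk] at h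
      obtain rfl := Option.some.inj h
      exact h'
    · exact fun h => ⟨_, encode_of_mem _ _ hk, ha, h⟩
  · constructor
    · rintro ⟨y, h, hx', h'⟩
      rw [hE, encode_of_mem _ _ hk] at h
      obtain rfl := Option.some.inj h
      exact h'
    · exact fun h => ⟨_, encode_of_mem _ _ hk, hx, h⟩

/-! ### Levels of atoms and of formulas -/

/-- A labelling that depends only on the marks and on the place in the component can ignore the
letters, so a single step from a constant labelling suffices. -/
theorem Level.of_position {m : Mode} (F : (ℕ → Option (Unit × Mark)) → Set ℕ) (hF : RegularFn F)
    {ℓ : Labelling K A Prop}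
    (h : ∀ n (w : K.Pos n → A × D) dom pos, Enumerates m w dom pos → ∀ k ∈ dom,
      k ∈ F (encode (fun i => ((), (markedLabel w i).2)) dom pos) ↔ ℓ n w (pos k)) (k : ℕ) :
    Level K A (k + 1) m Prop ℓ :=
  Level.of_le (Nat.succ_le_succ (Nat.zero_le k)) ⟨Unit, inferInstance, fun _ _ _ => (),
    ⟨fun _ => (), fun _ _ _ => rfl⟩, F, hF, fun n w dom pos he k hk => propext (h n w dom pos he k hk)⟩

theorem level_letter (a : A) (k : ℕ) (m : Mode) :
    Level K A k m Prop fun _ w i => i ∈ (Atom.letter a).sem w :=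
  Level.of_le (Nat.zero_le k) ⟨fun b => b = a, fun _ _ _ => rfl⟩

theorem level_S (k : ℕ) (m : Mode) : Level K A (k + 1) m Prop fun _ w i => i ∈ Atom.S.sem w :=
  Level.of_position _ (RegularFn.letterwise fun o => ∃ x, o = some x ∧ x.2.2 = true)
    (fun n w dom pos _ k hk => by
      change (∃ x, encode _ dom pos k = some x ∧ _) ↔ _
      simp [encode_of_mem _ _ hk, markedLabel, Atom.sem]) k

theorem level_P (k : ℕ) (m : Mode) : Level K A (k + 1) m Prop fun _ w i => i ∈ Atom.P.sem w :=
  Level.of_position _ (RegularFn.letterwise fun o => ∃ x, o = some x ∧ x.2.1 = true)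
    (fun n w dom pos _ k hk => by
      change (∃ x, encode _ dom pos k = some x ∧ _) ↔ _
      simp [encode_of_mem _ _ hk, markedLabel, Atom.sem]) k

theorem level_first (k : ℕ) (m : Mode) :
    Level K A (k + 1) m Prop fun _ w i => i ∈ (m.first A).sem w :=
  Level.of_position _ ((RegularFn.prev fun _ => True).map Not)
    (fun n w dom pos he k hk => by
      refine Iff.trans ?_ (he.first_iff hk).symm
      change (¬ ∃ j, k = j + 1 ∧ True) ↔ _
      cases k <;> simp) k

/-- The last position of a finite component is the one followed by a blank. -/
theorem level_last (k : ℕ) (m : Mode) :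
    Level K A (k + 1) m Prop fun _ w i => i ∈ (m.last A).sem w :=
  Level.of_position _ (RegularFn.next fun o => o = none)
    (fun n w dom pos he k hk => by
      refine Iff.trans ?_ (he.last_iff hk).symm
      change encode _ dom pos (k + 1) = none ↔ _
      by_cases h : k + 1 ∈ dom
      · simp [encode_of_mem _ _ h, h]
      · simp [encode_of_notMem _ _ h, h]) k

/-- The formulas of mode `m` in a basis: those whose modalities and atoms are allowed. -/
def Mode.Formulas (A : Type) (m : Mode) : Set (Formula A) := {φ | φ.modalities ⊆ m.modalities}

/-- The formulas of mode `m` that do not use the end markers of the other mode. -/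
def Mode.StrictFormulas (A : Type) (m : Mode) : Set (Formula A) :=
  {φ | φ.modalities ⊆ m.modalities ∧ m.other.first A ∉ φ.atoms ∧ m.other.last A ∉ φ.atoms}

theorem mem_modeBasis_iff {ψ : Formula A} : ψ ∈ modeBasis A ↔ ∃ m : Mode, ψ ∈ m.Formulas A := by
  constructor
  · rintro (h | h)
    exacts [⟨.glob, h⟩, ⟨.cls, h⟩]
  · rintro ⟨_ | _, h⟩
    exacts [.inl h, .inr h]

theorem mem_strictModeBasis_iff {ψ : Formula A} :
    ψ ∈ strictModeBasis A ↔ ∃ m : Mode, ψ ∈ m.StrictFormulas A := by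
  constructor
  · rintro (h | h)
    exacts [⟨.glob, h⟩, ⟨.cls, h⟩]
  · rintro ⟨_ | _, h⟩
    exacts [.inl h, .inr h]

theorem level_atom_strict (k : ℕ) {m : Mode} {a : Atom A} (h1 : a ≠ m.other.first A)
    (h2 : a ≠ m.other.last A) : Level K A (k + 1) m Prop fun _ w i => i ∈ a.sem w := by
  cases a with
  | letter a => exact level_letter a _ m
  | S => exact level_S k m
  | P => exact level_P k m
  | firstC => cases m; exacts [absurd rfl h1, level_first k .cls]
  | firstG => cases m; exacts [level_first k .glob, absurd rfl h1]
  | lastC => cases m; exacts [absurd rfl h2, level_last k .cls]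
  | lastG => cases m; exacts [level_last k .glob, absurd rfl h2]

/-- An end marker of the other mode is computed by a stage of that mode, followed by a stage of mode
`m`. This accounts for the extra stage in the bound for the non-strict height. -/
theorem level_atom (k : ℕ) (m : Mode) (a : Atom A) :
    Level K A (k + 2) m Prop fun _ w i => i ∈ a.sem w := by
  by_cases h1 : a = m.other.first A
  · subst h1; exact (level_first k m.other).succ_of_mode m
  by_cases h2 : a = m.other.last A
  · subst h2; exact (level_last k m.other).succ_of_mode m
  exact level_atom_strict (k + 1) h1 h2

/-- The number `d` counts the preliminary stages needed by the atoms: none for the strict basis, one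
for the full basis. The substituted sentences may have different modes; one more level makes all of
them available in the mode of the outermost formula. -/
theorem exists_level_of_mem_Comp {Ψ : Set (Formula A)} {d : ℕ}
    (hΨ : ∀ ψ ∈ Ψ, ∃ m : Mode, ψ.modalities ⊆ m.modalities ∧ ∀ a ∈ ψ.atoms, ∀ k,
      Level K A (k + 1 + d) m Prop fun _ w i => i ∈ a.sem w) {k : ℕ} {φ : Formula A}
    (h : φ ∈ Comp Ψ k) : ∃ m, Level K A (k + d) m Prop fun _ w i => φ.Holds w i := by
  induction k generalizing φ with
  | zero => exact h.elim
  | succ k ih =>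
    obtain ⟨ψ, hψ, σ, hσ, rfl⟩ := h
    obtain ⟨m, hm, ha⟩ := hΨ ψ hψ
    refine ⟨m, ?_⟩
    rw [Nat.add_right_comm]
    have := Level.formula (K := K) (k := k + d) ψ hm (fun a h => by
      rw [Nat.add_right_comm]; exact ha a h k)
      (fun x _ w i => (σ x).Holds w i) fun x hx => by
        obtain ⟨m', h⟩ := ih (hσ x hx)
        exact h.succ_of_mode m
    convert this using 4 with n w i
    unfold Formula.Holds
    rw [Formula.sem_subst w ψ σ fun x hx => freeVars_of_mem_Comp (hσ x hx)]
    rfl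

theorem exists_level_of_mem_Comp_strict {k : ℕ} {φ : Formula A}
    (h : φ ∈ Comp (strictModeBasis A) k) :
    ∃ m, Level K A k m Prop fun _ w i => φ.Holds w i :=
  exists_level_of_mem_Comp (d := 0) (fun ψ hψ => by
    obtain ⟨m, h1, h2, h3⟩ := mem_strictModeBasis_iff.mp hψ
    exact ⟨m, h1, fun a ha k => level_atom_strict k (fun e => h2 (e ▸ ha)) fun e => h3 (e ▸ ha)⟩) h

theorem exists_level_of_mem_Comp_mode {k : ℕ} {φ : Formula A} (h : φ ∈ Comp (modeBasis A) k) :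
    ∃ m, Level K A (k + 1) m Prop fun _ w i => φ.Holds w i :=
  exists_level_of_mem_Comp (fun ψ hψ => by
    obtain ⟨m, h1⟩ := mem_modeBasis_iff.mp hψ
    exact ⟨m, h1, fun a _ k => level_atom k m a⟩) h

/-! ### From formulas to cascades -/

theorem Level.exists_cascade_computes (hK : K.RealizesRegularFn) {k : ℕ} {m : Mode}
    {φ : Formula A} (h : Level K A (k + 1) m Prop fun _ w i => φ.Holds w i) :
    ∃ C : Cascade K.Trans A Bool, C.height = k + 1 ∧ ∀ n (w : K.Pos n → A × D) w',
      C.Runs w w' ↔ ∀ i, (w' i).2 = (w i).2 ∧ ((w' i).1 = true ↔ φ.Holds w i) := by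
  classical
  obtain ⟨C, h1, h2⟩ := (h.absorb (RegularIn.of_letter m _ (fun o => decide (o.elim False Prod.fst))
    (fun _ w i => decide (φ.Holds w i)) fun n w i => rfl)).exists_cascade hK Set.univ
  refine ⟨C, h1, fun n w w' => (h2 n w w').trans ?_⟩
  simp only [Set.mem_univ, implies_true, and_true, eq_relabel_iff]
  exact forall_congr' fun i => and_congr_right fun _ => by
    rw [Bool.eq_iff_iff, decide_eq_true_iff]

/-- The truth of `φ` and the marker of the first global position are computed together, and the last
transducer rejects every letter that has the marker (entry `true`) but not `φ` (entry `false`). Thus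
acceptance constrains the first position only. -/
theorem exists_cascade_language (hK : K.RealizesRegularFn) {k : ℕ} {φ : Formula A}
    (h : φ ∈ Comp (modeBasis A) k) :
    ∃ (B : Type) (C : Cascade K.Trans A B), C.height = k + 1 ∧ ∀ n (w : K.Pos n → A × D),
      (∃ w', C.Runs w w') ↔ φ.Holds w (K.start n) := by
  obtain ⟨k, rfl⟩ : ∃ l, k = l + 1 := by
    cases k with
    | zero => exact h.elim
    | succ k => exact ⟨k, rfl⟩
  obtain ⟨m, hm⟩ := exists_level_of_mem_Comp_mode (K := K) h
  have h1 := Level.pi (K := K) (A := A) (B := fun _ => Prop)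
    (ℓ := fun b : Bool => b.rec (fun _ w i => φ.Holds w i) fun _ w i => i ∈ Atom.firstG.sem w)
    (fun b => by cases b; exacts [hm, level_atom k m _])
  obtain ⟨C, hC, hC'⟩ := h1.exists_cascade hK {x | x true → x false}
  refine ⟨_, C, hC, fun n w => ?_⟩
  simp only [hC', exists_eq_left, Set.mem_ofPred_eq]
  constructor
  · exact fun h => h (K.start n) (K.start_le n)
  · intro h i hi
    rwa [le_antisymm (hi (K.start n)) (K.start_le n i)]

end Level

/-! ### Transducers for regular functions -/

section Pad

variable {Γ B : Type}

/-- A finite word, continued by blanks. -/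
def pad {n : ℕ} (u : Fin n → Γ) : ℕ → Option Γ := fun k => if h : k < n then some (u ⟨k, h⟩) else none

theorem pad_of_lt {n : ℕ} (u : Fin n → Γ) {k : ℕ} (h : k < n) : pad u k = some (u ⟨k, h⟩) := dif_pos h

theorem pad_of_le {n : ℕ} (u : Fin n → Γ) {k : ℕ} (h : n ≤ k) : pad u k = none :=
  dif_neg (not_lt.mpr h)

theorem encode_eq_pad {P : Type v} {n : ℕ} (f : P → Γ) {pos : ℕ → P} {e : Fin n → P}
    (h : ∀ k : Fin n, pos k = e k) : encode f {k | k < n} pos = pad fun k => f (e k) := by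
  funext k
  by_cases hk : k < n
  · rw [encode_of_mem f pos (show k ∈ {k | k < n} from hk), pad_of_lt _ hk, ← h ⟨k, hk⟩]
  · rw [encode_of_notMem f pos (show k ∉ {k | k < n} from hk), pad_of_le _ (not_lt.mp hk)]

theorem encode_univ {P : Type v} (f : P → Γ) (pos : ℕ → P) :
    encode f Set.univ pos = fun k => some (f (pos k)) :=
  funext fun k => encode_of_mem f pos (Set.mem_univ k)

/-- An automaton that reads an infinite input and output, as a transducer. -/
def BuchiAutomaton.omegaTransducer (M : BuchiAutomaton (Option Γ × B)) : Transducer Γ B :=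
  ⟨M.State, M.finite_state, M.init, fun p a b q => M.step p (some a, b) q, M.accept⟩

/-- An automaton that reads a padded input and an infinite output, as a transducer. -/
def BuchiAutomaton.finTransducer (M : BuchiAutomaton (Option Γ × B)) : Transducer Γ B :=
  ⟨M.State, M.finite_state, M.init, fun p a b q => M.step p (some a, b) q,
    {q | ∃ (s : ℕ → B) (r : ℕ → M.State), r 0 = q ∧ (∀ i, M.step (r i) (none, s i) (r (i + 1))) ∧
      ∃ᶠ i in Filter.atTop, r i ∈ M.accept}⟩

/-- A state is accepting for the finite transducer exactly if the automaton can accept from it while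
reading blanks only. The letters written on the blanks are arbitrary and are quantified away. -/
theorem BuchiAutomaton.finTransducer_outputs (M : BuchiAutomaton (Option Γ × B)) {n : ℕ}
    (u : Fin n → Γ) (v : Fin n → B) : M.finTransducer.Outputs u v ↔
      ∃ s : ℕ → B, (∀ k : Fin n, s k = v k) ∧ (fun k => (pad u k, s k)) ∈ M.language := by
  constructor
  · rintro ⟨r, h1, h2, s, r', h3, h4, h5⟩
    let R : ℕ → M.State := fun k => if h : k < n then r ⟨k, by omega⟩ else r' (k - n)
    have hR : ∀ k (h : k ≤ n), R k = r ⟨k, by omega⟩ := by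
      intro k h
      rcases h.lt_or_eq with h' | rfl
      · exact dif_pos h'
      · have : R k = r' (k - k) := dif_neg (lt_irrefl k)
        rw [this, Nat.sub_self, h3]; rfl
    have hR' : ∀ k, R (n + k) = r' k := fun k => by simp [R]
    refine ⟨fun k => if h : k < n then v ⟨k, h⟩ else s (k - n), fun k => by simp, R, ?_,
      fun k => ?_, ?_⟩
    · rw [hR 0 (Nat.zero_le n)]; exact h1
    · rcases Nat.lt_or_ge k n with hk | hk
      · simp only [pad_of_lt _ hk, dif_pos hk, hR k hk.le, hR (k + 1) hk]
        exact h2 ⟨k, hk⟩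
      · obtain ⟨l, rfl⟩ := Nat.exists_eq_add_of_le hk
        simp only [pad_of_le _ hk, dif_neg (not_lt.mpr hk), add_assoc, hR', Nat.add_sub_cancel_left]
        exact h4 l
    · refine Filter.frequently_atTop.mpr fun N => ?_
      obtain ⟨k, hk, hk'⟩ := Filter.frequently_atTop.mp h5 N
      exact ⟨n + k, by omega, (hR' k).symm ▸ hk'⟩
  · rintro ⟨s, h0, r, h1, h2, h3⟩
    refine ⟨fun k => r k, h1, fun k => ?_, fun k => s (n + k), fun k => r (n + k), rfl,
      fun k => ?_, ?_⟩
    · have := h2 k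
      simp only [pad_of_lt _ k.2, h0] at this
      exact this
    · have := h2 (n + k)
      simp only [pad_of_le u (Nat.le_add_right n k)] at this
      exact this
    · refine Filter.frequently_atTop.mpr fun N => ?_
      obtain ⟨k, hk, hk'⟩ := Filter.frequently_atTop.mp h3 (n + N)
      exact ⟨k - n, by omega, by
        change r (n + (k - n)) ∈ _
        rwa [Nat.add_sub_cancel' (by omega)]⟩

/-- The constraint `Q` is imposed on non-blank positions only, because the value of `f` on the
blanks is not part of the output. -/
theorem RegularFn.exists_automaton {f : (ℕ → Option Γ) → ℕ → B} (hf : RegularFn f) (Q : Set B) :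
    ∃ M : BuchiAutomaton (Option Γ × B), ∀ u v, (fun k => (u k, v k)) ∈ M.language ↔
      v = f u ∧ ∀ k, u k ≠ none → v k ∈ Q := by
  obtain ⟨M, hM⟩ := hf.inter
    (OmegaRegular.forall_letter fun x : Option Γ × B => x.1 ≠ none → x.2 ∈ Q)
  exact ⟨M, fun u v => by rw [hM]; rfl⟩

theorem RegularFn.exists_functionalTransducer {f : (ℕ → Option Γ) → ℕ → B} (hf : RegularFn f)
    (Q : Set B) : ∃ L : FunctionalTransducer Γ B, ∀ (n : ℕ) (u : Fin n → Γ) (v : Fin n → B),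
      L.Outputs u v ↔ ∀ k, v k = f (pad u) k ∧ v k ∈ Q := by
  obtain ⟨M, hM⟩ := hf.exists_automaton Q
  have key : ∀ (n : ℕ) (u : Fin n → Γ) (v : Fin n → B),
      M.finTransducer.Outputs u v ↔ ∀ k, v k = f (pad u) k ∧ v k ∈ Q := by
    intro n u v
    simp only [M.finTransducer_outputs, hM]
    constructor
    · rintro ⟨s, h1, rfl, h2⟩ k
      rw [← h1]
      exact ⟨rfl, h2 k (by simp [pad_of_lt])⟩
    · intro h
      refine ⟨f (pad u), fun k => (h k).1.symm, rfl, fun k hk => ?_⟩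
      rcases Nat.lt_or_ge k n with h' | h'
      · exact (h ⟨k, h'⟩).1 ▸ (h ⟨k, h'⟩).2
      · exact absurd (pad_of_le u h') hk
  exact ⟨⟨M.finTransducer, fun n u v v' h h' => funext fun k =>
    (((key n u v).mp h) k).1.trans (((key n u v').mp h') k).1.symm⟩, key⟩

theorem RegularFn.exists_functionalBuchiTransducer {f : (ℕ → Option Γ) → ℕ → B}
    (hf : RegularFn f) (Q : Set B) : ∃ L : FunctionalBuchiTransducer Γ B, ∀ u v,
      L.OmegaOutputs u v ↔ ∀ k, v k = f (fun k => some (u k)) k ∧ v k ∈ Q := by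
  obtain ⟨M, hM⟩ := hf.exists_automaton Q
  have key : ∀ u v, M.omegaTransducer.OmegaOutputs u v ↔
      ∀ k, v k = f (fun k => some (u k)) k ∧ v k ∈ Q := by
    intro u v
    refine (hM (fun k => some (u k)) v).trans ?_
    simp [funext_iff, forall_and]
  exact ⟨⟨M.omegaTransducer, fun u v v' h h' => funext fun k =>
    (((key u v).mp h) k).1.trans (((key u v').mp h') k).1.symm⟩, key⟩

end Pad

/-! ### Transducers on the components of a word -/

section Classes

variable {P : Type v} [LinearOrder P] {A B : Type}

theorem exists_fin_orderIso (s : Set P) [Finite s] : ∃ n, Nonempty (Fin n ≃o s) := by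
  have := Fintype.ofFinite s
  exact ⟨_, ⟨Fintype.orderIsoFinOfCardEq s rfl⟩⟩

/-- The regular function determines the word that a successful run must write on each class, so the
conditions for all finite classes together amount to one condition per position. -/
theorem outputsOnFiniteClasses_iff [Nonempty P] {L : FunctionalTransducer (A × Mark) B}
    {f : (ℕ → Option (A × Mark)) → ℕ → B} {Q : Set B}
    (hL : ∀ (n : ℕ) (u : Fin n → A × Mark) (v : Fin n → B),
      L.Outputs u v ↔ ∀ k, v k = f (pad u) k ∧ v k ∈ Q) {w : P → A × D} {ℓ : P → B}
    (hℓ : ∀ dom pos, Enumerates .cls w dom pos → ∀ k ∈ dom,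
      f (encode (markedLabel w) dom pos) k = ℓ (pos k)) (w' : P → B × D) :
    OutputsOnFiniteClasses L w w' ↔
      ∀ i, Finite (ClassOf w (w i).2) → (w' i).1 = ℓ i ∧ ℓ i ∈ Q := by
  have key : ∀ (d : D) (m : ℕ) (e : Fin m ≃o ClassOf w d) (k : Fin m),
      f (pad fun k => markedLabel w (e k).1) k = ℓ (e k).1 := by
    intro d m e k
    obtain ⟨pos, h1, h2⟩ := Enumerates.of_fin (m := .cls) (w := w) (s := {i | (w i).2 = d}) ⟨d, rfl⟩ e
    have := hℓ _ _ h1 k k.2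
    rwa [encode_eq_pad (markedLabel w) h2, h2] at this
  constructor
  · intro h i hi
    have : Finite {j | (w j).2 = (w i).2} := hi
    obtain ⟨m, ⟨e⟩⟩ := exists_fin_orderIso {j | (w j).2 = (w i).2}
    have := (hL _ _ _).mp (h (w i).2 ⟨i, rfl⟩ m e) (e.symm ⟨i, rfl⟩)
    rw [key] at this
    simp only [OrderIso.apply_symm_apply] at this
    exact ⟨this.1, this.1 ▸ this.2⟩
  · rintro h d - m e
    refine (hL _ _ _).mpr fun k => ?_
    obtain ⟨h1, h2⟩ := h (e k).1 (by
      rw [(e k).2]; exact Finite.of_equiv _ e.toEquiv)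
    rw [key, h1]
    exact ⟨rfl, h2⟩

theorem outputsOnInfiniteClasses_iff {L : FunctionalBuchiTransducer (A × Mark) B}
    {f : (ℕ → Option (A × Mark)) → ℕ → B} {Q : Set B}
    (hL : ∀ u v, L.OmegaOutputs u v ↔ ∀ k, v k = f (fun k => some (u k)) k ∧ v k ∈ Q)
    {w : P → A × D} {ℓ : P → B}
    (hℓ : ∀ dom pos, Enumerates .cls w dom pos → ∀ k ∈ dom,
      f (encode (markedLabel w) dom pos) k = ℓ (pos k)) (w' : P → B × D) :
    OutputsOnInfiniteClasses L w w' ↔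
      ∀ i, Nonempty (ℕ ≃o ClassOf w (w i).2) → (w' i).1 = ℓ i ∧ ℓ i ∈ Q := by
  have key : ∀ (d : D) (e : ℕ ≃o ClassOf w d) (k : ℕ),
      f (fun k => some (markedLabel w (e k).1)) k = ℓ (e k).1 := by
    intro d e k
    have h1 := Enumerates.of_nat (m := .cls) (w := w) (s := {i | (w i).2 = d}) ⟨d, rfl⟩ e
    have := hℓ _ _ h1 k trivial
    rwa [encode_univ] at this
  constructor
  · rintro h i ⟨e⟩
    have := (hL _ _).mp (h (w i).2 ⟨i, rfl⟩ e) (e.symm ⟨i, rfl⟩)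
    rw [key] at this
    simp only [OrderIso.apply_symm_apply] at this
    exact ⟨this.1, this.1 ▸ this.2⟩
  · rintro h d - e
    refine (hL _ _).mpr fun k => ?_
    obtain ⟨h1, h2⟩ := h (e k).1 (by rw [(e k).2]; exact ⟨e⟩)
    rw [key, h1]
    exact ⟨rfl, h2⟩

end Classes

/-! ### The two kinds of words -/

/-- Finite data words. -/
@[reducible] def finiteKind (D : Type u) : WordKind D where
  Index := ℕ
  Pos n := Fin (n + 1)
  order _ := inferInstance
  start _ := 0
  start_le _ := Fin.zero_le
  Trans := DataTransducer
  Run t _ w w' := t.Outputs w w'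

/-- Data `ω`-words. -/
@[reducible] def omegaKind (D : Type u) : WordKind D where
  Index := Unit
  Pos _ := ℕ
  order _ := inferInstance
  start _ := (0 : ℕ)
  start_le _ := Nat.zero_le
  Trans := DataOmegaTransducer
  Run t _ w w' := t.Outputs w w'

theorem finiteKind_realizes : (finiteKind D).RealizesRegularFn := by
  intro m A B f hf Q
  obtain ⟨L, hL⟩ := hf.exists_functionalTransducer Q
  cases m with
  | glob =>
    refine ⟨.glob L, fun n w ℓ hℓ w' => ?_⟩
    obtain ⟨pos, h1, h2⟩ := Enumerates.of_fin (m := .glob) (w := w) rfl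
      (OrderIso.Set.univ (α := Fin (n + 1))).symm
    rw [eq_relabel_iff, forall_and, and_assoc]
    refine and_congr_right fun _ => (hL _ _ _).trans ?_
    rw [← forall_and]
    refine forall_congr' fun k => ?_
    have := hℓ _ _ h1 k k.2
    rw [encode_eq_pad (markedLabel w) h2, h2] at this
    rw [show f (pad (markedLabel w)) k = ℓ k from this]
    exact and_congr_right fun h => by rw [h]
  | cls =>
    refine ⟨.cls L, fun n w ℓ hℓ w' => ?_⟩
    rw [eq_relabel_iff, forall_and, and_assoc]
    refine and_congr_right fun _ => (outputsOnFiniteClasses_iff hL hℓ w').trans ?_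
    rw [← forall_and]
    exact forall_congr' fun i => ⟨fun h => h inferInstance, fun h _ => h⟩

theorem omegaKind_realizes : (omegaKind D).RealizesRegularFn := by
  intro m A B f hf Q
  obtain ⟨L, hL⟩ := hf.exists_functionalTransducer Q
  obtain ⟨Lω, hLω⟩ := hf.exists_functionalBuchiTransducer Q
  cases m with
  | glob =>
    refine ⟨.glob Lω, fun n w ℓ hℓ w' => ?_⟩
    have h1 := Enumerates.of_nat (m := .glob) (w := w) rfl (OrderIso.Set.univ (α := ℕ)).symm
    rw [eq_relabel_iff, forall_and, and_assoc]
    refine and_congr_right fun _ => (hLω _ _).trans ?_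
    rw [← forall_and]
    refine forall_congr' fun k => ?_
    have := hℓ _ _ h1 k trivial
    rw [encode_univ] at this
    rw [show f (fun k => some (markedLabel w k)) k = ℓ k from this]
    exact and_congr_right fun h => by rw [h]
  | cls =>
    refine ⟨.cls L Lω, fun n w ℓ hℓ w' => ?_⟩
    rw [eq_relabel_iff, forall_and, and_assoc]
    refine and_congr_right fun _ => ((outputsOnFiniteClasses_iff hL hℓ w').and
      (outputsOnInfiniteClasses_iff hLω hℓ w')).trans ?_
    rw [← forall_and, ← forall_and]
    refine forall_congr' fun i => ⟨fun h => ?_, fun h => ⟨fun _ => h, fun _ => h⟩⟩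
    -- Every class of a data ω-word is either finite or ordered like `ℕ`, so each position is
    -- covered by exactly one of the two transducers.
    rcases finite_or_infinite (ClassOf w (w i).2) with hfin | hinf
    · exact h.1 hfin
    · classical
      have : Infinite {j : ℕ | (w j).2 = (w i).2} := hinf
      exact h.2 ⟨Nat.Subtype.orderIsoOfNat {j | (w j).2 = (w i).2}⟩

/-! ### Building formulas -/

namespace Formula

variable {A : Type}

/-- A formula that holds nowhere. -/
def falsum : Formula A := .and (.atom .S) (.natom .S)

/-- The disjunction of a list of formulas. -/
def disjList : List (Formula A) → Formula A
  | [] => falsum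
  | φ :: l => .or φ (disjList l)

/-- The disjunction of a finite family of formulas. -/
noncomputable def disj {ι : Type} [Finite ι] (f : ι → Formula A) : Formula A :=
  disjList ((Set.finite_univ (α := ι)).toFinset.toList.map f)

open Classical in
/-- The formula `φ` if `p` is true, and a formula that holds nowhere otherwise. -/
noncomputable def guard (p : Prop) (φ : Formula A) : Formula A := if p then φ else falsum

section LinSem

variable {dom : Set ℕ} {α : Atom A → Set ℕ} {v : ℕ → Set ℕ} {k : ℕ}

theorem notMem_linSem_falsum : k ∉ (falsum : Formula A).linSem dom α v := fun h => h.2 h.1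

theorem mem_linSem_disj {ι : Type} [Finite ι] {f : ι → Formula A} :
    k ∈ (disj f).linSem dom α v ↔ ∃ j, k ∈ (f j).linSem dom α v := by
  have : ∀ l : List (Formula A), k ∈ (disjList l).linSem dom α v ↔
      ∃ φ ∈ l, k ∈ φ.linSem dom α v := by
    intro l
    induction l with
    | nil => simpa [disjList] using notMem_linSem_falsum
    | cons φ l ih =>
      rw [List.exists_mem_cons_iff, ← ih]
      rfl
  simp [disj, this]

theorem mem_linSem_guard {p : Prop} {φ : Formula A} :
    k ∈ (guard p φ).linSem dom α v ↔ p ∧ k ∈ φ.linSem dom α v := by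
  unfold guard
  split_ifs with h
  · simp [h]
  · simpa [h] using notMem_linSem_falsum

theorem linSem_congr (ψ : Formula A) {v v' : ℕ → Set ℕ} (h : ∀ x ∈ ψ.freeVars, v x = v' x) :
    ψ.linSem dom α v = ψ.linSem dom α v' := by
  induction ψ generalizing v v' with
  | var x => exact h x rfl
  | atom a => rfl
  | natom a => rfl
  | modal M φ ih => simp only [Formula.linSem, ih h]
  | or φ ψ ih1 ih2 | and φ ψ ih1 ih2 =>
    simp only [Formula.linSem, ih1 fun x hx => h x (.inl hx), ih2 fun x hx => h x (.inr hx)]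
  | mu x φ ih | nu x φ ih =>
    have : ∀ S, φ.linSem dom α (Function.update v x S) =
        φ.linSem dom α (Function.update v' x S) := by
      intro S
      refine ih fun y hy => ?_
      by_cases e : y = x
      · subst e; simp
      · simpa [e] using h y ⟨hy, e⟩
    simp only [Formula.linSem, this]

end LinSem

/-- Membership in the strict formulas of mode `m`, with free variables in `s`. -/
structure Allowed (m : Mode) (s : Set ℕ) (φ : Formula A) : Prop where
  strict : φ ∈ m.StrictFormulas A
  vars : φ.freeVars ⊆ s

namespace Allowed

variable {m : Mode} {s : Set ℕ} {φ ψ : Formula A}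

theorem var {x : ℕ} (h : x ∈ s) : Allowed m s (.var x : Formula A) :=
  ⟨⟨Set.empty_subset _, Set.notMem_empty _, Set.notMem_empty _⟩, Set.singleton_subset_iff.mpr h⟩

theorem atom {a : Atom A} (h : a ≠ m.other.first A) (h' : a ≠ m.other.last A) :
    Allowed m s (.atom a) := ⟨⟨Set.empty_subset _, h.symm, h'.symm⟩, Set.empty_subset _⟩

theorem natom {a : Atom A} (h : a ≠ m.other.first A) (h' : a ≠ m.other.last A) :
    Allowed m s (.natom a) := ⟨⟨Set.empty_subset _, h.symm, h'.symm⟩, Set.empty_subset _⟩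

theorem or (h : Allowed m s φ) (h' : Allowed m s ψ) : Allowed m s (.or φ ψ) :=
  ⟨⟨Set.union_subset h.1.1 h'.1.1, fun h1 => h1.elim h.1.2.1 h'.1.2.1,
    fun h1 => h1.elim h.1.2.2 h'.1.2.2⟩, Set.union_subset h.2 h'.2⟩

theorem and (h : Allowed m s φ) (h' : Allowed m s ψ) : Allowed m s (.and φ ψ) :=
  ⟨⟨Set.union_subset h.1.1 h'.1.1, fun h1 => h1.elim h.1.2.1 h'.1.2.1,
    fun h1 => h1.elim h.1.2.2 h'.1.2.2⟩, Set.union_subset h.2 h'.2⟩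

theorem modal {M : Modality} (hM : M ∈ m.modalities) (h : Allowed m s φ) :
    Allowed m s (.modal M φ) := ⟨⟨Set.insert_subset hM h.1.1, h.1.2⟩, h.2⟩

theorem mu {x : ℕ} (h : Allowed m (insert x s) φ) : Allowed m s (.mu x φ) :=
  ⟨h.1, fun _ hy => (h.2 hy.1).resolve_left hy.2⟩

theorem nu {x : ℕ} (h : Allowed m (insert x s) φ) : Allowed m s (.nu x φ) :=
  ⟨h.1, fun _ hy => (h.2 hy.1).resolve_left hy.2⟩

theorem mono {t : Set ℕ} (h : Allowed m s φ) (hst : s ⊆ t) : Allowed m t φ := ⟨h.1, h.2.trans hst⟩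

theorem S : Allowed m s (.atom .S : Formula A) := by apply atom <;> cases m <;> nofun

theorem P : Allowed m s (.atom .P : Formula A) := by apply atom <;> cases m <;> nofun

theorem not_S : Allowed m s (.natom .S : Formula A) := by apply natom <;> cases m <;> nofun

theorem not_P : Allowed m s (.natom .P : Formula A) := by apply natom <;> cases m <;> nofun

theorem letter {a : A} : Allowed m s (.atom (.letter a)) := by apply atom <;> cases m <;> nofun

theorem first : Allowed m s (.atom (m.first A)) := by apply atom <;> cases m <;> nofun

theorem last : Allowed m s (.atom (m.last A)) := by apply atom <;> cases m <;> nofun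

theorem falsum : Allowed m s (Formula.falsum : Formula A) := S.and not_S

theorem disj {ι : Type} [Finite ι] {f : ι → Formula A} (h : ∀ j, Allowed m s (f j)) :
    Allowed m s (Formula.disj f) := by
  have : ∀ l : List (Formula A), (∀ φ ∈ l, Allowed m s φ) → Allowed m s (disjList l) := by
    intro l
    induction l with
    | nil => exact fun _ => falsum
    | cons φ l ih =>
      exact fun h => (h φ (List.mem_cons_self ..)).or (ih fun ψ hψ => h ψ (List.mem_cons_of_mem _ hψ))
  exact this _ fun φ hφ => by
    obtain ⟨j, -, rfl⟩ := List.mem_map.mp hφ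
    exact h j

theorem guard {p : Prop} (h : Allowed m s φ) : Allowed m s (Formula.guard p φ) := by
  unfold Formula.guard
  split_ifs
  exacts [h, falsum]

end Allowed
end Formula

/-! ### Paths with restricted intermediate points -/

/-- There is a non-empty `G`-path whose intermediate points are in `L`. -/
inductive PathVia {X : Type} (G : X → X → Prop) (L : Set X) : X → X → Prop
  | single {x y : X} : G x y → PathVia G L x y
  | cons {x z y : X} : G x z → z ∈ L → PathVia G L z y → PathVia G L x y

namespace PathVia

open Relation

theorem mono {X : Type} {G : X → X → Prop} {L L' : Set X} (hL : L ⊆ L') {x y : X}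
    (h : PathVia G L x y) : PathVia G L' x y := by
  induction h with
  | single h => exact .single h
  | cons h hz _ ih => exact .cons h (hL hz) ih

theorem trans {X : Type} {G : X → X → Prop} {L : Set X} {x z y : X} (h : PathVia G L x z)
    (hz : z ∈ L) (h' : PathVia G L z y) : PathVia G L x y := by
  induction h with
  | single h => exact .cons h hz h'
  | cons h hz' _ ih => exact .cons h hz' (ih hz h')

theorem univ_iff {X : Type} {G : X → X → Prop} {x y : X} :
    PathVia G Set.univ x y ↔ TransGen G x y := by
  constructor
  · intro h
    induction h with
    | single h => exact .single h
    | cons h _ _ ih => exact .head h ih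
  · intro h
    induction h using TransGen.head_induction_on with
    | single h => exact .single h
    | head h _ ih => exact .cons h trivial ih

/-- Kleene's decomposition of paths at the visits of the state `s`. -/
theorem insert_iff {S : Type} {G : S × ℕ → S × ℕ → Prop} {s : S} {l : List S} {x y : S × ℕ} :
    PathVia G {z | z.1 = s ∨ z.1 ∈ l} x y ↔ PathVia G {z | z.1 ∈ l} x y ∨
      ∃ k, PathVia G {z | z.1 ∈ l} x (s, k) ∧
        ∃ k', ReflTransGen (fun i j => PathVia G {z | z.1 ∈ l} (s, i) (s, j)) k k' ∧
          PathVia G {z | z.1 ∈ l} (s, k') y := by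
  constructor
  · intro h
    induction h with
    | single h => exact .inl (.single h)
    | @cons x z y h hz _ ih =>
      rcases hz with hz | hz
      · obtain ⟨z, k⟩ := z
        obtain rfl : z = s := hz
        rcases ih with ih | ⟨k₁, h1, k₂, h2, h3⟩
        · exact .inr ⟨k, .single h, k, .refl, ih⟩
        · exact .inr ⟨k, .single h, k₂, .head h1 h2, h3⟩
      · rcases ih with ih | ⟨k₁, h1, k₂, h2, h3⟩
        · exact .inl (.cons h hz ih)
        · exact .inr ⟨k₁, .cons h hz h1, k₂, h2, h3⟩
  · have hsub : {z : S × ℕ | z.1 ∈ l} ⊆ {z | z.1 = s ∨ z.1 ∈ l} := fun _ h => .inr h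
    rintro (h | ⟨k, h1, k', h2, h3⟩)
    · exact h.mono hsub
    · refine (h1.mono hsub).trans (.inl rfl) ?_
      clear h1
      induction h2 using ReflTransGen.head_induction_on with
      | refl => exact h3.mono hsub
      | head h _ ih => exact (h.mono hsub).trans (.inl rfl) ih

end PathVia

/-- Reachability of `Q` as the least fixpoint of `T ↦ Q ∪ R⁻¹(T)`. It serves for the iterated
returns to one state in Kleene's construction. -/
theorem sInter_closure_eq (R : ℕ → ℕ → Prop) (Q : Set ℕ) :
    ⋂₀ {T : Set ℕ | Q ∪ {k | ∃ k', R k k' ∧ k' ∈ T} ⊆ T} =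
      {k | ∃ k', Relation.ReflTransGen R k k' ∧ k' ∈ Q} := by
  apply Set.Subset.antisymm
  · refine Set.sInter_subset_of_mem ?_
    rintro k (h | ⟨k', h, k'', h', h''⟩)
    · exact ⟨k, .refl, h⟩
    · exact ⟨k'', .head h h', h''⟩
  · rintro k ⟨k', h, h'⟩ T hT
    induction h using Relation.ReflTransGen.head_induction_on with
    | refl => exact hT (.inl h')
    | head h _ ih => exact hT (.inr ⟨_, h, ih⟩)

/-! ### Path formulas -/

section PathFormula

variable {A S : Type}

/-- From formula transformers `E p q` for single steps, the formula for the paths from `p` to `q`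
with intermediate states in a list. The variables `N, N + 1, …` are used for fixpoints. -/
def pathFormula (E : S → S → Formula A → Formula A) (N : ℕ) :
    List S → S → S → Formula A → Formula A
  | [], p, q, φ => E p q φ
  | s :: l, p, q, φ => .or (pathFormula E N l p q φ) (pathFormula E N l p s
      (.mu (N + l.length) (.or (pathFormula E N l s q φ)
        (pathFormula E N l s s (.var (N + l.length))))))

/-- `E p q` expresses the step relation `G` between `p` and `q`. -/
structure Expresses (dom : Set ℕ) (α : Atom A → Set ℕ) (v : ℕ → Set ℕ) (m : Mode) (N : ℕ)
    (E : S → S → Formula A → Formula A) (G : S × ℕ → S × ℕ → Prop) : Prop where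
  allowed : ∀ p q s φ, Set.Iio N ⊆ s → Formula.Allowed m s φ → Formula.Allowed m s (E p q φ)
  sem : ∀ v' : ℕ → Set ℕ, (∀ x < N, v' x = v x) → ∀ p q φ,
    (E p q φ).linSem dom α v' = {k | ∃ k', G (p, k) (q, k') ∧ k' ∈ φ.linSem dom α v'}

variable {dom : Set ℕ} {α : Atom A → Set ℕ} {v : ℕ → Set ℕ} {m : Mode} {N : ℕ}
  {E : S → S → Formula A → Formula A} {G : S × ℕ → S × ℕ → Prop}

namespace Expresses

theorem allowed_pathFormula (h : Expresses dom α v m N E G) (l : List S) {s : Set ℕ}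
    (hs : Set.Iio N ⊆ s) (p q : S) {φ : Formula A} (hφ : Formula.Allowed m s φ) :
    Formula.Allowed m s (pathFormula E N l p q φ) := by
  induction l generalizing s p q φ with
  | nil => exact h.allowed p q s φ hs hφ
  | cons t l ih =>
    have hs' := hs.trans (Set.subset_insert (N + l.length) s)
    exact (ih hs p q hφ).or (ih hs p t (.mu ((ih hs' t q (hφ.mono (Set.subset_insert _ _))).or
      (ih hs' t t (.var (Set.mem_insert _ _))))))

/-- Eliminating a state binds the variable with index `N` plus the number of states still to be
eliminated. The formula `φ` may use such a variable of an outer elimination, but none that is bound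
in the present formula; this is the interval left out in `hφ`. -/
theorem sem_pathFormula (h : Expresses dom α v m N E G) (l : List S) (v' : ℕ → Set ℕ)
    (hv' : ∀ x < N, v' x = v x) (p q : S) {φ : Formula A}
    (hφ : Formula.Allowed m (Set.Iio N ∪ Set.Ici (N + l.length)) φ) :
    (pathFormula E N l p q φ).linSem dom α v' =
      {k | ∃ k', PathVia G {z | z.1 ∈ l} (p, k) (q, k') ∧ k' ∈ φ.linSem dom α v'} := by
  induction l generalizing v' p q φ with
  | nil =>
    rw [pathFormula, h.sem v' hv']
    ext k
    constructor
    · rintro ⟨k', h1, h2⟩; exact ⟨k', .single h1, h2⟩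
    · rintro ⟨k', h1 | ⟨_, h1, _⟩, h2⟩
      · exact ⟨k', h1, h2⟩
      · cases h1
  | cons s l ih =>
    rw [List.length_cons] at hφ
    have hsub : Set.Iio N ∪ Set.Ici (N + (l.length + 1)) ⊆
        Set.Iio N ∪ Set.Ici (N + l.length) :=
      Set.union_subset_union_right _ (Set.Ici_subset_Ici.mpr (by omega))
    have hx : N + l.length ∈ Set.Iio N ∪ Set.Ici (N + l.length) := .inr (Set.mem_Ici.mpr le_rfl)
    -- The fixpoint describes any number of returns to `s` with intermediate states in `l`, followed
    -- by a path from `s` to `q`.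
    have hmu : (Formula.mu (N + l.length) (.or (pathFormula E N l s q φ)
        (pathFormula E N l s s (.var (N + l.length))))).linSem dom α v' =
        {k | ∃ k', Relation.ReflTransGen (fun i j => PathVia G {z | z.1 ∈ l} (s, i) (s, j)) k k' ∧
          k' ∈ {k | ∃ k', PathVia G {z | z.1 ∈ l} (s, k) (q, k') ∧ k' ∈ φ.linSem dom α v'}} := by
      rw [← sInter_closure_eq]
      simp only [Formula.linSem]
      refine congrArg Set.sInter (Set.ext fun T => ?_)
      have hv'' : ∀ x < N, Function.update v' (N + l.length) T x = v x := fun x hx => by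
        rw [Function.update_of_ne (by omega), hv' x hx]
      rw [Set.mem_ofPred_eq, Set.mem_ofPred_eq, ih _ hv'' s q (hφ.mono hsub),
        ih _ hv'' s s (.var hx)]
      have hφ' : φ.linSem dom α (Function.update v' (N + l.length) T) = φ.linSem dom α v' :=
        Formula.linSem_congr φ fun y hy => by
          refine Function.update_of_ne ?_ _ _
          rintro rfl
          rcases hφ.vars hy with h | h
          · exact absurd h (by simp)
          · exact absurd h (by simp)
      rw [hφ']
      simp only [Formula.linSem, Function.update_self]
    have hal : Formula.Allowed m (Set.Iio N ∪ Set.Ici (N + l.length))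
        (Formula.mu (N + l.length) (.or (pathFormula E N l s q φ)
        (pathFormula E N l s s (.var (N + l.length))))) := by
      have hs := (Set.subset_union_left (s := Set.Iio N) (t := Set.Ici (N + l.length))).trans
        (Set.subset_insert (N + l.length) _)
      exact .mu ((h.allowed_pathFormula l hs s q
        (hφ.mono (hsub.trans (Set.subset_insert _ _)))).or
        (h.allowed_pathFormula l hs s s (.var (Set.mem_insert _ _))))
    rw [pathFormula, Formula.linSem, ih v' hv' p q (hφ.mono hsub), ih v' hv' p s hal, hmu]
    ext k
    have hins : {z : S × ℕ | z.1 ∈ s :: l} = {z | z.1 = s ∨ z.1 ∈ l} := by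
      ext z; simp
    simp only [hins, PathVia.insert_iff, Set.mem_union, Set.mem_ofPred_eq]
    constructor
    · rintro (⟨k', h1, h2⟩ | ⟨k1, h1, k2, h2, k3, h3, h4⟩)
      · exact ⟨k', .inl h1, h2⟩
      · exact ⟨k3, .inr ⟨k1, h1, k2, h2, h3⟩, h4⟩
    · rintro ⟨k', h1 | ⟨k1, h1, k2, h2, h3⟩, h4⟩
      · exact .inl ⟨k', h1, h4⟩
      · exact .inr ⟨k1, h1, k2, h2, k', h3, h4⟩

end Expresses

variable [Finite S]

/-- All elements of a finite type. -/
noncomputable def listAll (S : Type) [Finite S] : List S := (Set.finite_univ (α := S)).toFinset.toList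

/-- The formula for the paths from `p` to `q`. -/
noncomputable def transFormula (E : S → S → Formula A → Formula A) (N : ℕ) (p q : S)
    (φ : Formula A) : Formula A := pathFormula E N (listAll S) p q φ

/-- The formula for the possibly empty paths from `p` to some state `q`, where `T q` has to hold. -/
noncomputable def reachFormula (E : S → S → Formula A → Formula A) (N : ℕ) (p : S)
    (T : S → Formula A) : Formula A := .or (T p) (.disj fun q => transFormula E N p q (T q))

namespace Expresses

theorem allowed_transFormula (h : Expresses dom α v m N E G) {s : Set ℕ}
    (hs : Set.Iio N ⊆ s) (p q : S) {φ : Formula A} (hφ : Formula.Allowed m s φ) :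
    Formula.Allowed m s (transFormula E N p q φ) := h.allowed_pathFormula _ hs p q hφ

theorem allowed_reachFormula (h : Expresses dom α v m N E G) (p : S) {T : S → Formula A}
    (hT : ∀ q, Formula.Allowed m (Set.Iio N) (T q)) :
    Formula.Allowed m (Set.Iio N) (reachFormula E N p T) :=
  (hT p).or (.disj fun q => h.allowed_transFormula le_rfl p q (hT q))

theorem sem_transFormula (h : Expresses dom α v m N E G) (v' : ℕ → Set ℕ)
    (hv' : ∀ x < N, v' x = v x) (p q : S) {φ : Formula A}
    (hφ : Formula.Allowed m (Set.Iio N ∪ Set.Ici (N + (listAll S).length)) φ) :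
    (transFormula E N p q φ).linSem dom α v' =
      {k | ∃ k', Relation.TransGen G (p, k) (q, k') ∧ k' ∈ φ.linSem dom α v'} := by
  have : {z : S × ℕ | z.1 ∈ listAll S} = Set.univ := by ext z; simp [listAll]
  rw [transFormula, h.sem_pathFormula _ v' hv' p q hφ]
  simp only [this, PathVia.univ_iff]

theorem mem_linSem_reachFormula (h : Expresses dom α v m N E G) (p : S) {T : S → Formula A}
    (hT : ∀ q, Formula.Allowed m (Set.Iio N) (T q)) {k : ℕ} :
    k ∈ (reachFormula E N p T).linSem dom α v ↔
      ∃ q k', Relation.ReflTransGen G (p, k) (q, k') ∧ k' ∈ (T q).linSem dom α v := by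
  have h1 := fun q => h.sem_transFormula v (fun _ _ => rfl) p q
    ((hT q).mono Set.subset_union_left)
  simp only [reachFormula, Formula.linSem, Set.mem_union, Formula.mem_linSem_disj, h1,
    Relation.reflTransGen_iff_eq_or_transGen, Set.mem_ofPred_eq]
  constructor
  · rintro (h | ⟨q, k', h, h'⟩)
    · exact ⟨p, k, .inl rfl, h⟩
    · exact ⟨q, k', .inr h, h'⟩
  · rintro ⟨q, k', h | h, h'⟩
    · cases h; exact .inl h'
    · exact .inr ⟨q, k', h, h'⟩

end Expresses

end PathFormula

theorem Mode.next_dir (m : Mode) (k k' : ℕ) : m.next.Dir k k' ↔ k' = k + 1 := by cases m <;> rfl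

theorem Mode.prev_dir (m : Mode) (k k' : ℕ) : m.prev.Dir k k' ↔ k = k' + 1 := by cases m <;> rfl

theorem Mode.next_mem (m : Mode) : m.next ∈ m.modalities := Set.mem_insert _ _

theorem Mode.prev_mem (m : Mode) : m.prev ∈ m.modalities := Set.mem_insert_of_mem _ rfl

/-! ### Runs of transducers -/

namespace Transducer

variable {B C : Type} (T : Transducer (B × Mark) C)

/-- There is a transition from `q` to `q'` that reads the letter at position `k`. -/
def Tr (lab : ℕ → B × Mark) (k : ℕ) (q q' : T.State) : Prop := ∃ o, T.step q (lab k) o q'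

/-- There is a run from `q` at position `i` to `q'` at position `j`. -/
def Seg (lab : ℕ → B × Mark) (i j : ℕ) (q q' : T.State) : Prop :=
  ∃ r : ℕ → T.State, r i = q ∧ r j = q' ∧ ∀ l, i ≤ l → l < j → T.Tr lab l (r l) (r (l + 1))

variable {T} {lab : ℕ → B × Mark}

theorem Seg.refl (i : ℕ) (q : T.State) : T.Seg lab i i q q :=
  ⟨fun _ => q, rfl, rfl, fun _ h h' => absurd h' (not_lt.mpr h)⟩

theorem Seg.snoc {i j : ℕ} {q q₁ q' : T.State} (h : T.Seg lab i j q q₁) (hij : i ≤ j)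
    (h' : T.Tr lab j q₁ q') : T.Seg lab i (j + 1) q q' := by
  obtain ⟨r, h1, h2, h3⟩ := h
  refine ⟨Function.update r (j + 1) q', ?_, by simp, fun l hl hl' => ?_⟩
  · rw [Function.update_of_ne (by omega), h1]
  · rw [Function.update_of_ne (by omega)]
    rcases Nat.lt_or_ge l j with h4 | h4
    · rw [Function.update_of_ne (by omega)]; exact h3 l hl h4
    · obtain rfl : l = j := by omega
      rw [Function.update_self, h2]; exact h'

/-- A run on an initial segment and a run on a final segment can be concatenated. -/
theorem Seg.append {i j : ℕ} {q q' : T.State} (h : T.Seg lab i j q q') (hij : i ≤ j)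
    (r' : ℕ → T.State) (hr' : r' j = q') : ∃ r : ℕ → T.State, r i = q ∧ (∀ l, j ≤ l → r l = r' l) ∧
      ∀ l, i ≤ l → l < j → T.Tr lab l (r l) (r (l + 1)) := by
  obtain ⟨r, h1, h2, h3⟩ := h
  refine ⟨fun l => if l < j then r l else r' l, ?_, fun l hl => if_neg (not_lt.mpr hl),
    fun l hl hl' => ?_⟩
  · dsimp only
    split_ifs with h4
    · exact h1
    · obtain rfl : i = j := by omega
      rw [hr', ← h2, h1]
  · dsimp only
    rw [if_pos hl']
    split_ifs with h4
    · exact h3 l hl hl'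
    · obtain rfl : l + 1 = j := by omega
      rw [hr', ← h2]; exact h3 l hl hl'

end Transducer

/-! ### Formulas for the runs of a transducer -/

section TransducerFormulas

variable {A B C : Type}

/-- The formula for a marked letter, where the letter `b` is given by the variable `c b`. -/
def letterTest (A : Type) (c : B → ℕ) (x : B × Mark) : Formula A :=
  .and (.var (c x.1)) (.and (if x.2.1 then .atom .P else .natom .P)
    (if x.2.2 then .atom .S else .natom .S))

/-- The interpretations `α` and `v` describe the marked word `lab`. -/
structure Describes (m : Mode) (dom : Set ℕ) (α : Atom A → Set ℕ) (v : ℕ → Set ℕ) (c : B → ℕ)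
    (lab : ℕ → B × Mark) : Prop where
  lower : ∀ ⦃k l⦄, k ≤ l → l ∈ dom → k ∈ dom
  first : ∀ k ∈ dom, k ∈ α (m.first A) ↔ k = 0
  last : ∀ k ∈ dom, k ∈ α (m.last A) ↔ k + 1 ∉ dom
  letter : ∀ k ∈ dom, ∀ b, k ∈ v (c b) ↔ (lab k).1 = b
  pred : ∀ k ∈ dom, k ∈ α .P ↔ (lab k).2.1 = true
  succ : ∀ k ∈ dom, k ∈ α .S ↔ (lab k).2.2 = true

theorem allowed_letterTest {m : Mode} {s : Set ℕ} {c : B → ℕ} (hc : ∀ b, c b ∈ s) (x : B × Mark) :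
    Formula.Allowed m s (letterTest A c x) := by
  unfold letterTest
  refine (Formula.Allowed.var (hc _)).and (.and ?_ ?_) <;> split_ifs
  exacts [.P, .not_P, .S, .not_S]

variable {m : Mode} {dom : Set ℕ} {α : Atom A → Set ℕ} {v : ℕ → Set ℕ} {c : B → ℕ}
  {lab : ℕ → B × Mark}

theorem Describes.mem_letterTest (h : Describes m dom α v c lab) {k : ℕ} (hk : k ∈ dom)
    (x : B × Mark) : k ∈ (letterTest A c x).linSem dom α v ↔ lab k = x := by
  obtain ⟨b, p, s⟩ := x
  have h1 := h.letter k hk b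
  have h2 := h.pred k hk
  have h3 := h.succ k hk
  have e1 : k ∈ (if p = true then (.atom .P : Formula A) else .natom .P).linSem dom α v ↔
      (lab k).2.1 = p := by
    cases p
    · simpa [Formula.linSem] using not_congr h2
    · simpa [Formula.linSem] using h2
  have e2 : k ∈ (if s = true then (.atom .S : Formula A) else .natom .S).linSem dom α v ↔
      (lab k).2.2 = s := by
    cases s
    · simpa [Formula.linSem] using not_congr h3
    · simpa [Formula.linSem] using h3
  refine Iff.trans (and_congr h1 (and_congr e1 e2)) ?_
  simp only [Prod.ext_iff]

variable [Finite B] (T : Transducer (B × Mark) C)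

/-- The formula for a transition from `q` to `q'`. -/
noncomputable def transTest (A : Type) (c : B → ℕ) (q q' : T.State) : Formula A :=
  .disj fun x : B × Mark => .guard (∃ o, T.step q x o q') (letterTest A c x)

/-- The formula for a transition from `q` to `q'` that writes `o`. -/
noncomputable def outTest (A : Type) (c : B → ℕ) (o : C) (q q' : T.State) : Formula A :=
  .disj fun x : B × Mark => .guard (T.step q x o q') (letterTest A c x)

/-- One step forward. -/
noncomputable def forward (A : Type) (m : Mode) (c : B → ℕ) (q q' : T.State) (φ : Formula A) :
    Formula A := .and (transTest T A c q q') (.modal m.next φ)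

/-- One step backward. -/
noncomputable def backward (A : Type) (m : Mode) (c : B → ℕ) (q q' : T.State) (φ : Formula A) :
    Formula A := .modal m.prev (.and (transTest T A c q' q) φ)

variable {T}

theorem allowed_transTest {s : Set ℕ} (hc : ∀ b, c b ∈ s) (q q' : T.State) :
    Formula.Allowed m s (transTest T A c q q') :=
  .disj fun x => .guard (allowed_letterTest hc x)

theorem allowed_outTest {s : Set ℕ} (hc : ∀ b, c b ∈ s) (o : C) (q q' : T.State) :
    Formula.Allowed m s (outTest T A c o q q') :=
  .disj fun x => .guard (allowed_letterTest hc x)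

theorem Describes.mem_transTest (h : Describes m dom α v c lab) {k : ℕ} (hk : k ∈ dom)
    (q q' : T.State) : k ∈ (transTest T A c q q').linSem dom α v ↔ T.Tr lab k q q' := by
  simp only [transTest, Formula.mem_linSem_disj, Formula.mem_linSem_guard, h.mem_letterTest hk,
    exists_eq_right', Transducer.Tr]

theorem Describes.mem_outTest (h : Describes m dom α v c lab) {k : ℕ} (hk : k ∈ dom) (o : C)
    (q q' : T.State) : k ∈ (outTest T A c o q q').linSem dom α v ↔ T.step q (lab k) o q' := by
  simp only [outTest, Formula.mem_linSem_disj, Formula.mem_linSem_guard, h.mem_letterTest hk,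
    exists_eq_right']

/-- The step relation of `forward`. -/
def ForwardStep (T : Transducer (B × Mark) C) (dom : Set ℕ) (α : Atom A → Set ℕ) (v : ℕ → Set ℕ)
    (c : B → ℕ) (x y : T.State × ℕ) : Prop :=
  x.2 ∈ (transTest T A c x.1 y.1).linSem dom α v ∧ y.2 ∈ dom ∧ y.2 = x.2 + 1

/-- The step relation of `backward`. -/
def BackwardStep (T : Transducer (B × Mark) C) (dom : Set ℕ) (α : Atom A → Set ℕ) (v : ℕ → Set ℕ)
    (c : B → ℕ) (x y : T.State × ℕ) : Prop :=
  y.2 ∈ (transTest T A c y.1 x.1).linSem dom α v ∧ y.2 ∈ dom ∧ x.2 = y.2 + 1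

theorem expresses_forward {N : ℕ} (hc : ∀ b, c b < N) :
    Expresses dom α v m N (forward T A m c) (ForwardStep T dom α v c) where
  allowed p q s φ hs hφ :=
    (allowed_transTest (fun b => hs (hc b)) p q).and (.modal m.next_mem hφ)
  sem v' hv' p q φ := by
    have h := (transTest T A c p q).linSem_congr (dom := dom) (α := α) (v := v') (v' := v)
      fun x hx => hv' x ((allowed_transTest (m := m) (s := Set.Iio N) hc p q).vars hx)
    simp only [forward, Formula.linSem, h, m.next_dir, ForwardStep]
    ext k
    constructor
    · rintro ⟨h1, k', h2, h3, h4⟩; exact ⟨k', ⟨h1, h2, h3⟩, h4⟩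
    · rintro ⟨k', ⟨h1, h2, h3⟩, h4⟩; exact ⟨h1, k', h2, h3, h4⟩

theorem expresses_backward {N : ℕ} (hc : ∀ b, c b < N) :
    Expresses dom α v m N (backward T A m c) (BackwardStep T dom α v c) where
  allowed p q s φ hs hφ :=
    .modal m.prev_mem ((allowed_transTest (fun b => hs (hc b)) q p).and hφ)
  sem v' hv' p q φ := by
    have h := (transTest T A c q p).linSem_congr (dom := dom) (α := α) (v := v') (v' := v)
      fun x hx => hv' x ((allowed_transTest (m := m) (s := Set.Iio N) hc q p).vars hx)
    simp only [backward, Formula.linSem, h, m.prev_dir, BackwardStep]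
    ext k
    constructor
    · rintro ⟨k', h1, h2, h3, h4⟩; exact ⟨k', ⟨h3, h1, h2⟩, h4⟩
    · rintro ⟨k', ⟨h3, h1, h2⟩, h4⟩; exact ⟨k', h1, h2, h3, h4⟩

namespace Describes

open Relation

variable (h : Describes m dom α v c lab)
include h

theorem seg_of_forward {x y : T.State × ℕ} (hx : x.2 ∈ dom)
    (hxy : ReflTransGen (ForwardStep T dom α v c) x y) :
    y.2 ∈ dom ∧ x.2 ≤ y.2 ∧ T.Seg lab x.2 y.2 x.1 y.1 := by
  induction hxy with
  | refl => exact ⟨hx, le_rfl, .refl _ _⟩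
  | tail _ hs ih =>
    obtain ⟨h1, h2, h3⟩ := ih
    obtain ⟨h4, h5, h6⟩ := hs
    refine ⟨h5, by omega, ?_⟩
    rw [h6]
    exact h3.snoc h2 ((h.mem_transTest h1 _ _).mp h4)

theorem forward_of_run {i j : ℕ} (hij : i ≤ j) (hj : j ∈ dom) (r : ℕ → T.State)
    (hr : ∀ l, i ≤ l → l < j → T.Tr lab l (r l) (r (l + 1))) :
    ReflTransGen (ForwardStep T dom α v c) (r i, i) (r j, j) := by
  induction j, hij using Nat.le_induction with
  | base => exact .refl
  | succ j hij ih =>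
    have hj' := h.lower (Nat.le_succ j) hj
    exact .tail (ih hj' fun l a b => hr l a (by omega))
      ⟨(h.mem_transTest hj' _ _).mpr (hr j hij (Nat.lt_succ_self j)), hj, rfl⟩

theorem seg_of_backward {x y : T.State × ℕ}
    (hxy : ReflTransGen (BackwardStep T dom α v c) x y) :
    y.2 ≤ x.2 ∧ T.Seg lab y.2 x.2 y.1 x.1 := by
  induction hxy using ReflTransGen.head_induction_on with
  | refl => exact ⟨le_rfl, .refl _ _⟩
  | head hs _ ih =>
    obtain ⟨h4, h5, h6⟩ := hs
    refine ⟨by omega, ?_⟩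
    rw [h6]
    exact ih.2.snoc ih.1 ((h.mem_transTest h5 _ _).mp h4)

theorem backward_of_run {k : ℕ} (hk : k ∈ dom) (r : ℕ → T.State)
    (hr : ∀ l, l < k → T.Tr lab l (r l) (r (l + 1))) :
    ReflTransGen (BackwardStep T dom α v c) (r k, k) (r 0, 0) := by
  induction k with
  | zero => exact .refl
  | succ k ih =>
    have hk' := h.lower (Nat.le_succ k) hk
    exact .head ⟨(h.mem_transTest hk' _ _).mpr (hr k (Nat.lt_succ_self k)), hk', rfl⟩
      (ih hk' fun l a => hr l (by omega))

end Describes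

variable (T)

/-- The formula for the positions that are reached by a run in state `q`. -/
noncomputable def prefixFormula (A : Type) (m : Mode) (c : B → ℕ) (N : ℕ) (q : T.State) :
    Formula A :=
  have := T.finite_state
  reachFormula (backward T A m c) N q fun q' => .guard (q' ∈ T.init) (.atom (m.first A))

/-- The formula for the positions where a run writes `o` and continues as expressed by `φ`. -/
noncomputable def outFormula (A : Type) (m : Mode) (c : B → ℕ) (N : ℕ) (o : C)
    (φ : T.State → Formula A) : Formula A :=
  have := T.finite_state
  .disj fun q => .disj fun q' => .and (prefixFormula T A m c N q) (.and (outTest T A c o q q') (φ q'))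

/-- The formula for the positions from which a run in state `q` reaches the end and accepts. -/
noncomputable def finSuffix (A : Type) (m : Mode) (c : B → ℕ) (N : ℕ) (q : T.State) : Formula A :=
  have := T.finite_state
  reachFormula (forward T A m c) N q fun q' => .and (.atom (m.last A))
    (.disj fun f => .guard (f ∈ T.accept) (transTest T A c q' f))

/-- The formula for the positions after which a run in state `q` accepts at the end. -/
noncomputable def finNext (A : Type) (m : Mode) (c : B → ℕ) (N : ℕ) (q : T.State) : Formula A :=
  .or (.guard (q ∈ T.accept) (.atom (m.last A))) (.modal m.next (finSuffix T A m c N q))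

/-- The formula for the positions where infinitely many returns to the state `f` begin. -/
noncomputable def loopFormula (A : Type) (m : Mode) (c : B → ℕ) (N : ℕ) (f : T.State) : Formula A :=
  have := T.finite_state
  .nu (N + (listAll T.State).length) (transFormula (forward T A m c) N f f
    (.var (N + (listAll T.State).length)))

/-- The formula for the positions after which a run in state `q` satisfies the Büchi condition. -/
noncomputable def omegaNext (A : Type) (m : Mode) (c : B → ℕ) (N : ℕ) (q : T.State) : Formula A :=
  have := T.finite_state
  .modal m.next (reachFormula (forward T A m c) N q fun f =>
    .guard (f ∈ T.accept) (loopFormula T A m c N f))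

variable {T} {N : ℕ} (hc : ∀ b, c b < N)
include hc

theorem allowed_prefixFormula (q : T.State) :
    Formula.Allowed m (Set.Iio N) (prefixFormula T A m c N q) := by
  have := T.finite_state
  exact (expresses_backward (dom := ∅) (α := fun _ => ∅) (v := fun _ => ∅) hc).allowed_reachFormula q
    fun q' => .guard .first

theorem allowed_outFormula (o : C) {φ : T.State → Formula A}
    (hφ : ∀ q, Formula.Allowed m (Set.Iio N) (φ q)) :
    Formula.Allowed m (Set.Iio N) (outFormula T A m c N o φ) := by
  have := T.finite_state
  exact .disj fun q => .disj fun q' => (allowed_prefixFormula hc q).and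
    ((allowed_outTest hc o q q').and (hφ q'))

theorem allowed_finSuffix (q : T.State) :
    Formula.Allowed m (Set.Iio N) (finSuffix T A m c N q) := by
  have := T.finite_state
  have h := expresses_forward (A := A) (T := T) (m := m) (dom := ∅) (α := fun _ => ∅)
    (v := fun _ => ∅) hc
  have hT : ∀ q', Formula.Allowed m (Set.Iio N) (.and (.atom (m.last A))
      (.disj fun f => .guard (f ∈ T.accept) (transTest T A c q' f))) := fun q' =>
    .and .last (.disj fun f => .guard (allowed_transTest hc q' f))
  exact h.allowed_reachFormula q hT

theorem allowed_finNext (q : T.State) : Formula.Allowed m (Set.Iio N) (finNext T A m c N q) :=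
  (Formula.Allowed.guard .last).or (.modal m.next_mem (allowed_finSuffix hc q))

theorem allowed_loopFormula (q : T.State) :
    Formula.Allowed m (Set.Iio N) (loopFormula T A m c N q) := by
  have := T.finite_state
  exact .nu ((expresses_forward (dom := ∅) (α := fun _ => ∅) (v := fun _ => ∅)
    hc).allowed_transFormula (Set.subset_insert _ _) q q (.var (Set.mem_insert _ _)))

theorem allowed_omegaNext (q : T.State) :
    Formula.Allowed m (Set.Iio N) (omegaNext T A m c N q) := by
  have := T.finite_state
  exact .modal m.next_mem
    ((expresses_forward (dom := ∅) (α := fun _ => ∅) (v := fun _ => ∅) hc).allowed_reachFormula q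
      fun q' => .guard (allowed_loopFormula hc q'))

namespace Describes

open Relation

variable (h : Describes m dom α v c lab)
include h

theorem mem_prefixFormula {k : ℕ} (hk : k ∈ dom) (q : T.State) :
    k ∈ (prefixFormula T A m c N q).linSem dom α v ↔ ∃ q' ∈ T.init, T.Seg lab 0 k q' q := by
  have := T.finite_state
  rw [prefixFormula, (expresses_backward hc).mem_linSem_reachFormula q fun _ => .guard .first]
  simp only [Formula.mem_linSem_guard, Formula.linSem]
  constructor
  · rintro ⟨q', k', h1, h2, h3⟩
    have h4 := h.seg_of_backward h1
    obtain rfl := (h.first k' (h.lower h4.1 hk)).mp h3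
    exact ⟨q', h2, h4.2⟩
  · rintro ⟨_, h1, r, rfl, rfl, h4⟩
    exact ⟨r 0, 0, h.backward_of_run hk r fun l hl => h4 l (Nat.zero_le l) hl, h1,
      (h.first 0 (h.lower (Nat.zero_le k) hk)).mpr rfl⟩

/-- A run is cut at the transition that writes `o` at `k`. Since acceptance depends only on the part
after that transition (`hAcc`), every past that leads to the same state can be combined with every
successful future. -/
theorem mem_outFormula {k : ℕ} (hk : k ∈ dom) (o : C) {φ : T.State → Formula A}
    {Acc : (ℕ → T.State) → Prop} (hAcc : ∀ r r', (∀ l, k + 1 ≤ l → r l = r' l) → Acc r → Acc r')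
    (hφ : ∀ q, k ∈ (φ q).linSem dom α v ↔ ∃ r : ℕ → T.State, r (k + 1) = q ∧
      (∀ j ∈ dom, k + 1 ≤ j → T.Tr lab j (r j) (r (j + 1))) ∧ Acc r) :
    k ∈ (outFormula T A m c N o φ).linSem dom α v ↔ ∃ (r : ℕ → T.State) (s : ℕ → C),
      r 0 ∈ T.init ∧ (∀ j ∈ dom, T.step (r j) (lab j) (s j) (r (j + 1))) ∧ Acc r ∧ s k = o := by
  have := T.finite_state
  simp only [outFormula, Formula.mem_linSem_disj, Formula.linSem, Set.mem_inter_iff,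
    h.mem_prefixFormula hc hk, h.mem_outTest hk, hφ]
  constructor
  · rintro ⟨q, q', ⟨q₀, hq₀, h1⟩, h2, r', h3, h4, h5⟩
    obtain ⟨r₁, e0, e1, e2⟩ := h1.append (Nat.zero_le k) (Function.update r' k q)
      (Function.update_self _ _ _)
    have e1k : r₁ k = q := by rw [e1 k le_rfl, Function.update_self]
    have e1' : ∀ l, k + 1 ≤ l → r₁ l = r' l := fun l hl => by
      rw [e1 l (by omega), Function.update_of_ne (by omega)]
    -- The written letters are chosen transition by transition, with `o` forced at `k`; outside the
    -- domain any letter will do.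
    have hstep : ∀ j, ∃ s, (j ∈ dom → T.step (r₁ j) (lab j) s (r₁ (j + 1))) ∧ (j = k → s = o) := by
      intro j
      rcases lt_trichotomy j k with hj | rfl | hj
      · obtain ⟨s, hs⟩ := e2 j (Nat.zero_le j) hj
        exact ⟨s, fun _ => hs, fun e => absurd e hj.ne⟩
      · refine ⟨o, fun _ => ?_, fun _ => rfl⟩
        rw [e1k, e1' _ le_rfl, h3]; exact h2
      · by_cases hjd : j ∈ dom
        · obtain ⟨s, hs⟩ := h4 j hjd hj
          refine ⟨s, fun _ => ?_, fun e => absurd e hj.ne'⟩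
          rw [e1' j hj, e1' (j + 1) (by omega)]; exact hs
        · exact ⟨o, fun h => absurd h hjd, fun _ => rfl⟩
    choose s hs hsk using hstep
    exact ⟨r₁, s, e0 ▸ hq₀, hs, hAcc r' r₁ (fun l hl => (e1' l hl).symm) h5, hsk k rfl⟩
  · rintro ⟨r, s, h1, h2, h3, rfl⟩
    exact ⟨r k, r (k + 1), ⟨r 0, h1, r, rfl, rfl, fun l _ hl => ⟨_, h2 l (h.lower hl.le hk)⟩⟩,
      h2 k hk, r, rfl, fun j hj _ => ⟨_, h2 j hj⟩, h3⟩

theorem mem_finSuffix {k : ℕ} (hk : k ∈ dom) (q : T.State) :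
    k ∈ (finSuffix T A m c N q).linSem dom α v ↔ ∃ k' ∈ dom, k' + 1 ∉ dom ∧ k ≤ k' ∧
      ∃ f ∈ T.accept, T.Seg lab k (k' + 1) q f := by
  have := T.finite_state
  rw [finSuffix, (expresses_forward hc).mem_linSem_reachFormula q fun q' =>
    .and .last (.disj fun f => .guard (allowed_transTest hc q' f))]
  simp only [Formula.linSem, Set.mem_inter_iff, Formula.mem_linSem_disj, Formula.mem_linSem_guard]
  constructor
  · rintro ⟨q', k', h1, h2, f, h3, h4⟩
    obtain ⟨h5, h6, h7⟩ := h.seg_of_forward hk h1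
    exact ⟨k', h5, (h.last k' h5).mp h2, h6, f, h3, h7.snoc h6 ((h.mem_transTest h5 _ _).mp h4)⟩
  · rintro ⟨k', h1, h2, h3, _, h4, r, rfl, rfl, h5⟩
    exact ⟨r k', k', h.forward_of_run h3 h1 r fun l a b => h5 l a (by omega),
      (h.last k' h1).mpr h2, r (k' + 1), h4,
      (h.mem_transTest h1 _ _).mpr (h5 k' h3 (Nat.lt_succ_self k'))⟩

/-- The state after the last position has no position of its own. If `k` is the last position, `q`
itself must be accepting; otherwise the run continues from `k + 1`, and acceptance is tested after
its transition at the last position. -/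
theorem mem_finNext {n : ℕ} (hdom : dom = {k | k < n}) {k : ℕ} (hk : k ∈ dom) (q : T.State) :
    k ∈ (finNext T A m c N q).linSem dom α v ↔ ∃ r : ℕ → T.State, r (k + 1) = q ∧
      (∀ j ∈ dom, k + 1 ≤ j → T.Tr lab j (r j) (r (j + 1))) ∧ r n ∈ T.accept := by
  have hd : ∀ j, j ∈ dom ↔ j < n := fun j => by rw [hdom]; rfl
  have hkn := (hd k).mp hk
  simp only [finNext, Formula.linSem, Set.mem_union, Formula.mem_linSem_guard, m.next_dir,
    h.last k hk, Set.mem_ofPred_eq]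
  constructor
  · rintro (⟨h1, h2⟩ | ⟨_, h1, rfl, h2⟩)
    · exact ⟨fun _ => q, rfl, fun j hj hj' => absurd (h.lower hj' hj) h2, h1⟩
    · obtain ⟨k', h3, h4, h5, f, h6, r, h7, h8, h9⟩ := (h.mem_finSuffix hc h1 q).mp h2
      rw [hd] at h3 h4
      obtain rfl : n = k' + 1 := by omega
      exact ⟨r, h7, fun j hj hj' => h9 j hj' ((hd j).mp hj), h8.symm ▸ h6⟩
  · rintro ⟨r, rfl, h2, h3⟩
    by_cases hk1 : k + 1 ∈ dom
    · refine .inr ⟨k + 1, hk1, rfl, (h.mem_finSuffix hc hk1 _).mpr ?_⟩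
      have hk1' := (hd _).mp hk1
      obtain ⟨l, rfl⟩ : ∃ l, n = l + 1 := ⟨n - 1, by omega⟩
      exact ⟨l, (hd l).mpr (by omega), by rw [hd]; omega, by omega, _, h3, r, rfl, rfl,
        fun j a b => h2 j ((hd j).mpr b) a⟩
    · refine .inl ⟨?_, hk1⟩
      have := (hd _).not.mp hk1
      obtain rfl : n = k + 1 := by omega
      exact h3

/-- Either disjunct requires a last position, and an infinite component has none. -/
theorem notMem_finNext (hdom : dom = Set.univ) (k : ℕ) (q : T.State) :
    k ∉ (finNext T A m c N q).linSem dom α v := by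
  subst hdom
  simp only [finNext, Formula.linSem, Set.mem_union, Formula.mem_linSem_guard, m.next_dir,
    h.last k trivial, Set.mem_ofPred_eq]
  rintro (⟨-, h1⟩ | ⟨_, h1, rfl, h2⟩)
  · exact h1 trivial
  · obtain ⟨k', -, h4, -⟩ := (h.mem_finSuffix hc h1 q).mp h2
    exact h4 trivial

-- A post-fixed point is a set of positions from each of which a further non-empty return to `f`
-- ends in the set again; chaining these returns gives `κ`, and conversely the range of `κ` is a
-- post-fixed point.
omit h in
theorem mem_loopFormula {k : ℕ} (f : T.State) :
    k ∈ (loopFormula T A m c N f).linSem dom α v ↔ ∃ κ : ℕ → ℕ, κ 0 = k ∧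
      ∀ n, TransGen (ForwardStep T dom α v c) (f, κ n) (f, κ (n + 1)) := by
  have := T.finite_state
  set z := N + (listAll T.State).length with hz
  have key : ∀ S : Set ℕ, (transFormula (forward T A m c) N f f (.var z)).linSem dom α
      (Function.update v z S) =
      {k | ∃ k', TransGen (ForwardStep T dom α v c) (f, k) (f, k') ∧ k' ∈ S} := by
    intro S
    rw [(expresses_forward (dom := dom) (α := α) (v := v) (m := m) hc).sem_transFormula
      (Function.update v z S) (fun x hx => Function.update_of_ne (by omega) _ _) f f
      (.var (.inr (Set.mem_Ici.mpr le_rfl)))]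
    simp [Formula.linSem, ← hz]
  simp only [loopFormula, Formula.linSem, ← hz, key]
  constructor
  · rintro ⟨S, hS, hk⟩
    obtain ⟨κ, h1, h2⟩ := exists_chain S _ (fun k hk => by
      obtain ⟨k', h1, h2⟩ := hS hk
      exact ⟨k', h2, h1⟩) hk
    exact ⟨κ, h1, fun n => (h2 n).2⟩
  · rintro ⟨κ, rfl, h2⟩
    exact ⟨Set.range κ, by rintro _ ⟨n, rfl⟩; exact ⟨_, h2 n, _, rfl⟩, 0, rfl⟩

omit hc in
theorem seg_of_forward_transGen {x y : T.State × ℕ} (hx : x.2 ∈ dom)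
    (hxy : TransGen (ForwardStep T dom α v c) x y) :
    y.2 ∈ dom ∧ x.2 < y.2 ∧ T.Seg lab x.2 y.2 x.1 y.1 := by
  obtain ⟨z, h1, h2⟩ := TransGen.head'_iff.mp hxy
  have h3 := h.seg_of_forward h1.2.1 h2
  have h4 := h.seg_of_forward hx hxy.to_reflTransGen
  exact ⟨h4.1, by have := h1.2.2; omega, h4.2.2⟩

/-- Each return to `f` moves strictly forward, so infinitely many returns would leave a finite
component. -/
theorem notMem_omegaNext {n : ℕ} (hdom : dom = {k | k < n}) (k : ℕ) (q : T.State) :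
    k ∉ (omegaNext T A m c N q).linSem dom α v := by
  have := T.finite_state
  rw [omegaNext]
  rintro ⟨k₁, hk₁, -, h1⟩
  rw [(expresses_forward hc).mem_linSem_reachFormula q
    fun q' => .guard (allowed_loopFormula hc q')] at h1
  obtain ⟨f, k', h1, h2⟩ := h1
  obtain ⟨-, h2⟩ := Formula.mem_linSem_guard.mp h2
  obtain ⟨κ, rfl, h3⟩ := (mem_loopFormula hc f).mp h2
  have hd : ∀ j, κ j ∈ dom := by
    intro j
    induction j with
    | zero => exact (h.seg_of_forward hk₁ h1).1
    | succ j ih => exact (h.seg_of_forward_transGen ih (h3 j)).1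
  have hmono : StrictMono κ := strictMono_nat_of_lt_succ fun j =>
    (h.seg_of_forward_transGen (hd j) (h3 j)).2.1
  have h4 : κ n < n := by have := hd n; rw [hdom] at this; exact this
  exact absurd (hmono.id_le n) (not_le.mpr h4)

theorem mem_omegaNext (hdom : dom = Set.univ) (k : ℕ) (q : T.State) :
    k ∈ (omegaNext T A m c N q).linSem dom α v ↔ ∃ r : ℕ → T.State, r (k + 1) = q ∧
      (∀ j ∈ dom, k + 1 ≤ j → T.Tr lab j (r j) (r (j + 1))) ∧
        ∃ᶠ j in Filter.atTop, r j ∈ T.accept := by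
  have := T.finite_state
  have hd : ∀ j, j ∈ dom := fun j => hdom ▸ trivial
  have e1 : k ∈ (omegaNext T A m c N q).linSem dom α v ↔
      k + 1 ∈ (reachFormula (forward T A m c) N q fun f =>
        .guard (f ∈ T.accept) (loopFormula T A m c N f)).linSem dom α v := by
    simp only [omegaNext, Formula.linSem, m.next_dir]
    exact ⟨fun ⟨_, _, e, h⟩ => e ▸ h, fun h => ⟨_, hd _, rfl, h⟩⟩
  rw [e1, (expresses_forward hc).mem_linSem_reachFormula q
    fun q' => .guard (allowed_loopFormula hc q')]
  simp only [Formula.mem_linSem_guard, mem_loopFormula hc]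
  constructor
  · rintro ⟨f, k', h1, h2, κ, rfl, h3⟩
    have hseg := fun n => h.seg_of_forward_transGen (hd _) (h3 n)
    have hκ : StrictMono κ := strictMono_nat_of_lt_succ fun j => (hseg j).2.1
    choose ρ hρ1 hρ2 hρ3 using fun n => (hseg n).2.2
    dsimp only at hρ1 hρ2 hρ3
    -- The segments between consecutive visits to `f` form one infinite run, which is then put
    -- behind the segment that leads to the first visit.
    obtain ⟨r', hr'⟩ := exists_glue hκ ρ fun n => (hρ2 n).trans (hρ1 (n + 1)).symm
    have h4 := h.seg_of_forward (hd _) h1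
    dsimp only at h4
    have hf : ∀ n, r' (κ n) = f := fun n => by
      rw [hr' n _ le_rfl (hκ (Nat.lt_succ_self n)).le, hρ1]
    obtain ⟨r, i1, i2, i3⟩ := h4.2.2.append h4.2.1 r' (hf 0)
    refine ⟨r, i1, fun j _ hj => ?_, Filter.frequently_atTop.mpr fun n => ⟨κ n, hκ.id_le n, ?_⟩⟩
    · rcases Nat.lt_or_ge j (κ 0) with h5 | h5
      · exact i3 j hj h5
      · obtain ⟨n, a, b⟩ := exists_mem_interval hκ h5
        rw [i2 j h5, i2 (j + 1) (by omega), hr' n j a b.le, hr' n (j + 1) (by omega) b]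
        exact hρ3 n j a b
    · rw [i2 _ (hκ.monotone (Nat.zero_le n)), hf]
      exact h2
  · rintro ⟨r, rfl, h2, h3⟩
    -- There are finitely many states, so one fixed accepting state recurs infinitely often.
    obtain ⟨f, hf, h4⟩ : ∃ f ∈ T.accept, ∃ᶠ j in Filter.atTop, r j = f := by
      by_contra hcon
      push Not at hcon
      refine h3 ?_
      have : ∀ᶠ j in Filter.atTop, ∀ f, f ∈ T.accept → r j ≠ f :=
        Filter.eventually_all.mpr fun f => by
          by_cases hf : f ∈ T.accept
          · exact (hcon f hf).mono fun j hj _ => hj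
          · exact Filter.Eventually.of_forall fun j h => absurd h hf
      exact this.mono fun j hj hj' => hj _ hj' rfl
    have h5 := Filter.frequently_atTop.mp h4
    obtain ⟨k', hk', e⟩ := h5 (k + 1)
    obtain ⟨κ, h6, h7⟩ := exists_chain {j | k + 1 ≤ j ∧ r j = f} (fun i j => i < j) (fun i hi => by
      obtain ⟨j, hj, e⟩ := h5 (i + 1)
      exact ⟨j, ⟨by have := hi.1; omega, e⟩, hj⟩) (x := k') ⟨hk', e⟩
    refine ⟨f, k', e ▸ h.forward_of_run hk' (hd _) r fun l a _ => h2 l (hd l) a, hf, κ, h6,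
      fun n => ?_⟩
    have hlt := (h7 n).2
    have a1 := (h7 n).1
    have a2 := (h7 (n + 1)).1
    have h8 := h.forward_of_run (T := T) (i := κ n + 1) (j := κ (n + 1)) hlt (hd _) r
      fun l a _ => h2 l (hd l) (by have := a1.1; omega)
    refine TransGen.head'_iff.mpr ⟨(r (κ n + 1), κ n + 1), ?_, a2.2 ▸ h8⟩
    refine ⟨(h.mem_transTest (hd _) _ _).mpr ?_, hd _, rfl⟩
    have := h2 (κ n) (hd _) a1.1
    rwa [a1.2] at this

end Describes
end TransducerFormulas

/-! ### Formulas for the output of a transducer on words -/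

section Stages

variable {P : Type v} [LinearOrder P] {A B C : Type} {m : Mode} {w : P → A × D}
  {dom : Set ℕ} {pos : ℕ → P} {c : B → ℕ} {v : ℕ → Set P} {ℓ : P → B}

theorem Enumerates.describes (h : Enumerates m w dom pos) (hv : ∀ b i, i ∈ v (c b) ↔ ℓ i = b) :
    Describes m dom (fun a : Atom A => {k | pos k ∈ a.sem w}) (fun x => {k | pos k ∈ v x}) c
      fun k => markedLabel (relabel w ℓ) (pos k) where
  lower := h.lower
  first k hk := h.first_iff hk
  last k hk := h.last_iff hk
  letter k _ b := hv b (pos k)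
  pred k _ := by
    simp only [markedLabel, decide_eq_true_iff]
    exact Iff.rfl
  succ k _ := by
    simp only [markedLabel, decide_eq_true_iff]
    exact Iff.rfl

theorem Enumerates.mem_sem_iff_linSem (h : Enumerates m w dom pos) {s : Set ℕ} {ψ : Formula A}
    (hψ : Formula.Allowed m s ψ) {k : ℕ} (hk : k ∈ dom) : pos k ∈ ψ.sem w v ↔
      k ∈ ψ.linSem dom (fun a : Atom A => {k | pos k ∈ a.sem w}) (fun x => {k | pos k ∈ v x}) :=
  h.mem_sem_iff ψ hψ.strict.1 (fun _ _ _ _ => Iff.rfl) (fun _ _ _ _ => Iff.rfl) hk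

variable [Finite B] (T : Transducer (B × Mark) C) {N : ℕ}

/-- The formula for the output `o` on finite components. -/
noncomputable def finOut (A : Type) (m : Mode) (c : B → ℕ) (N : ℕ) (o : C) : Formula A :=
  outFormula T A m c N o (finNext T A m c N)

/-- The formula for the output `o` on infinite components. -/
noncomputable def omegaOut (A : Type) (m : Mode) (c : B → ℕ) (N : ℕ) (o : C) : Formula A :=
  outFormula T A m c N o (omegaNext T A m c N)

variable {T} (hc : ∀ b, c b < N)
include hc

theorem allowed_finOut (o : C) : Formula.Allowed m (Set.Iio N) (finOut T A m c N o) :=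
  allowed_outFormula hc o fun q => allowed_finNext hc q

theorem allowed_omegaOut (o : C) : Formula.Allowed m (Set.Iio N) (omegaOut T A m c N o) :=
  allowed_outFormula hc o fun q => allowed_omegaNext hc q

theorem mem_sem_outFormula_imp (h : Enumerates m w dom pos) (hv : ∀ b i, i ∈ v (c b) ↔ ℓ i = b)
    {o : C} {φ : T.State → Formula A} (hφ : ∀ q, Formula.Allowed m (Set.Iio N) (φ q)) {k : ℕ}
    (hk : k ∈ dom) (hn : ∀ q, k ∉ (φ q).linSem dom (fun a : Atom A => {k | pos k ∈ a.sem w})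
      fun x => {k | pos k ∈ v x}) : pos k ∉ (outFormula T A m c N o φ).sem w v := by
  rw [h.mem_sem_iff_linSem (allowed_outFormula hc o hφ) hk,
    (h.describes hv).mem_outFormula hc hk o (Acc := fun _ => False) (fun _ _ _ h => h)
      fun q => ⟨fun h => absurd h (hn q), fun ⟨_, _, _, h⟩ => h.elim⟩]
  exact fun ⟨_, _, _, _, h, _⟩ => h

theorem mem_sem_finOut {n : ℕ} (h : Enumerates m w {k | k < n} pos)
    (hv : ∀ b i, i ∈ v (c b) ↔ ℓ i = b) {e : Fin n → P} (he : ∀ k : Fin n, pos k = e k)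
    (k : Fin n) (o : C) : e k ∈ (finOut T A m c N o).sem w v ↔
      ∃ u, T.Outputs (fun k => markedLabel (relabel w ℓ) (e k)) u ∧ u k = o := by
  rw [← he, h.mem_sem_iff_linSem (allowed_finOut hc o) k.2, finOut,
    (h.describes hv).mem_outFormula hc k.2 o (Acc := fun r => r n ∈ T.accept)
      (fun r r' e h => e n k.2 ▸ h) fun q => (h.describes hv).mem_finNext hc rfl k.2 q]
  constructor
  · rintro ⟨r, s, h1, h2, h3, h4⟩
    exact ⟨fun k => s k, ⟨fun k => r k, h1, fun i => by
      have := h2 i i.2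
      rwa [he i] at this, h3⟩, h4⟩
  · rintro ⟨u, ⟨r, h1, h2, h3⟩, h4⟩
    -- The default values beyond the word are harmless: transitions are required only below `n`, and
    -- acceptance refers to the state at `n`.
    refine ⟨fun j => if hj : j ≤ n then r ⟨j, by omega⟩ else r 0,
      fun j => if hj : j < n then u ⟨j, hj⟩ else o, ?_, fun j (hj : j < n) => ?_, ?_, ?_⟩
    · simpa using h1
    · have := h2 ⟨j, hj⟩
      dsimp only at this
      rw [← he] at this
      simpa [hj, hj.le, Nat.succ_le_of_lt hj] using this
    · simp only [le_refl, dite_true]; exact h3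
    · simpa using h4

theorem mem_sem_omegaOut (h : Enumerates m w Set.univ pos) (hv : ∀ b i, i ∈ v (c b) ↔ ℓ i = b)
    (k : ℕ) (o : C) : pos k ∈ (omegaOut T A m c N o).sem w v ↔
      ∃ u, T.OmegaOutputs (fun k => markedLabel (relabel w ℓ) (pos k)) u ∧ u k = o := by
  rw [h.mem_sem_iff_linSem (allowed_omegaOut hc o) trivial, omegaOut,
    (h.describes hv).mem_outFormula hc trivial o
      (Acc := fun r => ∃ᶠ j in Filter.atTop, r j ∈ T.accept)
      (fun r r' e h => (h.and_eventually (Filter.eventually_ge_atTop (k + 1))).mono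
        fun j hj => e j hj.2 ▸ hj.1)
      fun q => (h.describes hv).mem_omegaNext hc rfl k q]
  constructor
  · rintro ⟨r, s, h1, h2, h3, h4⟩
    exact ⟨s, ⟨r, h1, fun i => h2 i trivial, h3⟩, h4⟩
  · rintro ⟨u, ⟨r, h1, h2, h3⟩, h4⟩
    exact ⟨r, u, h1, fun j _ => h2 j, h3, h4⟩

theorem notMem_sem_omegaOut {n : ℕ} (h : Enumerates m w {k | k < n} pos)
    (hv : ∀ b i, i ∈ v (c b) ↔ ℓ i = b) {k : ℕ} (hk : k < n) (o : C) :
    pos k ∉ (omegaOut T A m c N o).sem w v :=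
  mem_sem_outFormula_imp hc h hv (fun q => allowed_omegaNext hc q) hk
    fun q => (h.describes hv).notMem_omegaNext hc rfl k q

theorem notMem_sem_finOut (h : Enumerates m w Set.univ pos)
    (hv : ∀ b i, i ∈ v (c b) ↔ ℓ i = b) (k : ℕ) (o : C) :
    pos k ∉ (finOut T A m c N o).sem w v :=
  mem_sem_outFormula_imp hc h hv (fun q => allowed_finNext hc q) trivial
    fun q => (h.describes hv).notMem_finNext hc rfl k q

end Stages

/-- If `M k o` says that some output has the letter `o` at `k`, and outputs are unique, then `M`
determines the output. -/
theorem functional_outputs {I C : Type*} {R : (I → C) → Prop} (hR : ∀ u u', R u → R u' → u = u')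
    {M : I → C → Prop} (hM : ∀ k o, M k o ↔ ∃ u, R u ∧ u k = o) :
    (∀ u, R u → ∀ k o, M k o ↔ u k = o) ∧ ∀ u, I → (∀ k, M k (u k)) → R u := by
  refine ⟨fun u hu k o => (hM k o).trans ⟨?_, fun h => ⟨u, hu, h⟩⟩, fun u i hu => ?_⟩
  · rintro ⟨u', hu', h⟩
    rwa [hR u u' hu hu']
  · obtain ⟨u', hu', -⟩ := (hM i _).mp (hu i)
    convert hu'
    funext k
    obtain ⟨u'', hu'', h⟩ := (hM k _).mp (hu k)
    rw [← h, hR u'' u' hu'' hu']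

/-! ### Functional outputs, class by class -/

section ClassOutputs

variable {P : Type v} [LinearOrder P] {B C : Type} {w₀ : P → B × D}
  {M : C → Set P}

theorem finiteClasses_iff {L : FunctionalTransducer (B × Mark) C}
    (hM : ∀ (d : D) (n : ℕ) (e : Fin n ≃o ClassOf w₀ d) (k : Fin n) (o : C), (e k).1 ∈ M o ↔
      ∃ u, L.Outputs (fun k => markedLabel w₀ (e k).1) u ∧ u k = o) :
    (∀ w' : P → C × D, OutputsOnFiniteClasses L w₀ w' → ∀ i o, Finite (ClassOf w₀ (w₀ i).2) →
      (i ∈ M o ↔ (w' i).1 = o)) ∧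
    ∀ w' : P → C × D, (∀ i, i ∈ M (w' i).1) → OutputsOnFiniteClasses L w₀ w' := by
  refine ⟨fun w' hw' i o hfin => ?_, ?_⟩
  · have : Finite {j | (w₀ j).2 = (w₀ i).2} := hfin
    obtain ⟨n, ⟨e⟩⟩ := exists_fin_orderIso {j | (w₀ j).2 = (w₀ i).2}
    have h := (functional_outputs (L.functional n _) (hM (w₀ i).2 n e)).1 _
      (hw' _ ⟨i, rfl⟩ n e) (e.symm ⟨i, rfl⟩) o
    simpa only [OrderIso.apply_symm_apply] using h
  · rintro w' hw' d ⟨i, rfl⟩ n e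
    exact (functional_outputs (L.functional n _) (hM _ n e)).2 _ (e.symm ⟨i, rfl⟩)
      fun k => hw' (e k).1

theorem infiniteClasses_iff {L : FunctionalBuchiTransducer (B × Mark) C}
    (hM : ∀ (d : D) (e : ℕ ≃o ClassOf w₀ d) (k : ℕ) (o : C), (e k).1 ∈ M o ↔
      ∃ u, L.OmegaOutputs (fun k => markedLabel w₀ (e k).1) u ∧ u k = o) :
    (∀ w' : P → C × D, OutputsOnInfiniteClasses L w₀ w' → ∀ i o,
      Nonempty (ℕ ≃o ClassOf w₀ (w₀ i).2) → (i ∈ M o ↔ (w' i).1 = o)) ∧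
    ∀ w' : P → C × D, (∀ i, i ∈ M (w' i).1) → OutputsOnInfiniteClasses L w₀ w' := by
  refine ⟨fun w' hw' i o ⟨e⟩ => ?_, ?_⟩
  · have h := (functional_outputs (L.functional _) (hM (w₀ i).2 e)).1 _
      (hw' _ ⟨i, rfl⟩ e) (e.symm ⟨i, rfl⟩) o
    simpa only [OrderIso.apply_symm_apply] using h
  · rintro w' hw' d - e
    exact (functional_outputs (L.functional _) (hM _ e)).2 _ 0 fun k => hw' (e k).1

end ClassOutputs

/-- For every transducer there are formulas of some mode that define its output, in terms of
variables that define its input. -/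
def WordKind.DefinesOutputs {D : Type u} (K : WordKind D) : Prop :=
  ∀ (A B C : Type), Finite B → ∀ t : K.Trans B C, ∃ m : Mode, ∀ (N : ℕ) (c : B → ℕ),
    (∀ b, c b < N) → ∃ ψ : C → Formula A, (∀ o, Formula.Allowed m (Set.Iio N) (ψ o)) ∧
      ∀ n (w : K.Pos n → A × D) (ℓ : K.Pos n → B) (v : ℕ → Set (K.Pos n)),
        (∀ b i, i ∈ v (c b) ↔ ℓ i = b) →
        (∀ w', K.Run t (relabel w ℓ) w' →
          (∀ i, (w' i).2 = (w i).2) ∧ ∀ i o, i ∈ (ψ o).sem w v ↔ (w' i).1 = o) ∧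
        ((∀ i, ∃ o, i ∈ (ψ o).sem w v) → ∃ w', K.Run t (relabel w ℓ) w')

theorem finiteKind_definesOutputs : (finiteKind D).DefinesOutputs := by
  intro A B C _ t
  cases t with
  | glob G =>
    refine ⟨.glob, fun N c hc => ⟨finOut G.toTransducer A .glob c N, allowed_finOut hc,
      fun n w ℓ v hv => ?_⟩⟩
    obtain ⟨pos, h1, h2⟩ := Enumerates.of_fin (m := .glob) (w := w) rfl
      (OrderIso.Set.univ (α := Fin (n + 1))).symm
    obtain ⟨h3, h4⟩ := functional_outputs (G.functional _ _)
      (mem_sem_finOut (T := G.toTransducer) hc h1 hv h2)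
    refine ⟨fun w' hw' => ⟨hw'.1, fun i o => h3 _ hw'.2 i o⟩, fun h => ?_⟩
    choose o ho using h
    exact ⟨relabel w o, fun i => rfl, h4 o 0 ho⟩
  | cls L =>
    refine ⟨.cls, fun N c hc => ⟨finOut L.toTransducer A .cls c N, allowed_finOut hc,
      fun n w ℓ v hv => ?_⟩⟩
    obtain ⟨h3, h4⟩ := finiteClasses_iff (w₀ := relabel w ℓ) (L := L)
      (M := fun o => (finOut L.toTransducer A .cls c N o).sem w v) fun d m e k o => by
        obtain ⟨pos, h1, h2⟩ := Enumerates.of_fin (m := .cls) (w := w)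
          (s := {i | (w i).2 = d}) ⟨d, rfl⟩ e
        exact mem_sem_finOut hc h1 hv h2 k o
    refine ⟨fun w' hw' => ⟨hw'.1, fun i o => h3 w' hw'.2 i o inferInstance⟩, fun h => ?_⟩
    choose o ho using h
    exact ⟨relabel w o, fun i => rfl, h4 _ ho⟩

theorem omegaKind_definesOutputs : (omegaKind D).DefinesOutputs := by
  intro A B C _ t
  cases t with
  | glob G =>
    refine ⟨.glob, fun N c hc => ⟨omegaOut G.toTransducer A .glob c N, allowed_omegaOut hc,
      fun n w ℓ v hv => ?_⟩⟩
    have h1 := Enumerates.of_nat (m := .glob) (w := w) rfl (OrderIso.Set.univ (α := ℕ)).symm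
    obtain ⟨h3, h4⟩ := functional_outputs (G.functional _)
      (mem_sem_omegaOut (T := G.toTransducer) hc h1 hv)
    refine ⟨fun w' hw' => ⟨hw'.1, fun i o => h3 _ hw'.2 i o⟩, fun h => ?_⟩
    choose o ho using h
    exact ⟨relabel w o, fun i => rfl, h4 o 0 ho⟩
  | cls L Lω =>
    refine ⟨.cls, fun N c hc => ⟨fun o => .or (finOut L.toTransducer A .cls c N o)
      (omegaOut Lω.toTransducer A .cls c N o),
      fun o => (allowed_finOut hc o).or (allowed_omegaOut hc o), fun n w ℓ v hv => ?_⟩⟩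
    obtain ⟨h3, h4⟩ := finiteClasses_iff (w₀ := relabel w ℓ) (L := L)
      (M := fun o => (finOut L.toTransducer A .cls c N o).sem w v ∪
        (omegaOut Lω.toTransducer A .cls c N o).sem w v) fun d m e k o => by
        obtain ⟨pos, h1, h2⟩ := Enumerates.of_fin (m := .cls) (w := w)
          (s := {i | (w i).2 = d}) ⟨d, rfl⟩ e
        -- On a finite class the Büchi disjunct is false. The two kinds of classes can therefore
        -- share one disjunction, although no atom tells them apart.
        refine Iff.trans (or_iff_left ?_) (mem_sem_finOut (T := L.toTransducer) hc h1 hv h2 k o)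
        have h := notMem_sem_omegaOut (T := Lω.toTransducer) hc h1 hv k.2 o
        rwa [h2 k] at h
    obtain ⟨h3', h4'⟩ := infiniteClasses_iff (w₀ := relabel w ℓ) (L := Lω)
      (M := fun o => (finOut L.toTransducer A .cls c N o).sem w v ∪
        (omegaOut Lω.toTransducer A .cls c N o).sem w v) fun d e k o => by
        have h1 := Enumerates.of_nat (m := .cls) (w := w) (s := {i | (w i).2 = d}) ⟨d, rfl⟩ e
        exact Iff.trans (or_iff_right (notMem_sem_finOut hc h1 hv k o))
          (mem_sem_omegaOut (T := Lω.toTransducer) hc h1 hv k o)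
    refine ⟨fun w' hw' => ⟨hw'.1, fun i o => ?_⟩, fun h => ?_⟩
    · rcases finite_or_infinite (ClassOf (relabel w ℓ) (w i).2) with hfin | hinf
      · exact h3 w' hw'.2.1 i o hfin
      · classical
        have : Infinite {j : ℕ | (w j).2 = (w i).2} := hinf
        exact h3' w' hw'.2.2 i o ⟨Nat.Subtype.orderIsoOfNat {j | (w j).2 = (w i).2}⟩
    · choose o ho using h
      exact ⟨relabel w o, fun i => rfl, h4 _ ho, h4' _ ho⟩

/-! ### The composition hierarchy -/

section Hierarchy

variable {A : Type} {m : Mode}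

namespace Formula

theorem subst_var (ψ : Formula A) : ψ.subst .var = ψ := by
  induction ψ with
  | var x => rfl
  | atom a => rfl
  | natom a => rfl
  | modal M φ ih => rw [subst, ih]
  | or φ ψ ih1 ih2 | and φ ψ ih1 ih2 => rw [subst, ih1, ih2]
  | mu x φ ih | nu x φ ih => rw [subst, Function.update_eq_self, ih]

/-- Substitution within one mode produces a formula of that mode again. This keeps the height from
growing when the substituted formulas are letters. -/
theorem Allowed.subst {s t : Set ℕ} {ψ : Formula A} {σ : ℕ → Formula A} (h : Allowed m s ψ)
    (hσ : ∀ x ∈ s, Allowed m t (σ x)) : Allowed m t (ψ.subst σ) := by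
  have hupd : ∀ {s t : Set ℕ} {σ : ℕ → Formula A}, (∀ x ∈ s, Allowed m t (σ x)) → ∀ x,
      ∀ y ∈ insert x s, Allowed m (insert x t) (Function.update σ x (.var x) y) := by
    intro s t σ hσ x y hy
    by_cases e : y = x
    · subst e
      rw [Function.update_self]
      exact .var (Set.mem_insert _ _)
    · rw [Function.update_of_ne e]
      exact (hσ y (hy.resolve_left e)).mono (Set.subset_insert _ _)
  induction ψ generalizing s t σ with
  | var x => exact hσ x (h.2 rfl)
  | atom a => exact ⟨h.1, Set.empty_subset _⟩
  | natom a => exact ⟨h.1, Set.empty_subset _⟩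
  | modal M φ ih =>
    exact .modal (h.1.1 (Set.mem_insert _ _))
      (ih ⟨⟨(Set.subset_insert _ _).trans h.1.1, h.1.2⟩, h.2⟩ hσ)
  | or φ ψ ih1 ih2 =>
    exact .or (ih1 ⟨⟨Set.subset_union_left.trans h.1.1, fun h' => h.1.2.1 (.inl h'),
      fun h' => h.1.2.2 (.inl h')⟩, Set.subset_union_left.trans h.2⟩ hσ)
      (ih2 ⟨⟨Set.subset_union_right.trans h.1.1, fun h' => h.1.2.1 (.inr h'),
      fun h' => h.1.2.2 (.inr h')⟩, Set.subset_union_right.trans h.2⟩ hσ)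
  | and φ ψ ih1 ih2 =>
    exact .and (ih1 ⟨⟨Set.subset_union_left.trans h.1.1, fun h' => h.1.2.1 (.inl h'),
      fun h' => h.1.2.2 (.inl h')⟩, Set.subset_union_left.trans h.2⟩ hσ)
      (ih2 ⟨⟨Set.subset_union_right.trans h.1.1, fun h' => h.1.2.1 (.inr h'),
      fun h' => h.1.2.2 (.inr h')⟩, Set.subset_union_right.trans h.2⟩ hσ)
  | mu x φ ih =>
    refine .mu (ih (s := insert x s) ⟨h.1, fun y hy => ?_⟩ (hupd hσ x))
    by_cases e : y = x
    exacts [.inl e, .inr (h.2 ⟨hy, e⟩)]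
  | nu x φ ih =>
    refine .nu (ih (s := insert x s) ⟨h.1, fun y hy => ?_⟩ (hupd hσ x))
    by_cases e : y = x
    exacts [.inl e, .inr (h.2 ⟨hy, e⟩)]

/-- The number of mode changes along the modalities of a formula, in a context of mode `m`. -/
noncomputable def alternation : Formula A → Mode → ℕ
  | .var _, _ => 0
  | .atom _, _ => 0
  | .natom _, _ => 0
  | .modal M φ, m => by
    classical exact if M ∈ m.modalities then φ.alternation m else φ.alternation m.other + 1
  | .or φ ψ, m => max (φ.alternation m) (ψ.alternation m)
  | .and φ ψ, m => max (φ.alternation m) (ψ.alternation m)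
  | .mu _ φ, m => φ.alternation m
  | .nu _ φ, m => φ.alternation m

end Formula

theorem Mode.next_notMem_other (m : Mode) : m.next ∉ m.other.modalities := by
  cases m <;> simp [Mode.modalities, Mode.other, Mode.next, Mode.prev]

theorem Mode.notMem_other {M : Modality} (h : M ∈ m.modalities) : M ∉ m.other.modalities := by
  rcases h with rfl | rfl <;> cases m <;>
    simp [Mode.modalities, Mode.other, Mode.next, Mode.prev]

/-- A formula of mode `m` changes the mode at most once, on entering from a context of the other
mode; all further changes occur in the substituted formulas, whatever the context they are placed
in. -/
theorem Formula.alternation_subst_le {ψ : Formula A} (h : ψ.modalities ⊆ m.modalities)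
    {σ : ℕ → Formula A} {k : ℕ} (hσ : ∀ x ∈ ψ.freeVars, ∀ m, (σ x).alternation m ≤ k) :
    (ψ.subst σ).alternation m ≤ k ∧ (ψ.subst σ).alternation m.other ≤ k + 1 := by
  induction ψ generalizing σ with
  | var x => exact ⟨hσ x rfl m, (hσ x rfl _).trans (Nat.le_succ k)⟩
  | atom a => exact ⟨Nat.zero_le _, Nat.zero_le _⟩
  | natom a => exact ⟨Nat.zero_le _, Nat.zero_le _⟩
  | modal M φ ih =>
    obtain ⟨h1, h2⟩ := ih ((Set.subset_insert _ _).trans h) hσ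
    have hM := h (Set.mem_insert _ _)
    refine ⟨?_, ?_⟩
    · rw [subst, alternation, if_pos hM]
      exact h1
    · rw [subst, alternation, if_neg (Mode.notMem_other hM), Mode.other_other]
      exact Nat.succ_le_succ h1
  | or φ ψ ih1 ih2 | and φ ψ ih1 ih2 =>
    obtain ⟨h1, h2⟩ := ih1 (Set.subset_union_left.trans h) fun x hx => hσ x (.inl hx)
    obtain ⟨h3, h4⟩ := ih2 (Set.subset_union_right.trans h) fun x hx => hσ x (.inr hx)
    exact ⟨max_le h1 h3, max_le h2 h4⟩
  | mu x φ ih | nu x φ ih =>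
    refine ih (σ := Function.update σ x (.var x)) h fun y hy m => ?_
    by_cases e : y = x
    · subst e
      rw [Function.update_self]
      exact Nat.zero_le _
    · rw [Function.update_of_ne e]
      exact hσ y ⟨hy, e⟩ m

/-- This is the lower bound for heights: it applies to every way of composing the formula over the
full basis, and hence also over the strict one. -/
theorem alternation_le_of_mem_Comp {k : ℕ} {φ : Formula A} (h : φ ∈ Comp (modeBasis A) k)
    (m : Mode) : φ.alternation m ≤ k := by
  induction k generalizing φ m with
  | zero => exact h.elim
  | succ k ih =>
    obtain ⟨ψ, hψ, σ, hσ, rfl⟩ := h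
    obtain ⟨m', hm'⟩ := mem_modeBasis_iff.mp hψ
    obtain ⟨h1, h2⟩ := Formula.alternation_subst_le hm' fun x hx m => ih (hσ x hx) m
    cases m <;> cases m'
    exacts [h1.trans (Nat.le_succ k), h2, h2, h1.trans (Nat.le_succ k)]

theorem Comp_subset_succ (Ψ : Set (Formula A)) (k : ℕ) : Comp Ψ k ⊆ Comp Ψ (k + 1) := by
  induction k with
  | zero => exact Set.empty_subset _
  | succ k ih => exact fun χ ⟨ψ, h, σ, hσ, e⟩ => ⟨ψ, h, σ, fun x hx => ih (hσ x hx), e⟩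

theorem Comp_mono (Ψ : Set (Formula A)) : Monotone (Comp Ψ) :=
  monotone_nat_of_le_succ (Comp_subset_succ Ψ)

theorem Comp_subset_Comp {Ψ Ψ' : Set (Formula A)} (h : Ψ ⊆ Ψ') (k : ℕ) : Comp Ψ k ⊆ Comp Ψ' k := by
  induction k with
  | zero => exact Set.Subset.rfl
  | succ k ih => exact fun χ ⟨ψ, h1, σ, hσ, e⟩ => ⟨ψ, h h1, σ, fun x hx => ih (hσ x hx), e⟩

theorem strictModeBasis_subset : strictModeBasis A ⊆ modeBasis A := fun _ h =>
  have ⟨m, hm⟩ := mem_strictModeBasis_iff.mp h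
  mem_modeBasis_iff.mpr ⟨m, hm.1⟩

theorem Formula.Allowed.subst_mem_Comp {k : ℕ} {s : Set ℕ} {ψ : Formula A}
    (h : Formula.Allowed m s ψ) {σ : ℕ → Formula A}
    (hσ : ∀ x ∈ s, σ x ∈ Comp (strictModeBasis A) k) :
    ψ.subst σ ∈ Comp (strictModeBasis A) (k + 1) :=
  ⟨ψ, mem_strictModeBasis_iff.mpr ⟨m, h.1⟩, σ, fun x hx => hσ x (h.2 hx), rfl⟩

theorem Formula.Allowed.mem_Comp {ψ : Formula A} (h : Formula.Allowed m ∅ ψ) :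
    ψ ∈ Comp (strictModeBasis A) 1 :=
  ψ.subst_var ▸ h.subst_mem_Comp fun _ hx => hx.elim

/-- A formula that holds nowhere, with `k` nested modalities of alternating modes, the outermost of
mode `m`. -/
def chain (A : Type) : Mode → ℕ → Formula A
  | _, 0 => .falsum
  | m, k + 1 => .modal m.next (chain A m.other k)

theorem le_alternation_chain (m : Mode) (k : ℕ) : k ≤ (chain A m k).alternation m.other := by
  induction k generalizing m with
  | zero => exact Nat.zero_le _
  | succ k ih =>
    rw [chain, Formula.alternation, if_neg m.next_notMem_other]
    exact Nat.succ_le_succ (ih m.other)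

theorem sem_chain {P : Type v} [LinearOrder P] {D : Type u} (w : P → A × D) (v : ℕ → Set P)
    (m : Mode) (k : ℕ) : (chain A m k).sem w v = ∅ := by
  induction k generalizing m with
  | zero => exact Set.eq_empty_of_forall_notMem fun i h => h.2 h.1
  | succ k ih =>
    refine Set.eq_empty_of_forall_notMem ?_
    rintro i ⟨j, -, h⟩
    rwa [ih] at h

theorem chain_mem_Comp (m : Mode) (k : ℕ) : chain A m (k + 1) ∈ Comp (strictModeBasis A) (k + 1) := by
  induction k generalizing m with
  | zero => exact (Formula.Allowed.modal m.next_mem .falsum).mem_Comp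
  | succ k ih =>
    exact (Formula.Allowed.modal m.next_mem (.var (Set.mem_singleton 0))).subst_mem_Comp
      (σ := fun _ => chain A m.other (k + 1)) fun _ _ => ih m.other

/-- Every formula of the hierarchy is equivalent to one whose height is any given upper bound, where
the height does not depend on the basis. -/
theorem exists_hasCompHeight {k : ℕ} {φ : Formula A} (h : φ ∈ Comp (strictModeBasis A) k) :
    ∃ φ', HasCompHeight (modeBasis A) φ' k ∧ HasCompHeight (strictModeBasis A) φ' k ∧
      ∀ {P : Type} [LinearOrder P] {D : Type u} (w : P → A × D) (i : P),
        φ'.Holds w i ↔ φ.Holds w i := by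
  suffices H : ∃ φ' ∈ Comp (strictModeBasis A) k, (∃ m : Mode, k ≤ φ'.alternation m) ∧
      ∀ {P : Type} [LinearOrder P] {D : Type u} (w : P → A × D) (i : P),
        φ'.Holds w i ↔ φ.Holds w i by
    obtain ⟨φ', h1, ⟨m, h2⟩, h3⟩ := H
    have hle : ∀ i, φ' ∈ Comp (modeBasis A) i → k ≤ i := fun i hi =>
      h2.trans (alternation_le_of_mem_Comp hi m)
    have hsub := Comp_subset_Comp (strictModeBasis_subset (A := A))
    exact ⟨φ', ⟨hsub k h1, fun i hi => hle i hi⟩, ⟨h1, fun i hi => hle i (hsub i hi)⟩, h3⟩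
  cases k with
  | zero => exact h.elim
  | succ k =>
    obtain ⟨ψ, hψ, σ, hσ, rfl⟩ := h
    obtain ⟨m, hm⟩ := mem_strictModeBasis_iff.mp hψ
    obtain ⟨x, hx⟩ := ψ.finite_freeVars.exists_notMem
    have hclosed : ∀ y ∈ ψ.freeVars, (σ y).freeVars = ∅ := fun y hy => freeVars_of_mem_Comp (hσ y hy)
    -- At height `1` nothing can be substituted, since level `0` is empty, so the chain of length
    -- `1` is added to `ψ` itself. At greater height a chain in the other mode, one level down, is
    -- substituted for a fresh variable `x` under a modality of mode `m`.
    cases k with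
    | zero =>
      refine ⟨(Formula.or ψ (chain A m 1)).subst σ, Formula.Allowed.subst_mem_Comp (m := m)
        (s := ψ.freeVars) (.or ⟨hm, subset_rfl⟩ (.modal m.next_mem .falsum)) hσ,
        ⟨m.other, (le_alternation_chain m 1).trans (le_max_right _ _)⟩, fun w i => ?_⟩
      refine or_iff_left fun h => ?_
      have := sem_chain (A := A) w (fun _ => ∅) m 1
      exact Set.notMem_empty i (this ▸ h)
    | succ k =>
      have hne : ∀ y ∈ ψ.freeVars, Function.update σ x (chain A m.other (k + 1)) y = σ y :=
        fun y hy => Function.update_of_ne (by rintro rfl; exact hx hy) _ _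
      have hchain : Function.update σ x (chain A m.other (k + 1)) x = chain A m.other (k + 1) :=
        Function.update_self ..
      have heq : (Formula.modal m.next (.var x)).subst
          (Function.update σ x (chain A m.other (k + 1))) = chain A m (k + 2) := by
        rw [Formula.subst, Formula.subst, hchain]; rfl
      refine ⟨(Formula.or ψ (.modal m.next (.var x))).subst
        (Function.update σ x (chain A m.other (k + 1))), Formula.Allowed.subst_mem_Comp (m := m)
        (s := insert x ψ.freeVars) (.or ⟨hm, Set.subset_insert _ _⟩ (.modal m.next_mem
        (.var (Set.mem_insert _ _)))) ?_, ⟨m.other, ?_⟩, fun w i => ?_⟩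
      · rintro y (rfl | hy)
        · rw [hchain]; exact chain_mem_Comp _ _
        · rw [hne y hy]; exact hσ y hy
      · rw [Formula.subst, heq]
        exact (le_alternation_chain m (k + 2)).trans (le_max_right _ _)
      · unfold Formula.Holds
        rw [Formula.subst, heq, Formula.sem, sem_chain, Set.union_empty,
          ψ.sem_subst w _ fun y hy => by rw [hne y hy]; exact hclosed y hy,
          ψ.sem_subst w σ hclosed, ψ.sem_congr w fun y hy => by rw [hne y hy]]

end Hierarchy

/-! ### From cascades to formulas -/

/-- The levels of the strict hierarchy, where the letters are added as level `0`. -/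
def letterComp (A : Type) : ℕ → Set (Formula A)
  | 0 => Set.range fun a => .atom (.letter a)
  | i + 1 => Comp (strictModeBasis A) (i + 1)

theorem letterComp_subset (A : Type) (i : ℕ) :
    letterComp A i ⊆ Comp (strictModeBasis A) (max i 1) := by
  cases i with
  | zero =>
    rintro _ ⟨a, rfl⟩
    exact (Formula.Allowed.letter (m := .glob)).mem_Comp
  | succ i => exact Comp_mono _ (le_max_left _ _)

theorem freeVars_of_mem_letterComp {A : Type} {i : ℕ} {φ : Formula A} (h : φ ∈ letterComp A i) :
    φ.freeVars = ∅ :=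
  freeVars_of_mem_Comp (letterComp_subset A i h)

/-- Letters belong to both modes, so substituting them leaves the formula in the strict basis.
Counting letters as level `0` is what makes a first stage cost only one level. -/
theorem Formula.Allowed.subst_mem_letterComp {A : Type} {m : Mode} {i : ℕ} {s : Set ℕ}
    {ψ : Formula A} (h : Formula.Allowed m s ψ) {σ : ℕ → Formula A}
    (hσ : ∀ x ∈ s, σ x ∈ letterComp A i) : ψ.subst σ ∈ Comp (strictModeBasis A) (i + 1) := by
  cases i with
  | zero =>
    refine (h.subst (t := ∅) fun x hx => ?_).mem_Comp
    obtain ⟨a, ha⟩ := hσ x hx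
    rw [← ha]
    exact .letter
  | succ i => exact h.subst_mem_Comp hσ

theorem Formula.mem_sem_disj {P : Type v} [LinearOrder P] {A : Type} {D : Type u} {w : P → A × D}
    {v : ℕ → Set P} {ι : Type} [Finite ι] {f : ι → Formula A} {i : P} :
    i ∈ (Formula.disj f).sem w v ↔ ∃ j, i ∈ (f j).sem w v := by
  have : ∀ l : List (Formula A), i ∈ (disjList l).sem w v ↔ ∃ φ ∈ l, i ∈ φ.sem w v := by
    intro l
    induction l with
    | nil => simpa [disjList] using fun h : i ∈ falsum.sem w v => h.2 h.1
    | cons φ l ih =>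
      rw [List.exists_mem_cons_iff, ← ih]
      rfl
  simp [disj, this]

section CascadeToFormula

variable {K : WordKind D} {A : Type}

/-- Induction along the cascade, with `β` defining the current input letters. The formulas for the
output of a stage become the input formulas of the next one. The list `S` collects, for each stage,
the sentence that some output letter is defined; by functionality, its truth at all positions means
that the stage succeeds. The output formulas are meaningful only if all earlier stages succeed,
which the sentences placed before them in `S` ensure. -/
theorem Cascade.exists_formulas (hK : K.DefinesOutputs) {B C : Type} (c : Cascade K.Trans B C)
    (hB : Finite B) (i : ℕ) (β : B → Formula A) (hβ : ∀ b, β b ∈ letterComp A i) :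
    ∃ (γ : C → Formula A) (S : List (Formula A)), (∀ o, γ o ∈ letterComp A (i + c.height)) ∧
      (∀ s ∈ S, s ∈ Comp (strictModeBasis A) (i + c.height)) ∧
      ∀ n (w : K.Pos n → A × D) (ℓ : K.Pos n → B), (∀ b j, (β b).Holds w j ↔ ℓ j = b) →
        (∀ w', c.Runs (relabel w ℓ) w' → ∀ o j, (γ o).Holds w j ↔ (w' j).1 = o) ∧
        ((∃ w', c.Runs (relabel w ℓ) w') ↔ ∀ s ∈ S, ∀ j, s.Holds w j) := by
  induction c generalizing i with
  | nil B =>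
    refine ⟨β, [], hβ, by simp, fun n w ℓ h => ⟨?_, by simp [Cascade.Runs]⟩⟩
    rintro _ rfl o j
    exact h o j
  | @cons B C C' hC t c ih =>
    obtain ⟨N, ⟨e⟩⟩ := Finite.exists_equiv_fin B
    obtain ⟨m, hm⟩ := hK A B C hB t
    obtain ⟨ψ, hψ, hψ'⟩ := hm N (fun b => e b) fun b => (e b).2
    -- The variables below `N` number the letters of `B`; the default value is never used, as all
    -- formulas involved have their free variables below `N`.
    let σ : ℕ → Formula A := fun x => if h : x < N then β (e.symm ⟨x, h⟩) else .falsum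
    have hσe : ∀ b, σ (e b) = β b := fun b => by
      simp only [σ, dif_pos (e b).2, Fin.eta, Equiv.symm_apply_apply]
    have hσ : ∀ x ∈ Set.Iio N, σ x ∈ letterComp A i := fun x hx => by
      simp only [σ, dif_pos (show x < N from hx)]
      exact hβ _
    have hcl : ∀ {φ : Formula A}, Formula.Allowed m (Set.Iio N) φ →
        ∀ x ∈ φ.freeVars, (σ x).freeVars = ∅ :=
      fun h x hx => freeVars_of_mem_letterComp (hσ x (h.2 hx))
    have hd := Formula.Allowed.disj hψ
    obtain ⟨γ, S, h1, h2, h3⟩ := ih hC (i + 1) (fun o => (ψ o).subst σ)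
      fun o => (hψ o).subst_mem_letterComp hσ
    rw [Nat.add_assoc, Nat.add_comm 1] at h1 h2
    refine ⟨γ, (Formula.disj ψ).subst σ :: S, h1, ?_, fun n w ℓ hℓ => ?_⟩
    · rintro s (_ | ⟨_, hs⟩)
      -- The test of this stage has level `i + 1`, which is within the bound because the cascade
      -- contains at least this stage.
      · exact Comp_mono _ (by simp only [Cascade.height]; omega) (hd.subst_mem_letterComp hσ)
      · exact h2 s hs
    obtain ⟨h4, h5⟩ := hψ' n w ℓ (fun x => (σ x).sem w fun _ => ∅) fun b j => by
      rw [hσe]; exact hℓ b j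
    have hrun : ∀ w₁, K.Run t (relabel w ℓ) w₁ → w₁ = relabel w (fun j => (w₁ j).1) ∧
        ∀ o j, ((ψ o).subst σ).Holds w j ↔ (w₁ j).1 = o := fun w₁ h => by
      refine ⟨eq_relabel_iff.mpr fun j => ⟨(h4 w₁ h).1 j, rfl⟩, fun o j => ?_⟩
      unfold Formula.Holds
      rw [Formula.sem_subst w _ σ (hcl (hψ o))]
      exact (h4 w₁ h).2 j o
    have hdisj : ∀ j, ((Formula.disj ψ).subst σ).Holds w j ↔
        ∃ o, j ∈ (ψ o).sem w fun x => (σ x).sem w fun _ => ∅ := fun j => by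
      unfold Formula.Holds
      rw [Formula.sem_subst w _ σ (hcl hd), Formula.mem_sem_disj]
    constructor
    · rintro w' ⟨w₁, hw₁, hw'⟩
      obtain ⟨h6, h7⟩ := hrun w₁ hw₁
      rw [h6] at hw'
      exact (h3 n w _ h7).1 w' hw'
    · simp only [List.forall_mem_cons, hdisj]
      constructor
      · rintro ⟨w', w₁, hw₁, hw'⟩
        obtain ⟨h6, h7⟩ := hrun w₁ hw₁
        rw [h6] at hw'
        exact ⟨fun j => ⟨_, ((h4 w₁ hw₁).2 j _).mpr rfl⟩, (h3 n w _ h7).2.mp ⟨w', hw'⟩⟩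
      · rintro ⟨hd, hS⟩
        obtain ⟨w₁, hw₁⟩ := h5 hd
        obtain ⟨h6, h7⟩ := hrun w₁ hw₁
        obtain ⟨w', hw'⟩ := (h3 n w _ h7).2.mpr hS
        exact ⟨w', w₁, hw₁, h6 ▸ hw'⟩

/-- The conjunction of the variables `1, …, n`. -/
def Formula.conjVars (A : Type) : ℕ → Formula A
  | 0 => .or (.atom .S) (.natom .S)
  | n + 1 => .and (.var (n + 1)) (Formula.conjVars A n)

theorem Formula.mem_sem_conjVars {P : Type v} [LinearOrder P] {w : P → A × D} {v : ℕ → Set P}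
    {n : ℕ} {i : P} : i ∈ (Formula.conjVars A n).sem w v ↔ ∀ j < n, i ∈ v (j + 1) := by
  induction n with
  | zero => exact ⟨fun _ _ h => absurd h (Nat.not_lt_zero _), fun _ => em (i ∈ Atom.S.sem w)⟩
  | succ n ih =>
    rw [Nat.forall_lt_succ_right, ← ih, and_comm]
    rfl

theorem Formula.allowed_conjVars (A : Type) (m : Mode) (n : ℕ) :
    Formula.Allowed m (Set.Icc 1 n) (Formula.conjVars A n) := by
  induction n with
  | zero => exact .or .S .not_S
  | succ n ih =>
    exact .and (.var ⟨by omega, le_rfl⟩) (ih.mono (Set.Icc_subset_Icc_right (Nat.le_succ n)))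

/-- The conjunction of the variables `1, …, n` holds at the current and all later positions. -/
def Formula.alwaysVars (A : Type) (n : ℕ) : Formula A :=
  .nu 0 (.and (Formula.conjVars A n) (.or (.atom .lastG) (.modal .Xg (.var 0))))

theorem Formula.allowed_alwaysVars (A : Type) (n : ℕ) :
    Formula.Allowed .glob (Set.Icc 1 n) (Formula.alwaysVars A n) :=
  .nu (.and ((allowed_conjVars A .glob n).mono (Set.subset_insert _ _))
    (.or (.last (m := .glob)) (.modal Mode.glob.next_mem (.var (Set.mem_insert _ _)))))

/-- From the least position every position is reached by finitely many successor steps, so a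
post-fixed point that contains the first position contains all of them. In the other direction the
set of all positions is post-fixed, the disjunct `lastG` taking care of a greatest position. -/
theorem Formula.mem_sem_alwaysVars {P : Type v} [LinearOrder P] [LocallyFiniteOrder P]
    {w : P → A × D} {v : ℕ → Set P} {n : ℕ} {i : P} (hi : ∀ j, i ≤ j) :
    i ∈ (Formula.alwaysVars A n).sem w v ↔ ∀ j < n, ∀ k, k ∈ v (j + 1) := by
  let := LinearLocallyFiniteOrder.succOrder P
  have hv : ∀ T k, k ∈ (Formula.conjVars A n).sem w (Function.update v 0 T) ↔
      ∀ j < n, k ∈ v (j + 1) := fun T k => by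
    simp [Formula.mem_sem_conjVars]
  constructor
  · rintro ⟨T, hT, hiT⟩ j hj k
    suffices H : k ∈ T from (hv T k).mp (hT H).1 j hj
    refine Succ.rec (P := fun k _ => k ∈ T) hiT (fun l _ hl => ?_) (hi k)
    rcases (hT hl).2 with h | ⟨l', h, h'⟩
    · rwa [Order.succ_eq_iff_isMax.mpr fun l' _ => h l']
    · simp only [Formula.sem, Function.update_self] at h'
      rwa [Order.succ_eq_of_covBy h]
  · intro h
    refine ⟨Set.univ, fun k _ => ⟨(hv _ k).mpr fun j hj => h j hj k, ?_⟩, trivial⟩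
    by_cases hk : IsMax k
    · exact .inl fun l => (le_total l k).elim id fun h => hk h
    · exact .inr ⟨Order.succ k, Order.covBy_succ_of_not_isMax hk, by simp [Formula.sem]⟩

variable [Finite A] (hK : K.DefinesOutputs) {B : Type} (c : Cascade K.Trans A B)
include hK

theorem Cascade.exists_formulas_of_letters : ∃ (γ : B → Formula A) (S : List (Formula A)),
    (∀ o, γ o ∈ letterComp A c.height) ∧
    (∀ s ∈ S, s ∈ Comp (strictModeBasis A) c.height) ∧
    ∀ n (w : K.Pos n → A × D),
      (∀ w', c.Runs w w' → ∀ o j, (γ o).Holds w j ↔ (w' j).1 = o) ∧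
      ((∃ w', c.Runs w w') ↔ ∀ s ∈ S, ∀ j, s.Holds w j) := by
  obtain ⟨γ, S, h1, h2, h3⟩ := c.exists_formulas hK inferInstance 0
    (fun a => .atom (.letter a)) fun a => ⟨a, rfl⟩
  rw [Nat.zero_add] at h1 h2
  exact ⟨γ, S, h1, h2, fun n w => h3 n w (fun j => (w j).1) fun b j => Iff.rfl⟩

/-- The maximum with `1` matters only for the empty cascade, whose output formulas are letters and
have height `1`. -/
theorem Cascade.exists_output_formula (b : B) : ∃ φ : Formula A,
    HasCompHeight (modeBasis A) φ (max c.height 1) ∧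
    HasCompHeight (strictModeBasis A) φ (max c.height 1) ∧
    ∀ n (w : K.Pos n → A × D) w', c.Runs w w' → ∀ i, φ.Holds w i ↔ (w' i).1 = b := by
  obtain ⟨γ, S, h1, h2, h3⟩ := c.exists_formulas_of_letters hK
  obtain ⟨φ, h4, h5, h6⟩ := exists_hasCompHeight (letterComp_subset A _ (h1 b))
  exact ⟨φ, h4, h5, fun n w w' hw i => (h6 w i).trans ((h3 n w).1 w' hw b i)⟩

theorem Cascade.exists_language_formula [∀ n, LocallyFiniteOrder (K.Pos n)] : ∃ φ : Formula A,
    HasCompHeight (modeBasis A) φ (c.height + 1) ∧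
    HasCompHeight (strictModeBasis A) φ (c.height + 1) ∧
    ∀ n (w : K.Pos n → A × D), φ.Holds w (K.start n) ↔ ∃ w', c.Runs w w' := by
  obtain ⟨γ, S, h1, h2, h3⟩ := c.exists_formulas_of_letters hK
  -- The variable `0` is bound by the greatest fixpoint, so the sentences in `S` are numbered from
  -- `1`; the default value lies outside the range used.
  have hσ : ∀ x ∈ Set.Icc 1 S.length, S.getD (x - 1) .falsum ∈
      Comp (strictModeBasis A) c.height := fun x hx => by
    have : x - 1 < S.length := by have := hx.1; have := hx.2; omega
    rw [List.getD_eq_getElem _ _ this]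
    exact h2 _ (List.getElem_mem this)
  have hal := Formula.allowed_alwaysVars A S.length
  obtain ⟨φ, h4, h5, h6⟩ := exists_hasCompHeight (hal.subst_mem_Comp hσ)
  refine ⟨φ, h4, h5, fun n w => (h6 w _).trans ?_⟩
  unfold Formula.Holds
  rw [Formula.sem_subst w _ _ fun x hx => freeVars_of_mem_Comp (hσ x (hal.2 hx)),
    Formula.mem_sem_alwaysVars (K.start_le n), (h3 n w).2]
  simp only [Nat.add_sub_cancel]
  constructor
  · rintro h s hs j
    obtain ⟨l, hl, rfl⟩ := List.getElem_of_mem hs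
    have := h l hl j
    rwa [List.getD_eq_getElem _ _ hl] at this
  · intro h l hl j
    rw [List.getD_eq_getElem _ _ hl]
    exact h _ (List.getElem_mem hl) j

end CascadeToFormula

/-! ### The two kinds of words -/

variable {A B : Type}

theorem Cascade.runs_finiteKind {n : ℕ} (C : Cascade DataTransducer A B)
    (w : Fin (n + 1) → A × D) (w' : Fin (n + 1) → B × D) :
    Cascade.Runs (K := finiteKind D) (n := n) C w w' ↔ C.Outputs w w' := by
  induction C with
  | nil A => exact Iff.rfl
  | cons h t c ih => exact exists_congr fun w₁ => and_congr_right fun _ => ih w₁ w'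

theorem Cascade.runs_omegaKind (C : Cascade DataOmegaTransducer A B)
    (w : DataOmegaWord A D) (w' : DataOmegaWord B D) :
    Cascade.Runs (K := omegaKind D) (n := ()) C w w' ↔ C.OmegaOutputs w w' := by
  induction C with
  | nil A => exact Iff.rfl
  | cons h t c ih => exact exists_congr fun w₁ => and_congr_right fun _ => ih w₁ w'

instance (n : (finiteKind D).Index) : LocallyFiniteOrder ((finiteKind D).Pos n) :=
  inferInstanceAs (LocallyFiniteOrder (Fin (n + 1)))

instance (n : (omegaKind D).Index) : LocallyFiniteOrder ((omegaKind D).Pos n) :=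
  inferInstanceAs (LocallyFiniteOrder ℕ)

theorem exists_cascade_computes {K : WordKind D} (hK : K.RealizesRegularFn) {k : ℕ}
    {φ : Formula A} (h : φ ∈ Comp (modeBasis A) k) :
    ∃ C : Cascade K.Trans A Bool, C.height = k + 1 ∧ ∀ n (w : K.Pos n → A × D) w',
      C.Runs w w' ↔ ∀ i, (w' i).2 = (w i).2 ∧ ((w' i).1 = true ↔ φ.Holds w i) :=
  have ⟨_, hm⟩ := exists_level_of_mem_Comp_mode h
  hm.exists_cascade_computes hK

theorem exists_cascade_computes_strict {K : WordKind D} (hK : K.RealizesRegularFn) {k : ℕ}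
    {φ : Formula A} (h : φ ∈ Comp (strictModeBasis A) k) :
    ∃ C : Cascade K.Trans A Bool, C.height = k ∧ ∀ n (w : K.Pos n → A × D) w',
      C.Runs w w' ↔ ∀ i, (w' i).2 = (w i).2 ∧ ((w' i).1 = true ↔ φ.Holds w i) := by
  cases k with
  | zero => exact h.elim
  | succ k =>
    obtain ⟨m, hm⟩ := exists_level_of_mem_Comp_strict h
    exact hm.exists_cascade_computes hK

theorem exists_cascade_language_eq {k : ℕ} {φ : Formula A} (h : φ ∈ Comp (modeBasis A) k) :
    ∃ (B : Type) (C : Cascade DataTransducer A B),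
      C.height = k + 1 ∧ C.language D = φ.language D := by
  obtain ⟨B, C, h1, h2⟩ := exists_cascade_language (finiteKind_realizes (D := D)) h
  exact ⟨B, C, h1, Set.ext fun w => Iff.trans
    (exists_congr fun w' => (C.runs_finiteKind w.2 w').symm) (h2 w.1 w.2)⟩

theorem exists_cascade_omegaLanguage_eq {k : ℕ} {φ : Formula A} (h : φ ∈ Comp (modeBasis A) k) :
    ∃ (B : Type) (C : Cascade DataOmegaTransducer A B),
      C.height = k + 1 ∧ C.omegaLanguage D = φ.omegaLanguage D := by
  obtain ⟨B, C, h1, h2⟩ := exists_cascade_language (omegaKind_realizes (D := D)) h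
  exact ⟨B, C, h1, Set.ext fun w => Iff.trans
    (exists_congr fun w' => (C.runs_omegaKind w w').symm) (h2 () w)⟩

theorem Cascade.exists_formula_language_eq (D : Type u) [Finite A]
    (C : Cascade DataTransducer A B) : ∃ φ : Formula A,
      HasCompHeight (modeBasis A) φ (C.height + 1) ∧
      HasCompHeight (strictModeBasis A) φ (C.height + 1) ∧ φ.language D = C.language D := by
  obtain ⟨φ, h1, h2, h3⟩ := Cascade.exists_language_formula (K := finiteKind D)
    finiteKind_definesOutputs C
  exact ⟨φ, h1, h2, Set.ext fun w => (h3 w.1 w.2).trans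
    (exists_congr fun w' => C.runs_finiteKind w.2 w')⟩

theorem Cascade.exists_formula_omegaLanguage_eq (D : Type u) [Finite A]
    (C : Cascade DataOmegaTransducer A B) : ∃ φ : Formula A,
      HasCompHeight (modeBasis A) φ (C.height + 1) ∧
      HasCompHeight (strictModeBasis A) φ (C.height + 1) ∧
      φ.omegaLanguage D = C.omegaLanguage D := by
  obtain ⟨φ, h1, h2, h3⟩ := Cascade.exists_language_formula (K := omegaKind D)
    omegaKind_definesOutputs C
  exact ⟨φ, h1, h2, Set.ext fun w => (h3 () w).trans
    (exists_congr fun w' => C.runs_omegaKind w w')⟩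

end DataWords

theorem mainTheorem6 (A : Type) [Finite A] (D : Type*) [Infinite D] :
    -- data words
    ((∀ X : Set (DataWords.DataWord A D),
        (∃ φ ∈ DataWords.BMA A, φ.language D = X) ↔
          ∃ (B : Type) (C : DataWords.Cascade DataWords.DataTransducer A B), C.language D = X) ∧
      (∀ (φ : DataWords.Formula A) (k : ℕ),
        DataWords.HasCompHeight (DataWords.modeBasis A) φ k →
          (∃ (B : Type) (C : DataWords.Cascade DataWords.DataTransducer A B),
            C.height = k + 1 ∧ C.language D = φ.language D) ∧
          (∃ C : DataWords.Cascade DataWords.DataTransducer A Bool,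
            C.height = k + 1 ∧ C.Computes D φ)) ∧
      (∀ (φ : DataWords.Formula A) (k : ℕ),
        DataWords.HasCompHeight (DataWords.strictModeBasis A) φ k →
          ∃ C : DataWords.Cascade DataWords.DataTransducer A Bool,
            C.height = k ∧ C.Computes D φ) ∧
      (∀ (B : Type) (C : DataWords.Cascade DataWords.DataTransducer A B),
        (∃ φ : DataWords.Formula A,
          DataWords.HasCompHeight (DataWords.modeBasis A) φ (C.height + 1) ∧
          DataWords.HasCompHeight (DataWords.strictModeBasis A) φ (C.height + 1) ∧
          φ.language D = C.language D) ∧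
        (∀ b : B, ∃ φ : DataWords.Formula A,
          DataWords.HasCompHeight (DataWords.modeBasis A) φ (max C.height 1) ∧
          DataWords.HasCompHeight (DataWords.strictModeBasis A) φ (max C.height 1) ∧
          ∀ (w : DataWords.DataWord A D) (w' : Fin (w.1 + 1) → B × D),
            C.Outputs w.2 w' → ∀ i, φ.Holds w.2 i ↔ (w' i).1 = b))) ∧
    -- data ω-words
    ((∀ X : Set (DataWords.DataOmegaWord A D),
        (∃ φ ∈ DataWords.BMA A, φ.omegaLanguage D = X) ↔
          ∃ (B : Type) (C : DataWords.Cascade DataWords.DataOmegaTransducer A B),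
            C.omegaLanguage D = X) ∧
      (∀ (φ : DataWords.Formula A) (k : ℕ),
        DataWords.HasCompHeight (DataWords.modeBasis A) φ k →
          (∃ (B : Type) (C : DataWords.Cascade DataWords.DataOmegaTransducer A B),
            C.height = k + 1 ∧ C.omegaLanguage D = φ.omegaLanguage D) ∧
          (∃ C : DataWords.Cascade DataWords.DataOmegaTransducer A Bool,
            C.height = k + 1 ∧ C.OmegaComputes D φ)) ∧
      (∀ (φ : DataWords.Formula A) (k : ℕ),
        DataWords.HasCompHeight (DataWords.strictModeBasis A) φ k →
          ∃ C : DataWords.Cascade DataWords.DataOmegaTransducer A Bool,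
            C.height = k ∧ C.OmegaComputes D φ) ∧
      (∀ (B : Type) (C : DataWords.Cascade DataWords.DataOmegaTransducer A B),
        (∃ φ : DataWords.Formula A,
          DataWords.HasCompHeight (DataWords.modeBasis A) φ (C.height + 1) ∧
          DataWords.HasCompHeight (DataWords.strictModeBasis A) φ (C.height + 1) ∧
          φ.omegaLanguage D = C.omegaLanguage D) ∧
        (∀ b : B, ∃ φ : DataWords.Formula A,
          DataWords.HasCompHeight (DataWords.modeBasis A) φ (max C.height 1) ∧
          DataWords.HasCompHeight (DataWords.strictModeBasis A) φ (max C.height 1) ∧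
          ∀ (w : DataWords.DataOmegaWord A D) (w' : DataWords.DataOmegaWord B D),
            C.OmegaOutputs w w' → ∀ i, φ.Holds w i ↔ (w' i).1 = b))) := by
  refine ⟨⟨fun X => ⟨?_, ?_⟩, fun φ k h => ⟨DataWords.exists_cascade_language_eq h.1, ?_⟩,
    fun φ k h => ?_, fun B C => ⟨C.exists_formula_language_eq D, fun b => ?_⟩⟩,
    fun X => ⟨?_, ?_⟩, fun φ k h => ⟨DataWords.exists_cascade_omegaLanguage_eq h.1, ?_⟩,
    fun φ k h => ?_, fun B C => ⟨C.exists_formula_omegaLanguage_eq D, fun b => ?_⟩⟩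
  · rintro ⟨φ, hφ, rfl⟩
    obtain ⟨k, hk⟩ := Set.mem_iUnion.mp hφ
    obtain ⟨B, C, -, h⟩ := DataWords.exists_cascade_language_eq (D := D) hk
    exact ⟨B, C, h⟩
  · rintro ⟨B, C, rfl⟩
    obtain ⟨φ, h, -, h'⟩ := C.exists_formula_language_eq D
    exact ⟨φ, Set.mem_iUnion.mpr ⟨_, h.1⟩, h'⟩
  · obtain ⟨C, h1, h2⟩ := DataWords.exists_cascade_computes
      (DataWords.finiteKind_realizes (D := D)) h.1
    exact ⟨C, h1, fun w w' => (C.runs_finiteKind w.2 w').symm.trans (h2 w.1 w.2 w')⟩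
  · obtain ⟨C, h1, h2⟩ := DataWords.exists_cascade_computes_strict
      (DataWords.finiteKind_realizes (D := D)) h.1
    exact ⟨C, h1, fun w w' => (C.runs_finiteKind w.2 w').symm.trans (h2 w.1 w.2 w')⟩
  · obtain ⟨φ, h1, h2, h3⟩ := DataWords.Cascade.exists_output_formula (K := DataWords.finiteKind D)
      DataWords.finiteKind_definesOutputs C b
    exact ⟨φ, h1, h2, fun w w' h => h3 w.1 w.2 w' ((C.runs_finiteKind w.2 w').mpr h)⟩
  · rintro ⟨φ, hφ, rfl⟩
    obtain ⟨k, hk⟩ := Set.mem_iUnion.mp hφ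
    obtain ⟨B, C, -, h⟩ := DataWords.exists_cascade_omegaLanguage_eq (D := D) hk
    exact ⟨B, C, h⟩
  · rintro ⟨B, C, rfl⟩
    obtain ⟨φ, h, -, h'⟩ := C.exists_formula_omegaLanguage_eq D
    exact ⟨φ, Set.mem_iUnion.mpr ⟨_, h.1⟩, h'⟩
  · obtain ⟨C, h1, h2⟩ := DataWords.exists_cascade_computes
      (DataWords.omegaKind_realizes (D := D)) h.1
    exact ⟨C, h1, fun w w' => (C.runs_omegaKind w w').symm.trans (h2 () w w')⟩
  · obtain ⟨C, h1, h2⟩ := DataWords.exists_cascade_computes_strict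
      (DataWords.omegaKind_realizes (D := D)) h.1
    exact ⟨C, h1, fun w w' => (C.runs_omegaKind w w').symm.trans (h2 () w w')⟩
  · obtain ⟨φ, h1, h2, h3⟩ := DataWords.Cascade.exists_output_formula (K := DataWords.omegaKind D)
      DataWords.omegaKind_definesOutputs C b
    exact ⟨φ, h1, h2, fun w w' h => h3 () w w' ((C.runs_omegaKind w w').mpr h)⟩
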